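/- Let $d\ge 1$ and let $U\in\mathcal C^2(\mathbb R^d)$ satisfy, for some $L,m>0$ and all $x,y\in\mathbb R^d$, $$|\nabla U(x)-\nabla U(y)|\le L|x-y|,\qquad (x-y)\cdot(\nabla U(x)-\nabla U(y))\ge m|x-y|^2 .$$ Let $\gamma\ge 2\sqrt L$ and $0<\delta\le m/(33\gamma^3)$. Put $\eta=e^{-\delta\gamma/2}$, $H(x,v)=U(x)+|v|^2/2$, let $\pi$ be the probability measure on $\mathbb R^{2d}$ with density proportional to $e^{-H}$, and let $$\Phi_V(x,v)=\big(x',\,v-\tfrac\delta2(\nabla U(x)+\nabla U(x'))\big),\quad x'=x+\delta v-\tfrac{\delta^2}{2}\nabla U(x),\qquad \alpha(x,v)=\exp\!\big(-(H(\Phi_V(x,v))-H(x,v))_+\big).$$ *The chains.* Let $G,G'$ be standard Gaussian vectors of $\mathbb R^d$ and $W$ uniform on $[0,1]$, all independent. From $(x_0,v_0)$, set $v_0'=\eta v_0+\sqrt{1-\eta^2}\,G$. One step of the OBABO chain, with kernel $P$, sets $(x_1,v_1')=\Phi_V(x_0,v_0')$. One step of the Metropolis-adjusted OM(BAB)O chain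 sets $(x_1,v_1')=\Phi_V(x_0,v_0')$ if $W\le\alpha(x_0,v_0')$ and $(x_1,v_1')=(x_0,-v_0')$ otherwise. In both cases the new state is $(x_1,\eta v_1'+\sqrt{1-\eta^2}\,G')$. *Notation.* $\mathcal W_1$ is the Wasserstein distance on $\mathbb R^{2d}$ for the Euclidean distance, and $\mathcal P_p(\mathbb R^{2d})$ the set of probability measures with finite $p$-th moment. A probability measure $\nu$ satisfies a log-Sobolev inequality with constant $C$ if $\int f^2\ln f^2\,d\nu-\int f^2d\nu\,\ln\int f^2d\nu\le C\int|\nabla f|^2d\nu$ for all bounded Lipschitz $f$ of class $\mathcal C^1$. Put $$K_1=\sqrt3\max(L^{1/2},L^{-1/2}),\quad \kappa=\frac m{3\gamma},\quad C_{lS}=\frac6mK_1^2\gamma^2\Big(1+\delta+\frac{\delta^2L}2\Big)^2,$$ $$K_3=L\Big[1+e^{L\delta^2}\Big(\frac\delta6+\frac{\delta^2L}{24}\Big)\Big]\Big(1+\frac{\delta L}{2\sqrt m}\Big),\qquad A=1+\frac1{\sqrt m}+\frac{2\delta K_1K_3}\kappa,$$ $$K_9=2L(K_1+3)^2A^2\Big(1+\frac1\kappa\Big)\Big[\frac{\delta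 L}8+\Big(1+\frac\delta4+\frac{\delta^2L}4\Big)\Big(1+\frac{\delta^2L^2}4\Big)\Big],$$ and, for $\ell\ge2$ and $L_\ell>0$, $$K_{10}=\Big[1+2^\ell(K_1+3)^{\ell+1}A^{\ell+1}\Big(\frac1\kappa+1\Big)\Big]\Big[\frac{L+2L^2}4\Big(1+\frac{\delta^2L^2}4\Big)+2^{\frac{\ell-3}2}L_\ell\Big(1+\frac{L\delta}2\Big)^3\Big(1+\delta+\frac{\delta^2L}2\Big)^{\ell-2}\Big].$$ **Theorem.** $U$ has a unique global minimum point $x_\star$; $P$ has a unique invariant probability measure $\pi_\delta$, and $\pi_\delta\in\mathcal P_p(\mathbb R^{2d})$ for all $p\ge1$. There is a real-valued $\mathcal E(\nu,\delta,n,d)$ such that (a), (b), (c) and the concentration inequality below hold. Here $M_{\nu,p}=\int|z-(x_\star,0)|^p\,\nu(dz)$. (a) For all $\nu\in\mathcal P_2(\mathbb R^{2d})$ and $n\ge1$: $\ \mathcal E(\nu,\delta,n,d)\le\delta K_9\,(M_{\nu,2}+\delta nd)$. (b) Let $\ell\ge2$ and $L_\ell>0$ be such that $|\nabla^2U(y)-\nabla^2U(x)|\le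 L_\ell|x-y|\,(2+|x-x_\star|^{\ell-2}+|y-x_\star|^{\ell-2})/4$ for all $x,y\in\mathbb R^d$ (operator norm). Then for all $\nu\in\mathcal P_{\ell+1}(\mathbb R^{2d})$ and $n\ge1$: $$\mathcal E(\nu,\delta,n,d)\le\delta^2K_{10}\big(M_{\nu,\ell+1}+\delta n(d+\ell-1)^{(\ell+1)/2}\big).$$ (c) Let $\ell\ge2$, $L_\ell>0$, an orthogonal map $\mathcal Q$ of $\mathbb R^d$ and $U_1,\dots,U_d\in\mathcal C^2(\mathbb R)$ be such that $U(\mathcal Qy)=\sum_{i=1}^dU_i(y_i)$ for all $y\in\mathbb R^d$ and, with $y_\star=\mathcal Q^{-1}x_\star$, for all $i$ and $s,t\in\mathbb R$, $|U_i''(t)-U_i''(s)|\le L_\ell|s-t|\,(2+|s-y_{\star,i}|^{\ell-2}+|t-y_{\star,i}|^{\ell-2})/4$. Then for all $\nu\in\mathcal P_{\ell+1}(\mathbb R^{2d})$ and $n\ge1$: $$\mathcal E(\nu,\delta,n,d)\le\delta^2K_{10}\Big(\sum_{i=1}^dM_i+\delta nd\,\ell^{(\ell+1)/2}\Big),\qquad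 M_i=\mathbb E\Big[\big((Y_i-y_{\star,i})^2+V_i^2\big)^{(\ell+1)/2}\Big],$$ where $(\mathcal QY,\mathcal QV)\sim\nu$. *Concentration.* Let the probability measure $\mu_0$ on $\mathbb R^{2d}$ satisfy a log-Sobolev inequality with constant $C'>0$, and let $(Z_k)_{k\ge0}$ be an OM(BAB)O chain with $Z_0\sim\mu_0$. Then every $1$-Lipschitz $\varphi:\mathbb R^{2d}\to\mathbb R$ is $\pi$-integrable and, for all $n\ge1$ and $u\ge0$, $$\mathbb P\Big(\Big|\frac1n\sum_{k=1}^n\varphi(Z_k)-\pi(\varphi)\Big|\ge u+\frac{2K_1}{n\kappa\delta}\mathcal W_1(\mu_0,\pi_\delta)+\mathcal W_1(\pi,\pi_\delta)\Big)\le2\exp\Big(-\frac{nu^2\kappa\delta}{4C_{lS}+4K_1^2C'/(n\kappa\delta)}\Big)+\mathcal E(\mu_0,\delta,n,d).$$ -/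

import Mathlib

open MeasureTheory ProbabilityTheory
open scoped ENNReal

noncomputable section

namespace Langevin

/-- The position (or velocity) space `ℝ^d` with its Euclidean norm. -/
abbrev Pos (d : ℕ) := EuclideanSpace ℝ (Fin d)

/-- The phase space `ℝ^d × ℝ^d = ℝ^{2d}` with its Euclidean norm. -/
abbrev Phase (d : ℕ) := WithLp 2 (Pos d × Pos d)

/-- The point `(x, v)` of the phase space. -/
abbrev mk {d : ℕ} (x v : Pos d) : Phase d := WithLp.toLp 2 (x, v)

/-! ### Assumptions on the potential -/

/-- `|∇U(x) - ∇U(y)| ≤ L |x - y|`. -/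
def GradLip {d : ℕ} (U : Pos d → ℝ) (L : ℝ) : Prop :=
  ∀ x y, ‖gradient U x - gradient U y‖ ≤ L * ‖x - y‖

/-- `(x - y) · (∇U(x) - ∇U(y)) ≥ m |x - y|²`. -/
def StrongConv {d : ℕ} (U : Pos d → ℝ) (m : ℝ) : Prop :=
  ∀ x y, m * ‖x - y‖ ^ 2 ≤ inner ℝ (x - y) (gradient U x - gradient U y)

/-- `|∇²U(y) - ∇²U(x)| ≤ L_ℓ |x - y| (2 + |x - c|^{ℓ-2} + |y - c|^{ℓ-2}) / 4`, where `∇²U` is the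
derivative of the gradient and matrices carry the operator norm. -/
def HessPol {d : ℕ} (U : Pos d → ℝ) (ℓ Lℓ : ℝ) (c : Pos d) : Prop :=
  ∀ x y, ‖fderiv ℝ (gradient U) y - fderiv ℝ (gradient U) x‖ ≤
    Lℓ * ‖x - y‖ * (2 + ‖x - c‖ ^ (ℓ - 2) + ‖y - c‖ ^ (ℓ - 2)) / 4

/-- In the orthonormal coordinates given by `Q`, the potential is a sum of one-dimensional `C²`
potentials: `U (Q y) = ∑ i, u i (y i)`, and
`|uᵢ''(t) - uᵢ''(s)| ≤ L_ℓ |s - t| (2 + |s - cᵢ|^{ℓ-2} + |t - cᵢ|^{ℓ-2}) / 4`,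
where `cᵢ` are the coordinates of `c` in that basis. -/
def Separable {d : ℕ} (U : Pos d → ℝ) (ℓ Lℓ : ℝ) (c : Pos d) (Q : Pos d ≃ₗᵢ[ℝ] Pos d)
    (u : Fin d → ℝ → ℝ) : Prop :=
  (∀ i, ContDiff ℝ 2 (u i)) ∧ (∀ y, U (Q y) = ∑ i, u i (y i)) ∧
    ∀ i, ∀ s t : ℝ, |deriv (deriv (u i)) t - deriv (deriv (u i)) s| ≤
      Lℓ * |s - t| * (2 + |s - Q.symm c i| ^ (ℓ - 2) + |t - Q.symm c i| ^ (ℓ - 2)) / 4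

/-! ### The target measure -/

/-- The Hamiltonian `H(x, v) = U(x) + |v|²/2`. -/
def hamiltonian {d : ℕ} (U : Pos d → ℝ) (z : Phase d) : ℝ := U z.fst + ‖z.snd‖ ^ 2 / 2

/-- The probability measure with Lebesgue density proportional to `exp(-H)`. -/
def gibbs {d : ℕ} (U : Pos d → ℝ) : Measure (Phase d) :=
  (volume : Measure (Phase d)).tilted (fun z => -hamiltonian U z)

/-! ### The unadjusted and the Metropolis-adjusted chains -/

/-- The damping coefficient of a half step, `η = exp(-δγ/2)`. -/
def eta (γ δ : ℝ) : ℝ := Real.exp (-(δ * γ / 2))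

/-- The step O: `(x, v) ↦ (x, η v + √(1 - η²) g)`. -/
def stepO {d : ℕ} (γ δ : ℝ) (z : Phase d) (g : Pos d) : Phase d :=
  mk z.fst (eta γ δ • z.snd + √(1 - eta γ δ ^ 2) • g)

/-- The steps BAB: the velocity Verlet map `Φ_V`. -/
def verlet {d : ℕ} (U : Pos d → ℝ) (δ : ℝ) (z : Phase d) : Phase d :=
  let x' := z.fst + δ • z.snd - (δ ^ 2 / 2) • gradient U z.fst
  mk x' (z.snd - (δ / 2) • (gradient U z.fst + gradient U x'))

/-- The acceptance probability `α = exp(-(H ∘ Φ_V - H)₊)`. -/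
def accept {d : ℕ} (U : Pos d → ℝ) (δ : ℝ) (z : Phase d) : ℝ :=
  Real.exp (-max (hamiltonian U (verlet U δ z) - hamiltonian U z) 0)

open Classical in
/-- The adjusted Verlet step: accept `Φ_V(z)` if `w ≤ α(z)`, else reflect the velocity. -/
def adjustedVerlet {d : ℕ} (U : Pos d → ℝ) (δ : ℝ) (z : Phase d) (w : ℝ) : Phase d :=
  if w ≤ accept U δ z then verlet U δ z else mk z.fst (-z.snd)

/-- One transition of the OBABO chain, driven by the Gaussian variables `g` and `g'`. -/
def obaboStep {d : ℕ} (U : Pos d → ℝ) (γ δ : ℝ) (z : Phase d) (g g' : Pos d) : Phase d :=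
  stepO γ δ (verlet U δ (stepO γ δ z g)) g'

/-- One transition of the OM(BAB)O chain, driven by the Gaussian variables `g` and `g'` and the
uniform variable `w`. -/
def ombaboStep {d : ℕ} (U : Pos d → ℝ) (γ δ : ℝ) (z : Phase d) (g g' : Pos d) (w : ℝ) : Phase d :=
  stepO γ δ (adjustedVerlet U δ (stepO γ δ z g) w) g'

/-- The transition kernel `P` of the OBABO chain: the law of `obaboStep U γ δ z G G'` with `G`, `G'`
independent standard Gaussian vectors. -/
def obaboKernel {d : ℕ} (U : Pos d → ℝ) (γ δ : ℝ) : Kernel (Phase d) (Phase d) :=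
  (Kernel.id ×ₖ Kernel.const (Phase d) ((stdGaussian (Pos d)).prod (stdGaussian (Pos d)))).map
    (fun q => obaboStep U γ δ q.1 q.2.1 q.2.2)

/-- The transition kernel `P_M` of the OM(BAB)O chain: the law of `ombaboStep U γ δ z G G' W` with
`G`, `G'` standard Gaussian vectors and `W` uniform on `[0, 1]`, all independent. -/
def ombaboKernel {d : ℕ} (U : Pos d → ℝ) (γ δ : ℝ) : Kernel (Phase d) (Phase d) :=
  (Kernel.id ×ₖ Kernel.const (Phase d) (((stdGaussian (Pos d)).prod (stdGaussian (Pos d))).prod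
    (volume.restrict (Set.Icc (0 : ℝ) 1)))).map
    (fun q => ombaboStep U γ δ q.1 q.2.1.1 q.2.1.2 q.2.2)

lemma measurable_gradient {d : ℕ} {U : Pos d → ℝ} : Measurable (gradient U) :=
  (InnerProductSpace.toDual ℝ (Pos d)).symm.continuous.measurable.comp (measurable_fderiv ℝ U)

lemma measurable_stepO {d : ℕ} (γ δ : ℝ) :
    Measurable (fun q : Phase d × Pos d => stepO γ δ q.1 q.2) := by
  unfold stepO mk; fun_prop

lemma measurable_verlet {d : ℕ} {U : Pos d → ℝ} (δ : ℝ) : Measurable (verlet U δ) := by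
  have := measurable_gradient (U := U)
  unfold verlet mk; fun_prop

lemma measurable_accept {d : ℕ} {U : Pos d → ℝ} (hU : Measurable U) (δ : ℝ) :
    Measurable (accept U δ) := by
  have := measurable_verlet (U := U) δ
  unfold accept hamiltonian; fun_prop

lemma measurable_adjustedVerlet {d : ℕ} {U : Pos d → ℝ} (hU : Measurable U) (δ : ℝ) :
    Measurable (fun q : Phase d × ℝ => adjustedVerlet U δ q.1 q.2) := by
  have h₁ := measurable_verlet (U := U) δ
  have h₂ := measurable_accept hU δ
  unfold adjustedVerlet
  refine Measurable.ite (measurableSet_le measurable_snd (h₂.comp measurable_fst))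
    (h₁.comp measurable_fst) ?_
  unfold mk; fun_prop

lemma measurable_obaboStep {d : ℕ} {U : Pos d → ℝ} (γ δ : ℝ) :
    Measurable (fun q : Phase d × Pos d × Pos d => obaboStep U γ δ q.1 q.2.1 q.2.2) := by
  have h₁ := measurable_verlet (U := U) δ
  have h₂ := measurable_stepO (d := d) γ δ
  exact h₂.comp ((h₁.comp (h₂.comp (by fun_prop :
    Measurable fun q : Phase d × Pos d × Pos d => (q.1, q.2.1)))).prodMk (by fun_prop))

lemma measurable_ombaboStep {d : ℕ} {U : Pos d → ℝ} (hU : Measurable U) (γ δ : ℝ) :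
    Measurable (fun q : Phase d × (Pos d × Pos d) × ℝ =>
      ombaboStep U γ δ q.1 q.2.1.1 q.2.1.2 q.2.2) := by
  have h₁ := measurable_adjustedVerlet hU δ
  have h₂ := measurable_stepO (d := d) γ δ
  exact h₂.comp ((h₁.comp ((h₂.comp (by fun_prop :
    Measurable fun q : Phase d × (Pos d × Pos d) × ℝ => (q.1, q.2.1.1))).prodMk
      (by fun_prop : Measurable fun q : Phase d × (Pos d × Pos d) × ℝ => q.2.2))).prodMk
        (by fun_prop))

lemma isMarkovKernel_obaboKernel {d : ℕ} (U : Pos d → ℝ) (γ δ : ℝ) :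
    IsMarkovKernel (obaboKernel U γ δ) :=
  Kernel.IsMarkovKernel.map _ (measurable_obaboStep γ δ)

lemma isMarkovKernel_ombaboKernel {d : ℕ} {U : Pos d → ℝ} (hU : Measurable U) (γ δ : ℝ) :
    IsMarkovKernel (ombaboKernel U γ δ) := by
  have : IsProbabilityMeasure ((volume : Measure ℝ).restrict (Set.Icc (0 : ℝ) 1)) :=
    ⟨by simp⟩
  exact Kernel.IsMarkovKernel.map _ (measurable_ombaboStep hU γ δ)

/-- `Z` is a (time-homogeneous) Markov chain with transition kernel `κ` and initial law `μ₀`: for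
each `n`, the conditional law of `Z (n + 1)` given `Z 0, …, Z n` is `κ (Z n)`. -/
structure IsMarkovChain {S Ω : Type*} [MeasurableSpace S] [MeasurableSpace Ω] (κ : Kernel S S)
    (μ₀ : Measure S) (Pr : Measure Ω) (Z : ℕ → Ω → S) : Prop where
  measurable : ∀ n, Measurable (Z n)
  initial : Pr.map (Z 0) = μ₀
  step : ∀ n : ℕ,
    Pr.map (fun ω => ((fun i : Fin (n + 1) => Z i ω), Z (n + 1) ω)) =
      (Pr.map (fun ω => fun i : Fin (n + 1) => Z i ω)) ⊗ₘ
        (κ.comap (fun h : Fin (n + 1) → S => h (Fin.last n)) (measurable_pi_apply _))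

/-! ### Moments, Wasserstein distance, log-Sobolev inequality -/

/-- `ν` is a probability measure with a finite moment of order `p`. -/
def InP {d : ℕ} (p : ℝ) (ν : Measure (Phase d)) : Prop :=
  IsProbabilityMeasure ν ∧ Integrable (fun z => ‖z‖ ^ p) ν

/-- The moment `∫ |z - (c, 0)|^p ν(dz)`. -/
def momentAt {d : ℕ} (c : Pos d) (p : ℝ) (ν : Measure (Phase d)) : ℝ :=
  ∫ z, ‖z - mk c 0‖ ^ p ∂ν

/-- The moment of order `p`, centred at the `i`-th coordinate of `(c, 0)`, of the law of the `i`-th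
coordinate `(y i, w i)` of `(Q⁻¹ x, Q⁻¹ v)`, where `(x, v)` has law `ν`. -/
def coordMoment {d : ℕ} (Q : Pos d ≃ₗᵢ[ℝ] Pos d) (c : Pos d) (i : Fin d) (p : ℝ)
    (ν : Measure (Phase d)) : ℝ :=
  ∫ z, √((Q.symm z.fst i - Q.symm c i) ^ 2 + (Q.symm z.snd i) ^ 2) ^ p ∂ν

/-- The Wasserstein distance `W₁`: infimum over all couplings `ρ` of `μ` and `ν` of the mean
Euclidean distance. -/
def wasserstein {d : ℕ} (μ ν : Measure (Phase d)) : ℝ≥0∞ :=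
  ⨅ ρ : {ρ : Measure (Phase d × Phase d) // ρ.fst = μ ∧ ρ.snd = ν}, ∫⁻ q, edist q.1 q.2 ∂ρ.1

/-- Log-Sobolev inequality with constant `C`. The test functions are the bounded Lipschitz functions
of class `C¹`, so that the gradient makes sense also for measures that are not absolutely
continuous. -/
def LogSobolev {d : ℕ} (ν : Measure (Phase d)) (C : ℝ) : Prop :=
  ∀ f : Phase d → ℝ, ContDiff ℝ 1 f → (∃ K, LipschitzWith K f) → (∃ B, ∀ z, |f z| ≤ B) →
    ∫ z, f z ^ 2 * Real.log (f z ^ 2) ∂ν - (∫ z, f z ^ 2 ∂ν) * Real.log (∫ z, f z ^ 2 ∂ν) ≤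
      C * ∫ z, ‖gradient f z‖ ^ 2 ∂ν

/-! ### Constants -/

/-- `K₁ = √3 max(√L, 1/√L)`. -/
def K₁ (L : ℝ) : ℝ := √3 * max √L (1 / √L)

/-- `κ = m / (3γ)`. -/
def rate (m γ : ℝ) : ℝ := m / (3 * γ)

/-- `K₃ = L [1 + e^{Lδ²} (δ/6 + δ²L/24)] (1 + δL/(2√m))`. -/
def K₃ (L m δ : ℝ) : ℝ :=
  L * (1 + Real.exp (L * δ ^ 2) * (δ / 6 + δ ^ 2 * L / 24)) * (1 + δ * L / (2 * √m))

/-- `A = 1 + 1/√m + 2δK₁K₃/κ`, a factor of `K₉` and `K_ten`. -/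
def momentConst (L m γ δ : ℝ) : ℝ := 1 + 1 / √m + 2 * δ * K₁ L * K₃ L m δ / rate m γ

/-- `K₉ = 2L (K₁+3)² A² (1 + 1/κ) [δL/8 + (1 + δ/4 + δ²L/4)(1 + δ²L²/4)]`. -/
def K₉ (L m γ δ : ℝ) : ℝ :=
  2 * L * (K₁ L + 3) ^ 2 * momentConst L m γ δ ^ 2 * (1 + 1 / rate m γ) *
    (δ * L / 8 + (1 + δ / 4 + δ ^ 2 * L / 4) * (1 + δ ^ 2 * (L ^ 2 / 4)))

/-- `K₁₀ = [1 + 2^ℓ (K₁+3)^{ℓ+1} A^{ℓ+1} (1/κ + 1)]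
  [(L+2L²)/4 (1+δ²L²/4) + 2^{(ℓ-3)/2} L_ℓ (1+Lδ/2)³ (1+δ+δ²L/2)^{ℓ-2}]`. -/
def K_ten (L m γ δ ℓ Lℓ : ℝ) : ℝ :=
  (1 + (2 : ℝ) ^ ℓ * (K₁ L + 3) ^ (ℓ + 1) * momentConst L m γ δ ^ (ℓ + 1) *
      (1 / rate m γ + 1)) *
    ((L + 2 * L ^ 2) / 4 * (1 + δ ^ 2 * (L ^ 2 / 4)) +
      (2 : ℝ) ^ ((ℓ - 3) / 2) * Lℓ * (1 + L * δ / 2) ^ 3 *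
        (1 + δ + δ ^ 2 * L / 2) ^ (ℓ - 2))

/-- `C_lS = (6/m) K₁² γ² (1 + δ + δ²L/2)²`. -/
def ClS (L m γ δ : ℝ) : ℝ :=
  6 / m * K₁ L ^ 2 * γ ^ 2 * (1 + δ + δ ^ 2 * L / 2) ^ 2

end Langevin

end

open Langevin

noncomputable section

namespace Langevin

/-! ### Convexity and smoothness of the potential -/

/-! The error term is `sumRej`: the expected number of rejections before time n, computed along the
unadjusted chain. Driven by the same variables, one step of the two chains differs only if the
proposal is refused. Hence a tail probability of the adjusted chain is at most the corresponding
bound for the unadjusted chain plus this expectation (`lintegral_ombaboKernel_le`,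
`measure_tail_le`).

The unadjusted chain is controlled by synchronous coupling. Two copies with the same Gaussian
variables approach each other by the factor 1 - κδ in the norm of |x|² + (2/γ) x·v + c|v|², for
every c between 4/γ² and 1/L (`obabo_contraction`); co-coercivity of the gradient supplies the
dissipation. This gives existence and uniqueness of the invariant law, and it bounds the Lipschitz
constant of the expected additive functional `meanSum` by that of φ divided by κδ, uniformly in the
number of steps.

For concentration, c = 1/L. A single transition satisfies a Gaussian exponential bound for Lipschitz
functions (Maurey–Pisier, applied to each of the two Gaussian vectors). Going backwards in time,
this turns `meanSum` into an exponential supermartingale. The initial law enters through Herbst's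
argument, and the bias through the easy half of Kantorovich duality, since the mean of `meanSum`
under π_δ is n π_δ(φ).

For the rejections, 1 - α is at most the positive part of the energy error. That error is a
trapezoidal-rule error plus a difference of squared gradients: it has order δ² for a smooth convex
potential and δ³ when the Hessian is locally Lipschitz with polynomial growth. What remains are
moments along the unadjusted chain, from Lyapunov functions (a_k + b_k q + β_k|v|²)^Q with q the
quadratic form for c = 4/γ². The separate |v|² is needed because this c weighs velocities too weakly
for constants uniform in γ. In the sum over time the stationary part contributes n, and the initial
part a geometric series bounded by 1/(κδ), which costs one power of δ.

For a separable potential each coordinate pair is itself a one-dimensional chain and energy errors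
add up, so the one-dimensional moment estimate applies to every coordinate. -/

lemma sub_le_sub_of_hasDerivAt_le {f f' g g' : ℝ → ℝ} (hf : ∀ t, HasDerivAt f (f' t) t)
    (hg : ∀ t, HasDerivAt g (g' t) t) (h : ∀ t, 0 < t → t < 1 → f' t ≤ g' t) :
    f 1 - f 0 ≤ g 1 - g 0 := by
  have hm : MonotoneOn (fun t => g t - f t) (Set.Icc 0 1) := by
    refine monotoneOn_of_deriv_nonneg (convex_Icc 0 1) ?_ ?_ ?_
    · exact fun t _ => ((hg t).sub (hf t)).continuousAt.continuousWithinAt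
    · exact fun t _ => ((hg t).sub (hf t)).differentiableAt.differentiableWithinAt
    · intro t ht
      rw [interior_Icc] at ht
      have hd : deriv (fun t => g t - f t) t = g' t - f' t := ((hg t).sub (hf t)).deriv
      rw [hd]
      exact sub_nonneg.2 (h t ht.1 ht.2)
  have := hm (Set.left_mem_Icc.2 zero_le_one) (Set.right_mem_Icc.2 zero_le_one) zero_le_one
  simp only at this
  linarith

section Calculus

variable {d : ℕ} {U : Pos d → ℝ} {L m δ : ℝ}

lemma hasDerivAt_line (hU : ContDiff ℝ 2 U) (x y : Pos d) (t : ℝ) :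
    HasDerivAt (fun t : ℝ => U (x + t • y)) (inner ℝ (gradient U (x + t • y)) y) t := by
  have h1 : HasGradientAt U (gradient U (x + t • y)) (x + t • y) :=
    ((hU.differentiable (by norm_num)) _).hasGradientAt
  have h2 : HasDerivAt (fun t : ℝ => x + t • y) y t := by
    simpa using ((hasDerivAt_id t).smul_const y).const_add x
  exact h1.hasFDerivAt.comp_hasDerivAt t h2

lemma contDiff_gradient (hU : ContDiff ℝ 2 U) : ContDiff ℝ 1 (gradient U) :=
  (InnerProductSpace.toDual ℝ (Pos d)).symm.contDiff.comp (hU.fderiv_right (by norm_num))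

lemma hasDerivAt_gradient_line (hU : ContDiff ℝ 2 U) (x y : Pos d) (t : ℝ) :
    HasDerivAt (fun t : ℝ => inner ℝ (gradient U (x + t • y)) y)
      (inner ℝ (fderiv ℝ (gradient U) (x + t • y) y) y) t := by
  have h1 := (((contDiff_gradient hU).differentiable (by norm_num)) (x + t • y)).hasFDerivAt
  have h2 : HasDerivAt (fun t : ℝ => x + t • y) y t := by
    simpa using ((hasDerivAt_id t).smul_const y).const_add x
  simpa using (h1.comp_hasDerivAt t h2).inner ℝ (hasDerivAt_const t y)

lemma le_of_strongConv (hU : ContDiff ℝ 2 U) (hC : StrongConv U m) (x y : Pos d) :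
    U x + inner ℝ (gradient U x) (y - x) + m / 2 * ‖y - x‖ ^ 2 ≤ U y := by
  have hg : ∀ t : ℝ, HasDerivAt
      (fun t : ℝ => t * inner ℝ (gradient U x) (y - x) + t ^ 2 * (m / 2 * ‖y - x‖ ^ 2))
      (1 * inner ℝ (gradient U x) (y - x) + (2 * t) * (m / 2 * ‖y - x‖ ^ 2)) t := fun t =>
    ((hasDerivAt_id t).mul_const _).add
      (by simpa using (hasDerivAt_pow 2 t).mul_const (m / 2 * ‖y - x‖ ^ 2))
  have := sub_le_sub_of_hasDerivAt_le hg (fun t => hasDerivAt_line hU x (y - x) t) ?_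
  · simp only [one_smul, zero_smul, add_zero, add_sub_cancel, one_pow, one_mul, ne_eq,
      OfNat.ofNat_ne_zero, not_false_eq_true, zero_pow, zero_mul, sub_zero] at this
    linarith
  · intro t ht _
    have h := hC (x + t • (y - x)) x
    -- The hypothesis at x + t(y - x) and x carries one factor t too many; it is cancelled below
    -- using t > 0.
    simp only [add_sub_cancel_left, norm_smul, real_inner_smul_left, inner_sub_right,
      Real.norm_eq_abs, mul_pow, sq_abs] at h
    rw [real_inner_comm, real_inner_comm (y - x)] 
    rw [real_inner_comm, real_inner_comm (y - x)] at h
    have h' : t * (m * t * ‖y - x‖ ^ 2) ≤ t * (inner ℝ (gradient U (x + t • (y - x))) (y - x) -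
      inner ℝ (gradient U x) (y - x)) := by
      simp only [real_inner_comm] at h ⊢; nlinarith
    have := le_of_mul_le_mul_left h' ht
    simp only [real_inner_comm] at this ⊢
    linarith

lemma le_of_gradLip (hU : ContDiff ℝ 2 U) (hL : GradLip U L) (x y : Pos d) :
    U y ≤ U x + inner ℝ (gradient U x) (y - x) + L / 2 * ‖y - x‖ ^ 2 := by
  have hg : ∀ t : ℝ, HasDerivAt
      (fun t : ℝ => t * inner ℝ (gradient U x) (y - x) + t ^ 2 * (L / 2 * ‖y - x‖ ^ 2))
      (1 * inner ℝ (gradient U x) (y - x) + (2 * t) * (L / 2 * ‖y - x‖ ^ 2)) t := fun t =>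
    ((hasDerivAt_id t).mul_const _).add
      (by simpa using (hasDerivAt_pow 2 t).mul_const (L / 2 * ‖y - x‖ ^ 2))
  have := sub_le_sub_of_hasDerivAt_le (fun t => hasDerivAt_line hU x (y - x) t) hg ?_
  · simp only [one_smul, zero_smul, add_zero, add_sub_cancel, one_pow, one_mul, ne_eq,
      OfNat.ofNat_ne_zero, not_false_eq_true, zero_pow, zero_mul, sub_zero] at this
    linarith
  · intro t ht _
    have h := hL (x + t • (y - x)) x
    simp only [add_sub_cancel_left, norm_smul, Real.norm_eq_abs, abs_of_pos ht] at h
    have h2 := real_inner_le_norm (gradient U (x + t • (y - x)) - gradient U x) (y - x)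
    rw [inner_sub_left] at h2
    nlinarith [norm_nonneg (y - x)]

lemma le_of_convex (hU : ContDiff ℝ 2 U) (hm : 0 < m) (hC : StrongConv U m) (x y : Pos d) :
    U x + inner ℝ (gradient U x) (y - x) ≤ U y := by
  have := le_of_strongConv hU hC x y
  nlinarith [sq_nonneg ‖y - x‖, mul_nonneg hm.le (sq_nonneg ‖y - x‖)]

/-- The convexity bound from x and the descent bound from y are compared at the gradient step y -
p/L, p being the difference of the gradients. Exchanging x and y and adding gives the claim. -/
lemma cocoercive (hU : ContDiff ℝ 2 U) (hL0 : 0 < L) (hL : GradLip U L) (hm : 0 < m)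
    (hC : StrongConv U m) (x y : Pos d) :
    ‖gradient U x - gradient U y‖ ^ 2 ≤ L * inner ℝ (x - y) (gradient U x - gradient U y) := by
  have key : ∀ x y : Pos d, U x + inner ℝ (gradient U x) (y - x) +
      ‖gradient U y - gradient U x‖ ^ 2 / (2 * L) ≤ U y := by
    intro x y
    set p := gradient U y - gradient U x with hp
    have h1 := le_of_gradLip hU hL y (y - (1 / L) • p)
    have h2 := le_of_convex hU hm hC x (y - (1 / L) • p)
    have e1 : y - (1 / L) • p - y = -((1 / L) • p) := by abel
    have e2 : y - (1 / L) • p - x = (y - x) - (1 / L) • p := by abel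
    rw [e1, norm_neg, norm_smul, inner_neg_right, real_inner_smul_right, Real.norm_eq_abs,
      abs_of_pos (by positivity)] at h1
    rw [e2, inner_sub_right, real_inner_smul_right] at h2
    have e3 : inner ℝ (gradient U y) p - inner ℝ (gradient U x) p = ‖p‖ ^ 2 := by
      rw [← inner_sub_left, ← hp, real_inner_self_eq_norm_sq]
    have e4 : L / 2 * (1 / L * ‖p‖) ^ 2 = ‖p‖ ^ 2 / (2 * L) := by field_simp
    have e5 : ‖p‖ ^ 2 / (2 * L) = 1 / L * ‖p‖ ^ 2 / 2 := by field_simp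
    rw [e4, e5] at h1
    rw [e5]
    have e6 : 1 / L * inner ℝ (gradient U y) p = 1 / L * inner ℝ (gradient U x) p +
      1 / L * ‖p‖ ^ 2 := by rw [← e3]; ring
    linarith
  have h1 := key x y
  have h2 := key y x
  rw [norm_sub_rev] at h1
  have e : inner ℝ (x - y) (gradient U x - gradient U y) =
      -inner ℝ (gradient U x) (y - x) - inner ℝ (gradient U y) (x - y) := by
    rw [inner_sub_right, real_inner_comm, real_inner_comm (gradient U y), ← neg_sub x y,
      inner_neg_right]; ring
  have e5 : ‖gradient U x - gradient U y‖ ^ 2 / (2 * L) =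
    ‖gradient U x - gradient U y‖ ^ 2 / L / 2 := by field_simp
  rw [e5] at h1 h2
  have : ‖gradient U x - gradient U y‖ ^ 2 / L ≤ inner ℝ (x - y) (gradient U x - gradient U y) := by
    rw [e]; linarith
  rwa [div_le_iff₀' hL0] at this

/-- Both hypotheses are tested on a unit vector, which is why the dimension has to be positive. -/
lemma strongConv_le_gradLip (hd : 0 < d) (hL : GradLip U L) (hC : StrongConv U m) : m ≤ L := by
  let e : Pos d := EuclideanSpace.single ⟨0, hd⟩ 1
  have he : ‖e - 0‖ = 1 := by simp [e]
  have h1 := hC e 0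
  have h2 := hL e 0
  have h3 := real_inner_le_norm (e - 0) (gradient U e - gradient U 0)
  rw [he] at h1 h2 h3
  linarith

lemma exists_isMin (hU : ContDiff ℝ 2 U) (hm : 0 < m) (hC : StrongConv U m) :
    ∃ xs : Pos d, gradient U xs = 0 ∧ ∀ x, U xs + m / 2 * ‖x - xs‖ ^ 2 ≤ U x := by
  have hlim : Filter.Tendsto U (Filter.cocompact (Pos d)) Filter.atTop := by
    have h1 : ∀ x, U 0 + ‖x‖ * (m / 2 * ‖x‖ - ‖gradient U 0‖) ≤ U x := by
      intro x
      have h := le_of_strongConv hU hC 0 x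
      have h2 := neg_le_of_abs_le (abs_real_inner_le_norm (gradient U 0) x)
      simp only [sub_zero] at h
      nlinarith
    refine Filter.tendsto_atTop_mono h1 (Filter.tendsto_atTop_add_const_left _ _ ?_)
    have h3 := tendsto_norm_cocompact_atTop (E := Pos d)
    refine h3.atTop_mul_atTop₀ ?_
    exact Filter.tendsto_atTop_add_const_right _ _ (h3.const_mul_atTop (by positivity))
  obtain ⟨xs, hxs⟩ := hU.continuous.exists_forall_le hlim
  have hg : gradient U xs = 0 := by
    have : fderiv ℝ U xs = 0 :=
      IsLocalMin.fderiv_eq_zero (Filter.Eventually.of_forall hxs)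
    simp [gradient, this]
  refine ⟨xs, hg, fun x => ?_⟩
  have := le_of_strongConv hU hC xs x
  simpa [hg] using this

/-! ### The energy error of the velocity Verlet scheme -/

lemma norm_sq_phase (z : Phase d) : ‖z‖ ^ 2 = ‖z.fst‖ ^ 2 + ‖z.snd‖ ^ 2 :=
  WithLp.prod_norm_sq_eq_of_L2 z

lemma norm_fst_le_phase (z : Phase d) : ‖z.fst‖ ≤ ‖z‖ := by
  have := norm_sq_phase z
  exact le_of_sq_le_sq (by nlinarith [sq_nonneg ‖z.snd‖]) (norm_nonneg z)

lemma norm_snd_le_phase (z : Phase d) : ‖z.snd‖ ≤ ‖z‖ := by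
  have := norm_sq_phase z
  exact le_of_sq_le_sq (by nlinarith [sq_nonneg ‖z.fst‖]) (norm_nonneg z)

/-- The displacement of the position in a Verlet step. -/
def drift (U : Pos d → ℝ) (δ : ℝ) (z : Phase d) : Pos d :=
  δ • z.snd - (δ ^ 2 / 2) • gradient U z.fst

lemma verlet_fst (z : Phase d) : (verlet U δ z).fst = z.fst + drift U δ z := by
  simp [verlet, drift, add_sub_assoc]

lemma verlet_snd (z : Phase d) : (verlet U δ z).snd =
    z.snd - (δ / 2) • (gradient U z.fst + gradient U (z.fst + drift U δ z)) := by
  simp [verlet, drift, add_sub_assoc]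

/-- Expressing the velocity through the displacement turns the kinetic part into a trapezoidal
approximation of the work of the gradient along the displacement. The mismatch between displacement
and velocity leaves the term with the squared gradients. -/
lemma hamiltonian_verlet_sub (z : Phase d) :
    hamiltonian U (verlet U δ z) - hamiltonian U z =
      (U (z.fst + drift U δ z) - U z.fst - (1 / 2) * inner ℝ (gradient U z.fst +
        gradient U (z.fst + drift U δ z)) (drift U δ z)) +
      δ ^ 2 / 8 * (‖gradient U (z.fst + drift U δ z)‖ ^ 2 - ‖gradient U z.fst‖ ^ 2) := by
  unfold hamiltonian
  rw [verlet_fst, verlet_snd]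
  set g' := gradient U (z.fst + drift U δ z)
  unfold drift
  simp only [← real_inner_self_eq_norm_sq, inner_sub_left, inner_sub_right, inner_add_left,
    inner_add_right, real_inner_smul_left, real_inner_smul_right]
  rw [real_inner_comm (gradient U z.fst) z.snd, real_inner_comm g' z.snd,
    real_inner_comm g' (gradient U z.fst)]
  ring

variable {xs : Pos d}

lemma norm_gradient_le (hL : GradLip U L) (hxs : gradient U xs = 0) (x : Pos d) :
    ‖gradient U x‖ ≤ L * ‖x - xs‖ := by
  simpa [hxs] using hL x xs

lemma norm_drift_le (hL : GradLip U L) (hδ : 0 < δ) (hxs : gradient U xs = 0) (z : Phase d) :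
    ‖drift U δ z‖ ≤ δ * (‖z.snd‖ + δ * L / 2 * ‖z.fst - xs‖) := by
  have h1 := norm_gradient_le hL hxs z.fst
  calc ‖drift U δ z‖ ≤ ‖δ • z.snd‖ + ‖(δ ^ 2 / 2) • gradient U z.fst‖ := norm_sub_le _ _
    _ = δ * ‖z.snd‖ + δ ^ 2 / 2 * ‖gradient U z.fst‖ := by
        rw [norm_smul, norm_smul, Real.norm_of_nonneg hδ.le, Real.norm_of_nonneg (by positivity)]
    _ ≤ δ * ‖z.snd‖ + δ ^ 2 / 2 * (L * ‖z.fst - xs‖) := by gcongr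
    _ = _ := by ring

lemma gradient_sq_sub_le (hL : GradLip U L) (hL0 : 0 < L) (hxs : gradient U xs = 0)
    (x y : Pos d) :
    ‖gradient U (x + y)‖ ^ 2 - ‖gradient U x‖ ^ 2 ≤ L ^ 2 * (2 * ‖x - xs‖ * ‖y‖ + ‖y‖ ^ 2) := by
  have h1 : ‖gradient U (x + y)‖ ≤ ‖gradient U x‖ + L * ‖y‖ := by
    have h2 := hL (x + y) x
    rw [add_sub_cancel_left] at h2
    have h3 := norm_sub_norm_le (gradient U (x + y)) (gradient U x)
    linarith
  have h4 := norm_gradient_le hL hxs x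
  have h5 : 0 ≤ L * ‖y‖ := by positivity
  have h6 := pow_le_pow_left₀ (norm_nonneg _) h1 2
  nlinarith [norm_nonneg (gradient U x)]

lemma norm_sub_mk_sq (z : Phase d) (x : Pos d) :
    ‖z - mk x 0‖ ^ 2 = ‖z.fst - x‖ ^ 2 + ‖z.snd‖ ^ 2 := by
  rw [norm_sq_phase]; simp

lemma drift_sq_le {X V D : ℝ} (hD : 0 ≤ D) (hδ : 0 < δ)
    (h : D ≤ δ * (V + δ * L / 2 * X)) :
    D ^ 2 ≤ 2 * δ ^ 2 * (1 + δ ^ 2 * (L ^ 2 / 4)) * (X ^ 2 + V ^ 2) := by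
  have h6 : D ^ 2 ≤ (δ * (V + δ * L / 2 * X)) ^ 2 := by gcongr
  refine h6.trans ?_
  have : (V + δ * L / 2 * X) ^ 2 ≤ 2 * (1 + δ ^ 2 * (L ^ 2 / 4)) * (X ^ 2 + V ^ 2) := by
    have h1 := sq_nonneg (V - δ * L / 2 * X)
    have h2 := mul_nonneg (sq_nonneg (δ * L)) (sq_nonneg V)
    have h3 := sq_nonneg X
    linear_combination h1 + 1 / 2 * h2 + 2 * h3
  calc (δ * (V + δ * L / 2 * X)) ^ 2 = δ ^ 2 * (V + δ * L / 2 * X) ^ 2 := by ring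
    _ ≤ δ ^ 2 * (2 * (1 + δ ^ 2 * (L ^ 2 / 4)) * (X ^ 2 + V ^ 2)) := by gcongr
    _ = _ := by ring

lemma mul_drift_le {X V D : ℝ} (hX : 0 ≤ X) (hδ : 0 < δ) (hL0 : 0 < L)
    (h : D ≤ δ * (V + δ * L / 2 * X)) :
    X * D ≤ δ * (1 / 2 + δ * L / 2) * (X ^ 2 + V ^ 2) := by
  have h1 : X * D ≤ X * (δ * (V + δ * L / 2 * X)) := by gcongr
  refine h1.trans ?_
  have h2 : 0 ≤ δ * (δ * L / 2) * V ^ 2 := by positivity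
  have h3 : 0 ≤ δ / 2 * (X - V) ^ 2 := by positivity
  linear_combination h2 + h3

/-- The trapezoidal error costs only L/4 times the squared displacement, and the displacement is of
order δ; the gradient term already carries δ². -/
lemma energy_error_le_quadratic (hU : ContDiff ℝ 2 U) (hL0 : 0 < L) (hL : GradLip U L) (hm : 0 < m)
    (hC : StrongConv U m) (hδ : 0 < δ) (hxs : gradient U xs = 0) (z : Phase d) :
    hamiltonian U (verlet U δ z) - hamiltonian U z ≤
      δ ^ 2 * (L * (δ * L / 8 + (1 + δ / 4 + δ ^ 2 * L / 4) * (1 + δ ^ 2 * (L ^ 2 / 4)))) *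
        ‖z - mk xs 0‖ ^ 2 := by
  rw [hamiltonian_verlet_sub, norm_sub_mk_sq]
  set y := drift U δ z with hy
  have h1 := le_of_gradLip hU hL z.fst (z.fst + y)
  have h2 := le_of_convex hU hm hC (z.fst + y) z.fst
  have e : z.fst - (z.fst + y) = -y := by abel
  rw [add_sub_cancel_left] at h1
  rw [e, inner_neg_right] at h2
  have h3 := gradient_sq_sub_le hL hL0 hxs z.fst y
  have h4 : ‖y‖ ≤ δ * (‖z.snd‖ + δ * L / 2 * ‖z.fst - xs‖) := norm_drift_le hL hδ hxs z
  rw [inner_add_left]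
  have h5 := drift_sq_le (norm_nonneg y) hδ h4
  have h7 := mul_drift_le (norm_nonneg (z.fst - xs)) hδ hL0 h4
  -- Half the sum of the descent inequality at the starting point and the convexity inequality at
  -- the end point.
  have h8 : (U (z.fst + y) - U z.fst - (1 / 2) * (inner ℝ (gradient U z.fst) y +
      inner ℝ (gradient U (z.fst + y)) y)) ≤ L / 4 * ‖y‖ ^ 2 := by linarith
  have h9 : δ ^ 2 / 8 * (‖gradient U (z.fst + y)‖ ^ 2 - ‖gradient U z.fst‖ ^ 2) ≤
      δ ^ 2 / 8 * (L ^ 2 * (2 * ‖z.fst - xs‖ * ‖y‖ + ‖y‖ ^ 2)) := by gcongr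
  refine (add_le_add h8 h9).trans ?_
  clear h8 h9 h1 h2 h3 h4
  generalize ‖z.fst - xs‖ = X at *
  generalize ‖z.snd‖ = V at *
  generalize ‖y‖ = D at *
  clear_value y
  clear hy e
  have h10 : 0 ≤ X ^ 2 + V ^ 2 := by positivity
  generalize X ^ 2 + V ^ 2 = Z at *
  obtain ⟨B, hB⟩ : ∃ B, B = 1 + δ ^ 2 * (L ^ 2 / 4) := ⟨_, rfl⟩
  rw [← hB] at h5 ⊢
  have hB1 : 0 ≤ B := by rw [hB]; positivity
  calc _ = L / 4 * D ^ 2 + δ ^ 2 / 8 * (L ^ 2 * (2 * (X * D) + D ^ 2)) := by ring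
    _ ≤ L / 4 * (2 * δ ^ 2 * B * Z) + δ ^ 2 / 8 * (L ^ 2 * (2 *
        (δ * (1 / 2 + δ * L / 2) * Z) + 2 * δ ^ 2 * B * Z)) := by gcongr
    _ = δ ^ 2 * (L * (δ * L / 8 + (B / 2 + δ ^ 2 * L / 8 * L + δ ^ 2 * L / 4 * B))) * Z := by ring
    _ ≤ _ := by
        gcongr
        have h11 : δ ^ 2 * L / 8 * L ≤ B / 2 := by
          rw [hB]; linarith
        have h12 : 0 ≤ δ / 4 * B := by positivity
        linear_combination h11 + h12

end Calculus

end Langevin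
end

/-! ### Energy error of third order under a Hessian bound. -/

noncomputable section

namespace Langevin

/-- The function f(t) - (t/2)(f'(0) + f'(t)) has derivative (f'(t) - f'(0))/2 - t f''(t)/2. By the
mean value theorem this is t(f''(c) - f''(t))/2 for some c < t, hence at most C t²/2, whose integral
over [0, 1] is C/6. Neither continuity of f'' nor a two-sided bound is needed. -/
lemma trapezoid_le {f f' f'' : ℝ → ℝ} {C : ℝ} (hC0 : 0 ≤ C) (hf : ∀ t, HasDerivAt f (f' t) t)
    (hf' : ∀ t, HasDerivAt f' (f'' t) t)
    (hC : ∀ s t, 0 ≤ s → s ≤ t → t ≤ 1 → f'' s - f'' t ≤ C * (t - s)) :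
    f 1 - f 0 - (1 / 2) * (f' 0 + f' 1) ≤ C / 6 := by
  have h1 : ∀ t, HasDerivAt (fun t => f t - t / 2 * (f' 0 + f' t))
      (f' t - (1 / 2 * (f' 0 + f' t) + t / 2 * f'' t)) t := fun t =>
    (hf t).sub (((hasDerivAt_id t).div_const 2).mul ((hf' t).const_add (f' 0)))
  have h2 : ∀ t : ℝ, HasDerivAt (fun t => t ^ 3 * (C / 6)) (3 * t ^ 2 * (C / 6)) t := fun t => by
    simpa using (hasDerivAt_pow 3 t).mul_const (C / 6)
  have h3 := sub_le_sub_of_hasDerivAt_le h1 h2 fun t ht ht1 => by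
    obtain ⟨c, hc, hce⟩ := exists_hasDerivAt_eq_slope f' f'' ht
      (fun s _ => (hf' s).continuousAt.continuousWithinAt) (fun s _ => hf' s)
    have h4 := hC c t hc.1.le hc.2.le ht1.le
    rw [sub_zero, eq_div_iff ht.ne'] at hce
    have h5 : f'' c * t ≤ f'' t * t + C * t ^ 2 := by
      have : C * (t - c) ≤ C * t := by gcongr; linarith [hc.1]
      nlinarith
    linarith
  norm_num at h3
  linarith

section Calculus

variable {d : ℕ} {U : Pos d → ℝ} {L m δ : ℝ} {xs : Pos d}

/-- The segment stays in the ball of radius W around the minimum, so the polynomial weight of the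
Hessian bound becomes a constant and the second derivative along the segment is Lipschitz with
constant Lℓ‖y‖³(1 + W^(ℓ-2))/2. -/
lemma trapezoid_le_of_hessPol (hU : ContDiff ℝ 2 U) {ℓ Lℓ : ℝ} (hℓ : 2 ≤ ℓ) (hLℓ : 0 < Lℓ)
    (hH : HessPol U ℓ Lℓ xs) {x y : Pos d} {W : ℝ} (h0 : ‖x - xs‖ ≤ W) (h1 : ‖x + y - xs‖ ≤ W) :
    U (x + y) - U x - (1 / 2) * inner ℝ (gradient U x + gradient U (x + y)) y ≤
      Lℓ * ‖y‖ ^ 3 * (1 + W ^ (ℓ - 2)) / 12 := by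
  have hW : 0 ≤ W := (norm_nonneg _).trans h0
  have hseg : ∀ t : ℝ, 0 ≤ t → t ≤ 1 → ‖x + t • y - xs‖ ^ (ℓ - 2) ≤ W ^ (ℓ - 2) := by
    intro t ht ht1
    refine Real.rpow_le_rpow (norm_nonneg _) ?_ (by linarith)
    have : x + t • y - xs = (1 - t) • (x - xs) + t • (x + y - xs) := by module
    rw [this]
    refine (norm_add_le _ _).trans ?_
    rw [norm_smul, norm_smul, Real.norm_of_nonneg ht, Real.norm_of_nonneg (by linarith)]
    nlinarith
  have hC0 : 0 ≤ Lℓ * ‖y‖ ^ 3 * (1 + W ^ (ℓ - 2)) / 2 := by positivity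
  have := trapezoid_le hC0 (fun t => hasDerivAt_line hU x y t)
    (fun t => hasDerivAt_gradient_line hU x y t) fun s t hs hst ht => by
      rw [← inner_sub_left, ← _root_.sub_apply]
      refine (real_inner_le_norm _ _).trans ?_
      have h2 := hH (x + t • y) (x + s • y)
      have e : x + t • y - (x + s • y) = (t - s) • y := by module
      rw [e, norm_smul, Real.norm_of_nonneg (by linarith)] at h2
      have h3 := (fderiv ℝ (gradient U) (x + s • y) - fderiv ℝ (gradient U) (x + t • y)).le_opNorm y
      have h4 := hseg s hs (by linarith)
      have h5 := hseg t (by linarith) ht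
      have hts : 0 ≤ t - s := by linarith
      calc _ ≤ Lℓ * ((t - s) * ‖y‖) * (2 + ‖x + t • y - xs‖ ^ (ℓ - 2) +
            ‖x + s • y - xs‖ ^ (ℓ - 2)) / 4 * ‖y‖ * ‖y‖ := by
              gcongr
              exact h3.trans (by gcongr)
        _ ≤ Lℓ * ((t - s) * ‖y‖) * (2 + W ^ (ℓ - 2) + W ^ (ℓ - 2)) / 4 * ‖y‖ * ‖y‖ := by gcongr
        _ = _ := by ring
  simp only [one_smul, zero_smul, add_zero] at this
  rw [inner_add_left]
  linarith

/-- The last factor of the constant `K_ten`. -/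
def cubicConst (L δ ℓ Lℓ : ℝ) : ℝ :=
  (L + 2 * L ^ 2) / 4 * (1 + δ ^ 2 * (L ^ 2 / 4)) +
      (2 : ℝ) ^ ((ℓ - 3) / 2) * Lℓ * (1 + L * δ / 2) ^ 3 * (1 + δ + δ ^ 2 * L / 2) ^ (ℓ - 2)

lemma pow_le_one_add_rpow {x p : ℝ} (hx : 0 ≤ x) (n : ℕ) (hn : n ≤ p) : x ^ n ≤ 1 + x ^ p := by
  rcases le_total x 1 with h | h
  · have := pow_le_one₀ (n := n) hx h
    have := Real.rpow_nonneg hx p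
    linarith
  · have := Real.rpow_le_rpow_of_exponent_le h hn
    rw [Real.rpow_natCast] at this
    linarith

/-- The factor 51/100 keeps almost half of `cubicConst` in reserve; `sum_lintegral_cubic_le` spends
it on the constant 1 and on splitting the moments. The hypothesis `hδL` turns the fourth-order part
of the gradient term into a small multiple of L + L². -/
lemma energy_error_le_cubic (hU : ContDiff ℝ 2 U) (hL0 : 0 < L) (hL : GradLip U L) (hδ : 0 < δ)
    (hδL : δ * L ^ 2 ≤ (L + L ^ 2) / 100) (hxs : gradient U xs = 0) {ℓ Lℓ : ℝ} (hℓ : 2 ≤ ℓ)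
    (hLℓ : 0 < Lℓ) (hH : HessPol U ℓ Lℓ xs) (z : Phase d) :
    hamiltonian U (verlet U δ z) - hamiltonian U z ≤
      δ ^ 3 * (51 / 100 * cubicConst L δ ℓ Lℓ) * (1 + ‖z - mk xs 0‖ ^ (ℓ + 1)) := by
  rw [hamiltonian_verlet_sub]
  set y := drift U δ z with hy
  have h3 := gradient_sq_sub_le hL hL0 hxs z.fst y
  have h4 : ‖y‖ ≤ δ * (‖z.snd‖ + δ * L / 2 * ‖z.fst - xs‖) := norm_drift_le hL hδ hxs z
  have hN : 0 ≤ ‖z - mk xs 0‖ := norm_nonneg _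
  have hN2 := norm_sub_mk_sq z xs
  have hx : ‖z.fst - xs‖ ≤ ‖z - mk xs 0‖ := by simpa using norm_fst_le_phase (z - mk xs 0)
  have hv : ‖z.snd‖ ≤ ‖z - mk xs 0‖ := by simpa using norm_snd_le_phase (z - mk xs 0)
  have hW : ‖z.fst + y - xs‖ ≤ (1 + δ + δ ^ 2 * L / 2) * ‖z - mk xs 0‖ := by
    have e : z.fst + y - xs = (z.fst - xs) + y := by abel
    rw [e]
    refine (norm_add_le _ _).trans ?_
    have : δ * (‖z.snd‖ + δ * L / 2 * ‖z.fst - xs‖) ≤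
      δ * (‖z - mk xs 0‖ + δ * L / 2 * ‖z - mk xs 0‖) := by gcongr
    linarith
  have hW' : ‖z.fst - xs‖ ≤ (1 + δ + δ ^ 2 * L / 2) * ‖z - mk xs 0‖ := by
    refine hx.trans (le_mul_of_one_le_left hN ?_)
    have : 0 ≤ δ + δ ^ 2 * L / 2 := by positivity
    linarith
  have hT := trapezoid_le_of_hessPol hU hℓ hLℓ hH hW' hW
  have h5 := drift_sq_le (norm_nonneg y) hδ h4
  have h7 := mul_drift_le (norm_nonneg (z.fst - xs)) hδ hL0 h4
  have hy1 : ‖y‖ ≤ δ * (1 + L * δ / 2) * ‖z - mk xs 0‖ := by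
    refine h4.trans ?_
    have : δ * (‖z.snd‖ + δ * L / 2 * ‖z.fst - xs‖) ≤
      δ * (‖z - mk xs 0‖ + δ * L / 2 * ‖z - mk xs 0‖) := by gcongr
    linarith
  have h9 : δ ^ 2 / 8 * (‖gradient U (z.fst + y)‖ ^ 2 - ‖gradient U z.fst‖ ^ 2) ≤
      δ ^ 2 / 8 * (L ^ 2 * (2 * ‖z.fst - xs‖ * ‖y‖ + ‖y‖ ^ 2)) := by gcongr
  refine (add_le_add hT h9).trans ?_
  rw [← hN2] at h5 h7
  have hD : 0 ≤ ‖y‖ := norm_nonneg y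
  clear hT h9 h3 h4 hN2 hx hv hW hW' hH
  generalize ‖z - mk xs 0‖ = N at *
  generalize ‖z.fst - xs‖ = X at *
  generalize ‖y‖ = D at *
  clear_value y
  clear hy
  have hp0 : 0 ≤ N ^ (ℓ + 1) := Real.rpow_nonneg hN _
  have hq2 : N ^ 2 ≤ 1 + N ^ (ℓ + 1) := pow_le_one_add_rpow hN 2 (by push_cast; linarith)
  have hq3 : N ^ 3 ≤ 1 + N ^ (ℓ + 1) := pow_le_one_add_rpow hN 3 (by push_cast; linarith)
  have hsplit : N ^ 3 * N ^ (ℓ - 2) = N ^ (ℓ + 1) := by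
    rw [← Real.rpow_natCast N 3, ← Real.rpow_add_of_nonneg hN (by positivity) (by linarith)]
    congr 1; push_cast; ring
  obtain ⟨B, hB⟩ : ∃ B, B = 1 + δ ^ 2 * (L ^ 2 / 4) := ⟨_, rfl⟩
  have hB0 : 0 ≤ B := by rw [hB]; positivity
  obtain ⟨E, hE⟩ : ∃ E, E = 1 + N ^ (ℓ + 1) := ⟨_, rfl⟩
  have hE0 : 0 ≤ E := by rw [hE]; linarith
  have hpart2 : δ ^ 2 / 8 * (L ^ 2 * (2 * X * D + D ^ 2)) ≤
      δ ^ 3 * (51 / 100 * ((L + 2 * L ^ 2) / 4 * B)) * E := by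
    rw [← hB] at h5
    rw [← hE] at hq2
    calc _ = δ ^ 2 / 8 * (L ^ 2 * (2 * (X * D) + D ^ 2)) := by ring
      _ ≤ δ ^ 2 / 8 * (L ^ 2 * (2 * (δ * (1 / 2 + δ * L / 2) * N ^ 2) +
          2 * δ ^ 2 * B * N ^ 2)) := by gcongr
      _ = δ ^ 3 * (L ^ 2 * (1 / 8 + δ * L / 8) + (δ * L ^ 2) * B / 4) * N ^ 2 := by ring
      _ ≤ δ ^ 3 * (L ^ 2 * (B / 4) + ((L + L ^ 2) / 100) * B / 4) * E := by
          gcongr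
          rw [hB]
          nlinarith [sq_nonneg (δ * L - 1)]
      _ ≤ _ := by
          gcongr δ ^ 3 * ?_ * E
          have h1 : 0 ≤ L * B := by positivity
          have h2 : 0 ≤ L ^ 2 * B := by positivity
          linarith
  set a := 1 + δ + δ ^ 2 * L / 2 with ha
  have ha1 : 1 ≤ a := by rw [ha]; have : 0 ≤ δ + δ ^ 2 * L / 2 := by positivity
                         linarith
  have hal : 1 ≤ a ^ (ℓ - 2) := Real.one_le_rpow ha1 (by linarith)
  -- Since ℓ ≥ 2, the exponent is at least -1/2. The bound 1/2 suffices because the trapezoidal term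
  -- only needs 50/153, which is (1/6)/(51/100).
  have hc : (1 / 2 : ℝ) ≤ 2 ^ ((ℓ - 3) / 2) := by
    have : (2 : ℝ) ^ (-1 : ℝ) ≤ 2 ^ ((ℓ - 3) / 2) :=
      Real.rpow_le_rpow_of_exponent_le (by norm_num) (by linarith)
    rwa [Real.rpow_neg_one, ← one_div] at this
  have hpart1 : Lℓ * D ^ 3 * (1 + (a * N) ^ (ℓ - 2)) / 12 ≤
      δ ^ 3 * (51 / 100 * ((2 : ℝ) ^ ((ℓ - 3) / 2) * Lℓ * (1 + L * δ / 2) ^ 3 *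
        a ^ (ℓ - 2))) * E := by
    rw [Real.mul_rpow (by linarith) hN]
    -- Because a ≥ 1, the summand 1 may be multiplied by a^(ℓ-2); then N³ + N^(ℓ+1) is at most 2(1 +
    -- N^(ℓ+1)).
    calc _ ≤ Lℓ * (δ * (1 + L * δ / 2) * N) ^ 3 *
          (a ^ (ℓ - 2) + a ^ (ℓ - 2) * N ^ (ℓ - 2)) / 12 := by gcongr
      _ = δ ^ 3 * (1 / 12 * (Lℓ * (1 + L * δ / 2) ^ 3 * a ^ (ℓ - 2))) *
          (N ^ 3 + N ^ 3 * N ^ (ℓ - 2)) := by ring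
      _ ≤ δ ^ 3 * (1 / 12 * (Lℓ * (1 + L * δ / 2) ^ 3 * a ^ (ℓ - 2))) * (2 * E) := by
          gcongr
          rw [hsplit]; linarith
      _ = δ ^ 3 * (51 / 100 * ((50 / 153) * Lℓ * (1 + L * δ / 2) ^ 3 * a ^ (ℓ - 2))) * E := by
          ring
      _ ≤ _ := by
          gcongr
          linarith
  refine (add_le_add hpart1 hpart2).trans (le_of_eq ?_)
  rw [cubicConst, ← hB, ← hE]
  ring

end Calculus

end Langevin
end

noncomputable section

namespace Langevin

/-! ### Contraction of the synchronous coupling -/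

lemma exp_half_bounds {h : ℝ} (h0 : 0 ≤ h) (h1 : h ≤ 1) :
    1 - h / 2 ≤ Real.exp (-(h / 2)) ∧ Real.exp (-(h / 2)) ≤ 1 - h / 2 + h ^ 2 / 8 := by
  constructor
  · have := Real.add_one_le_exp (-(h / 2)); linarith
  · have h2 : Real.exp (-(h / 2)) = (Real.exp (h / 2))⁻¹ := Real.exp_neg _
    have h3 := Real.quadratic_le_exp_of_nonneg (show 0 ≤ h / 2 by linarith)
    rw [h2]
    have h4 : 0 < 1 - h / 2 + h ^ 2 / 8 := by nlinarith
    rw [inv_le_comm₀ (Real.exp_pos _) h4]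
    refine le_trans ?_ h3
    rw [inv_le_iff_one_le_mul₀ h4]
    -- With y = h/2, the product (1 - y + y²/2)(1 + y + y²/2) equals 1 + y⁴/4.
    have : 0 ≤ h ^ 4 / 64 := by positivity
    linear_combination this

lemma eta_pos (γ δ : ℝ) : 0 < eta γ δ := Real.exp_pos _

/-- The standing assumptions on the parameters. -/
structure Params (L m γ δ : ℝ) : Prop where
  L_pos : 0 < L
  m_pos : 0 < m
  m_le : m ≤ L
  γ_pos : 0 < γ
  γ_sq : 4 * L ≤ γ ^ 2
  δ_pos : 0 < δ
  δ_le : δ * (33 * γ ^ 3) ≤ m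

namespace Params

variable {L m γ δ : ℝ} (hP : Params L m γ δ)
include hP

lemma h_pos : 0 < δ * γ := mul_pos hP.δ_pos hP.γ_pos

lemma h_mul_le : δ * γ * (33 * γ ^ 2) ≤ m := by
  have := hP.δ_le
  linarith

lemma h_le : δ * γ ≤ 1 / 132 := by
  have h1 := hP.h_mul_le
  have h2 := hP.m_le
  have h3 := hP.γ_sq
  have hg : 0 < γ ^ 2 := pow_pos hP.γ_pos 2
  by_contra hneg
  push Not at hneg
  have h4 := mul_lt_mul_of_pos_right hneg hg
  linarith

lemma δ_sq_L : δ ^ 2 * L ≤ (δ * γ) ^ 2 / 4 := by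
  have := mul_le_mul_of_nonneg_left hP.γ_sq (sq_nonneg δ)
  rw [mul_pow]
  linarith

lemma δ_sq_m : δ ^ 2 * m ≤ (δ * γ) ^ 2 / 4 :=
  (mul_le_mul_of_nonneg_left hP.m_le (sq_nonneg δ)).trans hP.δ_sq_L

lemma hγ_sq : (δ * γ * γ) ^ 2 ≤ δ * γ * m / 33 := by
  have := mul_le_mul_of_nonneg_left hP.h_mul_le hP.h_pos.le
  linarith

lemma eta_bounds : 1 - δ * γ / 2 ≤ eta γ δ ∧ eta γ δ ≤ 1 - δ * γ / 2 + (δ * γ) ^ 2 / 8 :=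
  exp_half_bounds hP.h_pos.le (hP.h_le.trans (by norm_num))

lemma eta_le_one : eta γ δ ≤ 1 := by
  have := hP.h_pos
  exact Real.exp_le_one_iff.2 (by linarith)

end Params

section Contraction

variable {E : Type*} [NormedAddCommGroup E] [InnerProductSpace ℝ E]

/-- Here x and v are the differences of two synchronously coupled chains, p and p' the differences
of the gradients before and after the move; the noise has cancelled. The products of p with x and of
p' with the new position are kept whole, since co-coercivity and strong convexity apply to them. -/
lemma obabo_expand (x v p p' : E) (δ e : ℝ) :
    let b := e • v - (δ / 2) • p
    let w := e • (e • v - (δ / 2) • (p + p'))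
    ‖x + δ • b‖ ^ 2 = ‖x‖ ^ 2 + 2 * δ * e * inner ℝ x v + δ ^ 2 * ‖b‖ ^ 2 - δ ^ 2 * inner ℝ x p ∧
    inner ℝ (x + δ • b) w = e ^ 2 * inner ℝ x v +
      e ^ 2 * δ * (e * ‖v‖ ^ 2 - δ / 2 * inner ℝ v p) - e * δ / 2 * (inner ℝ x p +
        δ * (e * inner ℝ v p - δ / 2 * ‖p‖ ^ 2) + inner ℝ (x + δ • b) p') ∧
    ‖w‖ ^ 2 = e ^ 4 * ‖v‖ ^ 2 -
      e ^ 3 * δ * (inner ℝ v p + inner ℝ v p') + e ^ 2 * δ ^ 2 / 4 * ‖p + p'‖ ^ 2 := by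
  intro b w
  refine ⟨?_, ?_, ?_⟩
  · simp only [← real_inner_self_eq_norm_sq, b, inner_sub_left, inner_sub_right, inner_add_left,
      inner_add_right, real_inner_smul_left, real_inner_smul_right]
    rw [real_inner_comm x v, real_inner_comm x p, real_inner_comm p v]
    ring
  · simp only [← real_inner_self_eq_norm_sq, b, w, inner_sub_left, inner_sub_right, inner_add_left,
      inner_add_right, real_inner_smul_left, real_inner_smul_right]
    rw [real_inner_comm v p]
    ring
  · simp only [← real_inner_self_eq_norm_sq, w, inner_sub_left, inner_sub_right, inner_add_left,
      inner_add_right, real_inner_smul_left, real_inner_smul_right]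
    rw [real_inner_comm v p, real_inner_comm v p']
    ring

variable {L m γ δ c : ℝ}

set_option maxHeartbeats 1600000 in
/-- Real-variable form of the contraction estimate. -/
lemma contraction_real (hP : Params L m γ δ) (hc1 : 4 ≤ c * γ ^ 2) (hc2 : c * L ≤ 1)
    {X V B S xv vp vp' P2 u u' l τ e : ℝ} (he : e = eta γ δ)
    (hτ : τ = e ^ 2 + δ * γ * e - 1) (hX : 0 ≤ X) (hV : 0 ≤ V) (hu0 : 0 ≤ u) (hu0' : 0 ≤ u')
    (hl : l ^ 2 = L)
    (hxv : |xv| ≤ X * V) (hvp : |vp| ≤ V * (l * u)) (hvp' : |vp'| ≤ V * (l * u'))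
    (hP2 : P2 ≤ L * u ^ 2)
    (hB : B ≤ 2 * V ^ 2 + δ ^ 2 * L / 2 * u ^ 2) (hS : S ≤ 2 * L * (u ^ 2 + u' ^ 2))
    (hmX : m * X ^ 2 ≤ 501 / 1000 * u ^ 2 + 505 / 1000 * u' ^ 2 + δ * γ * V ^ 2) :
    2 * m / 3 * (X ^ 2 + 2 / γ * xv + c * V ^ 2) ≤
      -(2 / δ * τ * xv) - δ * γ * B - 2 * e ^ 2 * (e * V ^ 2 - δ / 2 * vp)
      + e * (u ^ 2 + u' ^ 2 + δ * (e * vp - δ / 2 * P2)) + c * γ / δ * (1 - e ^ 4) * V ^ 2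
      + c * γ * e ^ 3 * (vp + vp') - c * γ * e ^ 2 * δ / 4 * S := by
  have hh0 := hP.h_pos
  have hh1 := hP.h_le
  have hδ := hP.δ_pos
  have hγ := hP.γ_pos
  have hm := hP.m_pos
  have hL := hP.L_pos
  obtain ⟨he1, he2⟩ := hP.eta_bounds
  rw [← he] at he1 he2
  have he0 : 0 < e := he ▸ eta_pos γ δ
  have he3 : e ≤ 1 := he ▸ hP.eta_le_one
  have hδL := hP.δ_sq_L
  have hγγ := hP.hγ_sq
  have hγL := hP.γ_sq
  have hmL := hP.m_le
  have hδg : δ * γ = γ * δ := mul_comm _ _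
  obtain ⟨h, hh⟩ : ∃ h, h = δ * γ := ⟨_, rfl⟩
  rw [← hh] at hh0 hh1 he1 he2 hδL hγγ hmX hτ ⊢
  have hc : 0 < c := by
    by_contra hneg
    have : c * γ ^ 2 ≤ 0 := mul_nonpos_of_nonpos_of_nonneg (not_lt.1 hneg) (sq_nonneg γ)
    linarith
  have hhsq : h ^ 2 ≤ h / 132 := by
    have := mul_le_mul_of_nonneg_left hh1 hh0.le
    linarith
  have hlγ : 2 * l ≤ γ := by
    refine le_of_sq_le_sq ?_ hγ.le
    rw [mul_pow, hl]; linarith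
  have hδl : δ * l ≤ h / 2 := by
    have := mul_le_mul_of_nonneg_left hlγ hδ.le
    rw [hh]; linarith
  -- The number τ is, up to the factor 2/γ, what the step adds to the coefficient of x·v. The cross
  -- weight 2/γ of the quadratic form makes its first-order part in h vanish.
  have hτ1 : |τ| ≤ h ^ 2 / 2 := by
    have e1 : (1 - h / 2) ^ 2 ≤ e ^ 2 := pow_le_pow_left₀ (by linarith) he1 2
    have e2 : e ^ 2 ≤ (1 - h / 2 + h ^ 2 / 8) ^ 2 := pow_le_pow_left₀ he0.le he2 2
    have e3 := mul_le_mul_of_nonneg_left he1 hh0.le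
    have e4 := mul_le_mul_of_nonneg_left he2 hh0.le
    have e5 : 0 ≤ h ^ 3 := by positivity
    have e6 : h ^ 4 ≤ h ^ 2 := pow_le_pow_of_le_one hh0.le (by linarith) (by norm_num)
    have e7 : 0 ≤ h ^ 2 := by positivity
    rw [hτ, abs_le]
    constructor <;> linarith
  -- With k = √c γ, the natural unit of velocity is y = kV. The two conditions on c become k ≥ 2,
  -- which absorbs plain V² terms, and cγ√L ≤ k, which bounds the products of velocity and gradient.
  obtain ⟨k, hk0, hk⟩ : ∃ k, 0 ≤ k ∧ k ^ 2 = c * γ ^ 2 :=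
    ⟨√(c * γ ^ 2), Real.sqrt_nonneg _, Real.sq_sqrt (by positivity)⟩
  have hkl : c * γ * l ≤ k := by
    refine le_of_sq_le_sq ?_ hk0
    rw [hk, mul_pow, mul_pow, hl]
    have := mul_le_mul_of_nonneg_left hc2 (show 0 ≤ c * γ ^ 2 by positivity)
    linarith
  have hk2 : 2 ≤ k := by
    refine le_of_sq_le_sq ?_ hk0
    rw [hk]; linarith
  obtain ⟨y, hy⟩ : ∃ y, y = k * V := ⟨_, rfl⟩
  have hVy : 2 * V ≤ y := by rw [hy]; gcongr
  have hy0 : 0 ≤ y := by linarith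
  have hyy : y ^ 2 = c * γ ^ 2 * V ^ 2 := by rw [hy, mul_pow, hk]
  have hV2 : V ^ 2 ≤ y ^ 2 / 4 := by
    have := pow_le_pow_left₀ (by linarith) hVy 2
    linarith
  -- bounds of the single terms
  have hu2 := sq_nonneg u
  have hu2' := sq_nonneg u'
  have hVV := sq_nonneg V
  -- Young's inequality with weights adapted to m; the restriction of δ by m/(33γ³) enters at full
  -- strength here, as (hγ)² ≤ hm/33.
  have t1 : 2 / δ * τ * xv ≤ 1 / 100 * (m * X ^ 2) + h * V ^ 2 := by
    have e0 : τ * xv ≤ h ^ 2 / 2 * (X * V) := by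
      refine (le_abs_self _).trans ?_
      rw [abs_mul]
      gcongr
    have e1 : 2 / δ * τ * xv ≤ h * γ * (X * V) := by
      calc 2 / δ * τ * xv = 2 / δ * (τ * xv) := by ring
        _ ≤ 2 / δ * (h ^ 2 / 2 * (X * V)) := by gcongr
        _ = _ := by rw [hh]; field_simp
    have e2 : 0 ≤ (m * X / 10 - 5 * (h * γ * V)) ^ 2 := sq_nonneg _
    have e4 : (h * γ) ^ 2 * V ^ 2 ≤ h * m / 33 * V ^ 2 := by gcongr
    have e5 : 0 ≤ h * m * V ^ 2 := by positivity
    have e3 : h * γ * (X * V) * m ≤ (1 / 100 * (m * X ^ 2) + h * V ^ 2) * m := by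
      linear_combination e2 + 25 * e4 + (8 / 33) * e5
    exact e1.trans (le_of_mul_le_mul_right e3 hm)
  have t2 : h * B ≤ h * (2 * V ^ 2) + 1 / 1000 * u ^ 2 := by
    have e1 := mul_le_mul_of_nonneg_left hB hh0.le
    have e2 : δ ^ 2 * L / 2 * u ^ 2 ≤ 1 / 1000 * u ^ 2 :=
      mul_le_mul_of_nonneg_right (by linarith) hu2
    have e3 : h * (δ ^ 2 * L / 2 * u ^ 2) ≤ 1 * (1 / 1000 * u ^ 2) := by gcongr; linarith
    linarith
  have hδvp : |δ * vp| ≤ h / 2 * (V * u) := by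
    rw [abs_mul, abs_of_pos hδ]
    calc δ * |vp| ≤ δ * (V * (l * u)) := by gcongr
      _ = δ * l * (V * u) := by ring
      _ ≤ _ := by gcongr
  have hVu : V * u ≤ V ^ 2 + u ^ 2 := by
    have := sq_nonneg (V - u); linarith
  have hVu0 : 0 ≤ V * u := by positivity
  have hee : e ^ 2 ≤ 1 := pow_le_one₀ he0.le he3
  have heee : e ^ 3 ≤ 1 := pow_le_one₀ he0.le he3
  have t4 : 2 * e ^ 2 * (e * V ^ 2 - δ / 2 * vp) ≤ 2 * V ^ 2 + h / 2 * (V ^ 2 + u ^ 2) := by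
    have e1 : e ^ 3 * V ^ 2 ≤ 1 * V ^ 2 := by gcongr
    have e2 : -(e ^ 2 * (δ * vp)) ≤ 1 * (h / 2 * (V * u)) := by
      refine (neg_le_abs _).trans ?_
      rw [abs_mul, abs_of_nonneg (by positivity)]
      gcongr
    have e3 : h / 2 * (V * u) ≤ h / 2 * (V ^ 2 + u ^ 2) := by gcongr
    linarith
  have t5 : e * (u ^ 2 + u' ^ 2 + δ * (e * vp - δ / 2 * P2)) ≥
      (1 - h / 2) * (u ^ 2 + u' ^ 2) - h / 2 * (V ^ 2 + u ^ 2) - 1 / 1000 * u ^ 2 := by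
    have e1 : (1 - h / 2) * (u ^ 2 + u' ^ 2) ≤ e * (u ^ 2 + u' ^ 2) := by gcongr
    have e2 : -(e ^ 2 * (δ * vp)) ≤ 1 * (h / 2 * (V * u)) := by
      refine (neg_le_abs _).trans ?_
      rw [abs_mul, abs_of_nonneg (by positivity)]
      gcongr
    have e3 : h / 2 * (V * u) ≤ h / 2 * (V ^ 2 + u ^ 2) := by gcongr
    have e4 : e * (δ ^ 2 / 2 * P2) ≤ 1 / 1000 * u ^ 2 := by
      calc e * (δ ^ 2 / 2 * P2) ≤ e * (δ ^ 2 / 2 * (L * u ^ 2)) := by gcongr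
        _ = e * (δ ^ 2 * L / 2 * u ^ 2) := by ring
        _ ≤ 1 * (1 / 1000 * u ^ 2) := mul_le_mul he3
          (mul_le_mul_of_nonneg_right (by linarith) hu2) (by positivity) zero_le_one
        _ = _ := one_mul _
    linarith
  have t6 : c * γ / δ * (1 - e ^ 4) * V ^ 2 ≥ (2 - 2 * h) * y ^ 2 := by
    have e1 : e ^ 4 ≤ 1 - 2 * h + 2 * h ^ 2 := by
      have e2 : e ^ 2 ≤ 1 - h + h ^ 2 / 2 := by
        have e3 : e ^ 2 ≤ (1 - h / 2 + h ^ 2 / 8) ^ 2 := pow_le_pow_left₀ he0.le he2 2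
        have e5 : 0 ≤ h ^ 3 := by positivity
        have e6 : h ^ 4 ≤ h ^ 3 := pow_le_pow_of_le_one hh0.le (by linarith) (by norm_num)
        linarith
      have e4 : (e ^ 2) ^ 2 ≤ (1 - h + h ^ 2 / 2) ^ 2 := pow_le_pow_left₀ (by positivity) e2 2
      have e5 : 0 ≤ h ^ 3 := by positivity
      have e6 : h ^ 4 ≤ h ^ 3 := pow_le_pow_of_le_one hh0.le (by linarith) (by norm_num)
      linarith
    calc (2 - 2 * h) * y ^ 2 = c * γ / δ * (2 * h - 2 * h ^ 2) * V ^ 2 := by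
          rw [hyy, hh]; field_simp
      _ ≤ _ := by gcongr c * γ / δ * ?_ * V ^ 2; linarith
  have t7 : c * γ * e ^ 3 * (vp + vp') ≥ -(y * (u + u')) := by
    have e1 : |vp + vp'| ≤ V * l * (u + u') :=
      (abs_add_le _ _).trans (by linarith)
    have e2 : |c * γ * e ^ 3 * (vp + vp')| ≤ y * (u + u') := by
      rw [abs_mul, abs_of_nonneg (by positivity)]
      calc c * γ * e ^ 3 * |vp + vp'| ≤ c * γ * 1 * (V * l * (u + u')) := by gcongr
        _ = (c * γ * l) * (V * (u + u')) := by ring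
        _ ≤ k * (V * (u + u')) := by gcongr
        _ = _ := by rw [hy]; ring
    linarith [neg_le_of_abs_le e2]
  have t8 : c * γ * e ^ 2 * δ / 4 * S ≤ h / 2 * (u ^ 2 + u' ^ 2) := by
    calc c * γ * e ^ 2 * δ / 4 * S ≤ c * γ * e ^ 2 * δ / 4 * (2 * L * (u ^ 2 + u' ^ 2)) := by
          gcongr
      _ ≤ c * γ * 1 * δ / 4 * (2 * L * (u ^ 2 + u' ^ 2)) := by gcongr
      _ = (c * L) * (h / 2 * (u ^ 2 + u' ^ 2)) := by rw [hh]; ring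
      _ ≤ 1 * (h / 2 * (u ^ 2 + u' ^ 2)) := by gcongr
      _ = _ := one_mul _
  have t9 : 2 * m / 3 * (X ^ 2 + 2 / γ * xv + c * V ^ 2) ≤ m * X ^ 2 + y ^ 2 / 4 := by
    have e1 : 2 / γ * xv ≤ 1 / 2 * (X ^ 2 + c * V ^ 2) := by
      have e2 : 2 / γ * xv ≤ 2 / γ * (X * V) := by
        gcongr; exact (le_abs_self _).trans hxv
      refine e2.trans ?_
      have e3 : 0 ≤ (X - k / γ * V) ^ 2 := sq_nonneg _
      have e4 : (k / γ) ^ 2 = c := by rw [div_pow, hk]; field_simp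
      have e5 : 2 / γ * (X * V) ≤ k / γ * (X * V) := by gcongr
      have e6 : 0 ≤ X ^ 2 - 2 * (k / γ * (X * V)) + (k / γ) ^ 2 * V ^ 2 := by
        linear_combination e3
      rw [e4] at e6
      linarith
    have e3 : m * (c * V ^ 2) ≤ y ^ 2 / 4 := by
      rw [hyy]
      have : m ≤ γ ^ 2 / 4 := by linarith
      calc m * (c * V ^ 2) ≤ γ ^ 2 / 4 * (c * V ^ 2) :=
            mul_le_mul_of_nonneg_right this (by positivity)
        _ = _ := by ring
    have e2 := mul_le_mul_of_nonneg_left e1 hm.le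
    linarith
  -- What is left after the dissipation u² + u'² + 2y² has paid for all other terms. The form is
  -- nonnegative because 1/(4·0.47) + 1/(4·0.48) < 1.2.
  have fin : 0 ≤ 47 / 100 * u ^ 2 + 48 / 100 * u' ^ 2 + 12 / 10 * y ^ 2 - y * (u + u') := by
    have h1 := sq_nonneg (u - 100 / 94 * y)
    have h2 := sq_nonneg (u' - 100 / 96 * y)
    have h3 := sq_nonneg y
    linear_combination 47 / 100 * h1 + 48 / 100 * h2 +
      (12 / 10 - 47 / 100 * (100 / 94) ^ 2 - 48 / 100 * (100 / 96) ^ 2) * h3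
  have f1 : h * V ^ 2 ≤ 1 / 132 * (y ^ 2 / 4) := by gcongr
  have f2 : h * u ^ 2 ≤ 1 / 132 * u ^ 2 := by gcongr
  have f3 : h * u' ^ 2 ≤ 1 / 132 * u' ^ 2 := by gcongr
  have f4 : h * y ^ 2 ≤ 1 / 132 * y ^ 2 := by gcongr
  linarith

-- The decrease of the form, divided by δ/γ, is bounded below by `contraction_real` in terms of u² =
-- x·p and u'² = x'·p'. These two squares dominate m|x|², m|x'|² and the squared gradient
-- differences divided by L.
set_option maxHeartbeats 800000 in
lemma obabo_contraction (hP : Params L m γ δ) (hc1 : 4 ≤ c * γ ^ 2) (hc2 : c * L ≤ 1)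
    {x v p p' x' : E}
    (hx' : x' = x + δ • (eta γ δ • v - (δ / 2) • p))
    (h1 : m * ‖x‖ ^ 2 ≤ inner ℝ x p) (h2 : ‖p‖ ^ 2 ≤ L * inner ℝ x p)
    (h3 : m * ‖x'‖ ^ 2 ≤ inner ℝ x' p') (h4 : ‖p'‖ ^ 2 ≤ L * inner ℝ x' p') :
    ‖x'‖ ^ 2 + 2 / γ * inner ℝ x' (eta γ δ • (eta γ δ • v - (δ / 2) • (p + p'))) +
      c * ‖eta γ δ • (eta γ δ • v - (δ / 2) • (p + p'))‖ ^ 2 ≤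
    (1 - rate m γ * δ) ^ 2 * (‖x‖ ^ 2 + 2 / γ * inner ℝ x v + c * ‖v‖ ^ 2) := by
  have hδ := hP.δ_pos
  have hγ := hP.γ_pos
  have hm := hP.m_pos
  have hL := hP.L_pos
  have hh0 := hP.h_pos
  have hh1 := hP.h_le
  have he0 := eta_pos γ δ
  have he3 := hP.eta_le_one
  obtain ⟨E1, E2, E3⟩ := obabo_expand x v p p' δ (eta γ δ)
  rw [hx'] at h3 h4 ⊢
  rw [E2, E3]
  have hc : 0 < c := by
    by_contra hneg
    have : c * γ ^ 2 ≤ 0 := mul_nonpos_of_nonpos_of_nonneg (not_lt.1 hneg) (sq_nonneg γ)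
    linarith
  set e := eta γ δ with he
  set b : E := e • v - (δ / 2) • p with hb
  have hq0 : 0 ≤ inner ℝ x p := le_trans (by positivity) h1
  have hq0' : 0 ≤ inner ℝ (x + δ • b) p' := le_trans (by positivity) h3
  obtain ⟨u, hu0, hu⟩ : ∃ u, 0 ≤ u ∧ u ^ 2 = inner ℝ x p :=
    ⟨_, Real.sqrt_nonneg _, Real.sq_sqrt hq0⟩
  obtain ⟨u', hu0', hu'⟩ : ∃ u, 0 ≤ u ∧ u ^ 2 = inner ℝ (x + δ • b) p' :=
    ⟨_, Real.sqrt_nonneg _, Real.sq_sqrt hq0'⟩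
  obtain ⟨l, hl0, hl⟩ : ∃ l, 0 ≤ l ∧ l ^ 2 = L := ⟨√L, Real.sqrt_nonneg _, Real.sq_sqrt hL.le⟩
  rw [← hu] at h1 h2 E1 ⊢
  rw [← hu'] at h3 h4 ⊢
  have hp : ‖p‖ ≤ l * u := by
    refine le_of_sq_le_sq ?_ (by positivity)
    rw [mul_pow, hl]; exact h2
  have hp' : ‖p'‖ ≤ l * u' := by
    refine le_of_sq_le_sq ?_ (by positivity)
    rw [mul_pow, hl]; exact h4
  have hvp : |inner ℝ v p| ≤ ‖v‖ * (l * u) := (abs_real_inner_le_norm v p).trans (by gcongr)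
  have hvp' : |inner ℝ v p'| ≤ ‖v‖ * (l * u') := (abs_real_inner_le_norm v p').trans (by gcongr)
  have hxv : |inner ℝ x v| ≤ ‖x‖ * ‖v‖ := abs_real_inner_le_norm x v
  have hb2 : ‖b‖ ^ 2 ≤ 2 * ‖v‖ ^ 2 + δ ^ 2 * L / 2 * u ^ 2 := by
    have e1 : ‖b‖ ≤ 1 * ‖v‖ + δ / 2 * (l * u) := by
      refine (norm_sub_le _ _).trans ?_
      rw [norm_smul, norm_smul, Real.norm_of_nonneg he0.le, Real.norm_of_nonneg (by positivity)]
      gcongr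
    have e2 := pow_le_pow_left₀ (norm_nonneg b) e1 2
    have e3 := sq_nonneg (‖v‖ - δ / 2 * (l * u))
    rw [← hl]
    linarith
  have hpp : ‖p + p'‖ ^ 2 ≤ 2 * L * (u ^ 2 + u' ^ 2) := by
    have e1 := pow_le_pow_left₀ (norm_nonneg _) (norm_add_le p p') 2
    have e2 := sq_nonneg (‖p‖ - ‖p'‖)
    linarith
  -- The average of strong convexity before the move and, through |x| ≤ |x'| + δ|b|, after it.
  -- Splitting the cost leaves nearly half of both u² and u'² for the cross terms.
  have hmX : m * ‖x‖ ^ 2 ≤ 501 / 1000 * u ^ 2 + 505 / 1000 * u' ^ 2 + δ * γ * ‖v‖ ^ 2 := by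
    have e1 : ‖x‖ ≤ ‖x + δ • b‖ + δ * ‖b‖ := by
      have := norm_sub_le (x + δ • b) (δ • b)
      rwa [add_sub_cancel_right, norm_smul, Real.norm_of_nonneg hδ.le] at this
    have e2 := pow_le_pow_left₀ (norm_nonneg x) e1 2
    have e3 : 0 ≤ (‖x + δ • b‖ / 10 - 10 * (δ * ‖b‖)) ^ 2 := sq_nonneg _
    have e4 : ‖x‖ ^ 2 ≤ 101 / 100 * ‖x + δ • b‖ ^ 2 + 101 * (δ ^ 2 * ‖b‖ ^ 2) := by linarith
    have e5 := mul_le_mul_of_nonneg_left e4 hm.le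
    have e9 : (δ * γ) ^ 2 ≤ δ * γ / 132 := by
      have := mul_le_mul_of_nonneg_left hh1 hh0.le
      linarith
    have e6 : m * (δ ^ 2 * ‖b‖ ^ 2) ≤ δ * γ / 528 * (2 * ‖v‖ ^ 2) + 1 / 1000000 * u ^ 2 := by
      have e7 := hP.δ_sq_m
      have e8 := hP.δ_sq_L
      calc m * (δ ^ 2 * ‖b‖ ^ 2) = (δ ^ 2 * m) * ‖b‖ ^ 2 := by ring
        _ ≤ δ * γ / 528 * (2 * ‖v‖ ^ 2 + 1 / 1000 * u ^ 2) := by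
          refine mul_le_mul (by linarith) (hb2.trans ?_) (by positivity) (by positivity)
          exact add_le_add_right (mul_le_mul_of_nonneg_right (by linarith) (sq_nonneg u)) _
        _ ≤ _ := by
          have : δ * γ * u ^ 2 ≤ 1 / 132 * u ^ 2 := by gcongr
          have := sq_nonneg u
          linarith
    have e10 : 0 ≤ δ * γ * ‖v‖ ^ 2 := by positivity
    have := sq_nonneg u
    linarith
  have main := contraction_real hP hc1 hc2 he rfl (norm_nonneg x) (norm_nonneg v) hu0 hu0'
    hl hxv hvp hvp' h2 hb2 hpp hmX
  have hE1 : ‖x + δ • b‖ ^ 2 ≤ ‖x‖ ^ 2 + 2 * δ * e * inner ℝ x v + δ ^ 2 * ‖b‖ ^ 2 := by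
    rw [E1]
    have : 0 ≤ δ ^ 2 * u ^ 2 := by positivity
    linarith
  have hQ0 : 0 ≤ ‖x‖ ^ 2 + 2 / γ * inner ℝ x v + c * ‖v‖ ^ 2 := by
    have e1 : 0 ≤ ‖x + (1 / γ) • v‖ ^ 2 := sq_nonneg _
    rw [norm_add_sq_real, real_inner_smul_right, norm_smul, mul_pow,
      Real.norm_of_nonneg (by positivity)] at e1
    have e2 : (1 / γ) ^ 2 * ‖v‖ ^ 2 ≤ c * ‖v‖ ^ 2 := by
      gcongr
      rw [div_pow, one_pow, div_le_iff₀ (by positivity)]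
      linarith
    have e3 : 2 * (1 / γ * inner ℝ x v) = 2 / γ * inner ℝ x v := by ring
    linarith
  have main2 := mul_le_mul_of_nonneg_left main (show 0 ≤ δ / γ by positivity)
  -- The factor δ/γ · 2m/3 from `contraction_real` is 2κδ; the square form of the contraction is
  -- what passes to the norm.
  have hr : 1 - 2 * (rate m γ * δ) ≤ (1 - rate m γ * δ) ^ 2 := by
    linear_combination sq_nonneg (rate m γ * δ)
  refine le_trans ?_ (mul_le_mul_of_nonneg_right hr hQ0)
  refine (add_le_add_left (add_le_add_left hE1 _) _).trans ?_
  rw [← sub_nonneg] at main2 ⊢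
  refine main2.trans (le_of_eq ?_)
  unfold rate
  field_simp
  ring

end Contraction

end Langevin
end

/-! ### The twisted quadratic form and the synchronous coupling of the unadjusted chain. -/

noncomputable section

namespace Langevin

/-- The standing assumptions on the potential. -/
structure Potential {d : ℕ} (U : Pos d → ℝ) (L m : ℝ) : Prop where
  contDiff : ContDiff ℝ 2 U
  gradLip : GradLip U L
  strongConv : StrongConv U m

/-- The quadratic form `|x|² + (2/γ) x·v + c |v|²`. -/
def quad {d : ℕ} (γ c : ℝ) (z : Phase d) : ℝ :=
  ‖z.fst‖ ^ 2 + 2 / γ * inner ℝ z.fst z.snd + c * ‖z.snd‖ ^ 2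

section Quad

variable {d : ℕ} {U : Pos d → ℝ} {L m γ δ c : ℝ}

lemma continuous_quad (γ c : ℝ) : Continuous (quad (d := d) γ c) := by
  unfold quad; fun_prop

lemma quad_snd (v : Pos d) : quad γ c (mk 0 v) = c * ‖v‖ ^ 2 := by
  simp [quad]

lemma sqrt_c_mul {c γ : ℝ} (hγ : 0 < γ) (hc1 : 4 ≤ c * γ ^ 2) (z : Phase d) :
    |2 / γ * inner ℝ z.fst z.snd| ≤ √c * (‖z.fst‖ * ‖z.snd‖) := by
  have h1 : 2 / γ ≤ √c := by
    refine Real.le_sqrt_of_sq_le ?_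
    rw [div_pow, div_le_iff₀ (by positivity)]
    linarith
  rw [abs_mul, abs_of_pos (by positivity : 0 < 2 / γ)]
  exact mul_le_mul h1 (abs_real_inner_le_norm _ _) (abs_nonneg _) (Real.sqrt_nonneg _)

lemma c_pos (hc1 : 4 ≤ c * γ ^ 2) : 0 < c := by
  by_contra hneg
  have : c * γ ^ 2 ≤ 0 := mul_nonpos_of_nonpos_of_nonneg (not_lt.1 hneg) (sq_nonneg γ)
  linarith

/-- The condition on c gives 2/γ ≤ √c, so the cross term is at most √c|x||v|. Each bound is then a
completed square; the third follows from the square of |x|/2 - √c|v|. -/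
lemma quad_bounds (hγ : 0 < γ) (hc1 : 4 ≤ c * γ ^ 2) (z : Phase d) :
    1 / 2 * (‖z.fst‖ ^ 2 + c * ‖z.snd‖ ^ 2) ≤ quad γ c z ∧
      quad γ c z ≤ 3 / 2 * (‖z.fst‖ ^ 2 + c * ‖z.snd‖ ^ 2) ∧
      3 / 4 * ‖z.fst‖ ^ 2 ≤ quad γ c z ∧ quad γ c z ≤ (1 + c) * ‖z‖ ^ 2 := by
  have hc := c_pos hc1
  have h1 := abs_le.1 (sqrt_c_mul hγ hc1 z)
  have h2 : (√c) ^ 2 = c := Real.sq_sqrt hc.le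
  have h3 := sq_nonneg (‖z.fst‖ - √c * ‖z.snd‖)
  have h3' := sq_nonneg (√c * ‖z.fst‖ - ‖z.snd‖)
  have h4 : (√c * ‖z.snd‖) ^ 2 = c * ‖z.snd‖ ^ 2 := by rw [mul_pow, h2]
  have h4' : (√c * ‖z.fst‖) ^ 2 = c * ‖z.fst‖ ^ 2 := by rw [mul_pow, h2]
  have h5 : 2 / γ ≤ √c := by
    refine Real.le_sqrt_of_sq_le ?_
    rw [div_pow, div_le_iff₀ (by positivity)]
    linarith
  have h7 : 0 ≤ c * ‖z.fst‖ ^ 2 := by positivity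
  have h8 := sq_nonneg ‖z.snd‖
  have h9 : 1 / γ ^ 2 ≤ c / 4 := by
    rw [div_le_iff₀ (by positivity)]; linarith
  refine ⟨?_, ?_, ?_, ?_⟩
  · unfold quad; linarith
  · unfold quad; linarith
  · have h6 := sq_nonneg (‖z.fst‖ / 2 - √c * ‖z.snd‖)
    unfold quad; linarith
  · rw [norm_sq_phase]
    unfold quad; linarith

lemma quad_nonneg (hγ : 0 < γ) (hc1 : 4 ≤ c * γ ^ 2) (z : Phase d) : 0 ≤ quad γ c z := by
  have h := (quad_bounds hγ hc1 z).2.2.1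
  exact le_trans (by positivity) h

lemma obaboStep_fst (z : Phase d) (g g' : Pos d) : (obaboStep U γ δ z g g').fst =
    z.fst + δ • (eta γ δ • z.snd + √(1 - eta γ δ ^ 2) • g) - (δ ^ 2 / 2) • gradient U z.fst := by
  simp [obaboStep, stepO, verlet]

lemma obaboStep_snd (z : Phase d) (g g' : Pos d) : (obaboStep U γ δ z g g').snd =
    eta γ δ • ((eta γ δ • z.snd + √(1 - eta γ δ ^ 2) • g) - (δ / 2) • (gradient U z.fst +
      gradient U (obaboStep U γ δ z g g').fst)) + √(1 - eta γ δ ^ 2) • g' := by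
  simp [obaboStep, stepO, verlet]

/-- The same Gaussian variables drive both steps, so they cancel in the difference and the
deterministic estimate applies pathwise. -/
lemma quad_obaboStep_sub_le (hU : Potential U L m) (hP : Params L m γ δ) (hc1 : 4 ≤ c * γ ^ 2)
    (hc2 : c * L ≤ 1) (z₁ z₂ : Phase d) (g g' : Pos d) :
    quad γ c (obaboStep U γ δ z₁ g g' - obaboStep U γ δ z₂ g g') ≤
      (1 - rate m γ * δ) ^ 2 * quad γ c (z₁ - z₂) := by
  have hco := cocoercive hU.contDiff hP.L_pos hU.gradLip hP.m_pos hU.strongConv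
  set x₁' := (obaboStep U γ δ z₁ g g').fst with hx1
  set x₂' := (obaboStep U γ δ z₂ g g').fst with hx2
  have key := obabo_contraction hP hc1 hc2 (x := z₁.fst - z₂.fst) (v := z₁.snd - z₂.snd)
    (p := gradient U z₁.fst - gradient U z₂.fst) (p' := gradient U x₁' - gradient U x₂')
    (x' := x₁' - x₂') (by rw [hx1, hx2, obaboStep_fst, obaboStep_fst]; module)
    (hU.strongConv _ _) (hco _ _) (hU.strongConv _ _) (hco _ _)
  have e : (obaboStep U γ δ z₁ g g' - obaboStep U γ δ z₂ g g').snd =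
      eta γ δ • (eta γ δ • (z₁.snd - z₂.snd) - (δ / 2) • (gradient U z₁.fst - gradient U z₂.fst +
        (gradient U x₁' - gradient U x₂'))) := by
    rw [WithLp.sub_snd, obaboStep_snd, obaboStep_snd, ← hx1, ← hx2]; module
  rw [quad, e, WithLp.sub_fst, ← hx1, ← hx2]
  exact key

lemma phase_ext {z w : Phase d} (h1 : z.fst = w.fst) (h2 : z.snd = w.snd) : z = w :=
  WithLp.ofLp_injective 2 (Prod.ext h1 h2)

/-- Absorbing the first Gaussian variable of a transition into the starting point. -/
lemma obaboStep_eq (z : Phase d) (g g' : Pos d) :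
    obaboStep U γ δ z g g' = obaboStep U γ δ
      (z + mk 0 ((√(1 - eta γ δ ^ 2) / eta γ δ) • g)) 0 0 + mk 0 (√(1 - eta γ δ ^ 2) • g') := by
  have hη := (eta_pos γ δ).ne'
  have e : stepO γ δ (z + mk 0 ((√(1 - eta γ δ ^ 2) / eta γ δ) • g)) 0 = stepO γ δ z g := by
    apply phase_ext
    · simp [stepO]
    · simp [stepO, smul_smul, mul_div_cancel₀ _ hη]
  unfold obaboStep
  rw [e]
  apply phase_ext <;> simp [stepO]

lemma obaboStep_fixed {xs : Pos d} (hxs : gradient U xs = 0) :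
    obaboStep U γ δ (mk xs 0) 0 0 = mk xs 0 := by
  simp [obaboStep, stepO, verlet, hxs]

end Quad

end Langevin
end

noncomputable section

namespace Langevin

/-! ### Moments of shifted Gaussian vectors -/

lemma integrable_exp_sq_gaussianReal {s : ℝ} (μ a σ : ℝ) (hs : s = 1 - 2 * (μ * σ ^ 2))
    (hs0 : 0 < s) :
    Integrable (fun x => Real.exp (μ * (a + σ * x) ^ 2)) (gaussianReal 0 1) ∧
    ∫ x, Real.exp (μ * (a + σ * x) ^ 2) ∂gaussianReal 0 1 =
      √(1 / s) * Real.exp (μ * a ^ 2 / s) := by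
  have key : ∀ x : ℝ, gaussianPDFReal 0 1 x * Real.exp (μ * (a + σ * x) ^ 2) =
      (√(2 * Real.pi))⁻¹ * Real.exp (μ * a ^ 2 / s) *
        Real.exp (-(s / 2) * (x - 2 * μ * a * σ / s) ^ 2) := by
    intro x
    rw [gaussianPDFReal_def]
    simp only [NNReal.coe_one, mul_one, sub_zero]
    rw [mul_assoc, mul_assoc, ← Real.exp_add, ← Real.exp_add]
    congr 2
    field_simp
    rw [hs]
    ring
  have hint : Integrable (fun x : ℝ => Real.exp (-(s / 2) * (x - 2 * μ * a * σ / s) ^ 2)) :=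
    (integrable_exp_neg_mul_sq (by positivity : 0 < s / 2)).comp_sub_right (2 * μ * a * σ / s)
  constructor
  · rw [gaussianReal_of_var_ne_zero _ one_ne_zero,
      integrable_withDensity_iff_integrable_smul' (measurable_gaussianPDF 0 1)
        (ae_of_all _ fun _ => gaussianPDF_lt_top)]
    simp only [toReal_gaussianPDF, smul_eq_mul, key]
    exact hint.const_mul _
  · rw [integral_gaussianReal_eq_integral_smul one_ne_zero]
    simp only [smul_eq_mul, key]
    rw [integral_const_mul, integral_sub_right_eq_self
      (fun x : ℝ => Real.exp (-(s / 2) * x ^ 2)), integral_gaussian]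
    have : √(Real.pi / (s / 2)) = √(2 * Real.pi) * √(1 / s) := by
      rw [← Real.sqrt_mul (by positivity)]
      congr 1
      field_simp
    rw [this]
    field_simp

/-- The integral factorises over the coordinates. Each normalising factor s^(-1/2) is at most
exp(μσ²/s), because 1/s = 1 + 2μσ²/s. -/
lemma lintegral_exp_sq_stdGaussian_le {d : ℕ} {s : ℝ} (μ σ : ℝ) (u : Pos d)
    (hs : s = 1 - 2 * (μ * σ ^ 2)) (hs0 : 0 < s) :
    ∫⁻ g, ENNReal.ofReal (Real.exp (μ * ‖u + σ • g‖ ^ 2)) ∂stdGaussian (Pos d) ≤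
      ENNReal.ofReal (Real.exp ((d * (μ * σ ^ 2) + μ * ‖u‖ ^ 2) / s)) := by
  rw [← map_pi_eq_stdGaussian, lintegral_map (by fun_prop) (by fun_prop)]
  have e : ∀ x : Fin d → ℝ, Real.exp (μ * ‖u + σ • (WithLp.toLp 2 x : Pos d)‖ ^ 2) =
      ∏ i, Real.exp (μ * (u i + σ * x i) ^ 2) := by
    intro x
    rw [← Real.exp_sum, EuclideanSpace.norm_sq_eq, Finset.mul_sum]
    simp
  simp only [e]
  rw [← ofReal_integral_eq_lintegral_ofReal
    (Integrable.fintype_prod_dep fun i => (integrable_exp_sq_gaussianReal μ (u i) σ hs hs0).1)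
    (ae_of_all _ fun x => Finset.prod_nonneg fun i _ => (Real.exp_pos _).le),
    integral_fintype_prod_eq_prod (fun i (x : ℝ) => Real.exp (μ * (u i + σ * x) ^ 2))]
  refine ENNReal.ofReal_le_ofReal ?_
  have hsq : √(1 / s) ≤ Real.exp (μ * σ ^ 2 / s) := by
    rw [Real.sqrt_le_left (Real.exp_pos _).le, ← Real.exp_nat_mul]
    have h1 := Real.add_one_le_exp ((2 : ℕ) * (μ * σ ^ 2 / s))
    refine le_trans (le_of_eq ?_) h1
    push_cast
    field_simp
    linarith
  calc ∏ i, ∫ x, Real.exp (μ * (u i + σ * x) ^ 2) ∂gaussianReal 0 1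
      ≤ ∏ i, Real.exp ((μ * σ ^ 2 + μ * u i ^ 2) / s) := by
        refine Finset.prod_le_prod (fun i _ => integral_nonneg fun x => (Real.exp_pos _).le)
          fun i _ => ?_
        rw [(integrable_exp_sq_gaussianReal μ (u i) σ hs hs0).2, add_div, Real.exp_add]
        gcongr
    _ = _ := by
        rw [← Real.exp_sum, EuclideanSpace.norm_sq_eq, ← Finset.sum_div, Finset.sum_add_distrib,
          Finset.mul_sum]
        simp

/-- Exponential bound for a power that is sharp at t = T, so that choosing T as the expected answer
loses nothing to leading order. -/
lemma rpow_le_mul_exp {t T q : ℝ} (ht : 0 ≤ t) (hT : 0 < T) (hq : 0 ≤ q) :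
    t ^ q ≤ T ^ q * Real.exp (-q) * Real.exp (q / T * t) := by
  have h1 : t / T ≤ Real.exp (t / T - 1) := by
    have := Real.add_one_le_exp (t / T - 1); linarith
  have h2 := Real.rpow_le_rpow (by positivity) h1 hq
  rw [Real.div_rpow ht hT.le, ← Real.exp_mul, div_le_iff₀ (Real.rpow_pos_of_pos hT q)] at h2
  refine h2.trans (le_of_eq ?_)
  rw [mul_assoc, ← Real.exp_add, mul_comm]
  congr 2
  field_simp
  ring

/-- The moment of order `2q` of a shifted Gaussian vector. -/
lemma lintegral_rpow_add_norm_sq_le {d : ℕ} (hd : 0 < d) {A c q : ℝ} (σ : ℝ) (u : Pos d)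
    (hA : 0 ≤ A) (hc : 0 ≤ c) (hq : 0 < q) :
    ∫⁻ g, ENNReal.ofReal ((A + c * ‖u + σ • g‖ ^ 2) ^ q) ∂stdGaussian (Pos d) ≤
      ENNReal.ofReal ((A + c * ‖u‖ ^ 2 + c * σ ^ 2 * (d + 2 * q)) ^ q) := by
  have hd' : (0 : ℝ) < d := by exact_mod_cast hd
  set T := A + c * ‖u‖ ^ 2 + c * σ ^ 2 * (d + 2 * q) with hT
  obtain ⟨E, hE⟩ : ∃ E, E = A + c * ‖u‖ ^ 2 + c * σ ^ 2 * d := ⟨_, rfl⟩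
  have hcu : 0 ≤ c * ‖u‖ ^ 2 := by positivity
  have hcσ : 0 ≤ c * σ ^ 2 := by positivity
  have hcσd : 0 ≤ c * σ ^ 2 * d := by positivity
  -- If E = 0 the integrand vanishes identically; otherwise T > 0 can serve as the reference point
  -- of the exponential bound.
  rcases (show 0 ≤ E by rw [hE]; positivity).eq_or_lt with h0 | h0
  · have h1 : A = 0 := by linarith
    have h2 : c * ‖u‖ ^ 2 = 0 := by linarith
    have h3 : c * σ ^ 2 = 0 := by
      have : c * σ ^ 2 * d = 0 := by linarith
      exact (mul_eq_zero.1 this).resolve_right hd'.ne'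
    have h4 : ∀ g : Pos d, A + c * ‖u + σ • g‖ ^ 2 = 0 := by
      intro g
      rcases mul_eq_zero.1 h3 with h | h
      · simp [h1, h]
      · rw [pow_eq_zero_iff two_ne_zero] at h
        simp [h1, h, h2]
    simp [h4, Real.zero_rpow hq.ne']
  · have hcq : 0 ≤ c * σ ^ 2 * (2 * q) := by positivity
    have hTE : T = E + c * σ ^ 2 * (2 * q) := by rw [hT, hE]; ring
    have hT0 : 0 < T := by linarith
    -- The term 2q in T is there exactly so that 1 - 2μσ² with μ = qc/T is the positive number E/T.
    have hs : E / T = 1 - 2 * ((q / T * c) * σ ^ 2) := by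
      field_simp; rw [hTE]; ring
    have hs0 : 0 < E / T := by positivity
    have hb := lintegral_exp_sq_stdGaussian_le (q / T * c) σ u hs hs0
    calc _ ≤ ∫⁻ g, ENNReal.ofReal (T ^ q * Real.exp (-q) * Real.exp (q / T * A)) *
          ENNReal.ofReal (Real.exp ((q / T * c) * ‖u + σ • g‖ ^ 2)) ∂stdGaussian (Pos d) := by
          refine lintegral_mono fun g => ?_
          rw [← ENNReal.ofReal_mul (by positivity)]
          refine ENNReal.ofReal_le_ofReal ((rpow_le_mul_exp (by positivity) hT0 hq.le).trans
            (le_of_eq ?_))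
          rw [mul_assoc (T ^ q * Real.exp (-q)), ← Real.exp_add]
          congr 2
          ring
      _ ≤ ENNReal.ofReal (T ^ q * Real.exp (-q) * Real.exp (q / T * A)) * ENNReal.ofReal
          (Real.exp ((d * ((q / T * c) * σ ^ 2) + (q / T * c) * ‖u‖ ^ 2) / (E / T))) := by
          rw [lintegral_const_mul _ (by fun_prop)]
          gcongr
      _ ≤ _ := by
          rw [← ENNReal.ofReal_mul (by positivity)]
          refine ENNReal.ofReal_le_ofReal ?_
          rw [mul_assoc, mul_assoc, ← Real.exp_add, ← Real.exp_add]
          refine mul_le_of_le_one_right (by positivity) (Real.exp_le_one_iff.2 ?_)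
          -- The total exponent is -q + qA/T + q(E - A)/E = qA/T - qA/E, which is nonpositive as E ≤
          -- T.
          have h5 : (d * ((q / T * c) * σ ^ 2) + (q / T * c) * ‖u‖ ^ 2) / (E / T) =
              q * (E - A) / E := by
            rw [hE]; field_simp; ring
          have h6 : q / T * A ≤ q * A / E := by
            rw [div_mul_eq_mul_div]
            gcongr
            linarith
          rw [h5]
          have h7 : q * (E - A) / E = q - q * A / E := by field_simp
          linarith

/-! ### Jensen's inequality for the exponential -/

/-- Jensen without integrability of the exponential: if it is not integrable, the right-hand side is
infinite. -/
lemma ofReal_exp_integral_le {α : Type*} [MeasurableSpace α] {μ : Measure α}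
    [IsProbabilityMeasure μ] {f : α → ℝ} (hf : Integrable f μ) :
    ENNReal.ofReal (Real.exp (∫ x, f x ∂μ)) ≤ ∫⁻ x, ENNReal.ofReal (Real.exp (f x)) ∂μ := by
  by_cases h : Integrable (fun x => Real.exp (f x)) μ
  · rw [← ofReal_integral_eq_lintegral_ofReal h (ae_of_all _ fun x => (Real.exp_pos _).le)]
    exact ENNReal.ofReal_le_ofReal (convexOn_exp.map_integral_le Real.continuous_exp.continuousOn
      isClosed_univ (by simp) hf h)
  · have : ∫⁻ x, ENNReal.ofReal (Real.exp (f x)) ∂μ = ∞ := by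
      by_contra hne
      refine h ⟨Real.continuous_exp.comp_aestronglyMeasurable hf.1, ?_⟩
      rw [hasFiniteIntegral_iff_ofReal (ae_of_all _ fun x => (Real.exp_pos _).le)]
      exact lt_of_le_of_ne le_top hne
    rw [this]
    exact le_top

end Langevin
end

noncomputable section

namespace Langevin

open scoped NNReal Convolution in
/-- A Lipschitz function is a uniform limit of `C¹` functions with the same Lipschitz constant. -/
lemma exists_contDiff_lipschitz_approx {E : Type*} [NormedAddCommGroup E] [InnerProductSpace ℝ E]
    [FiniteDimensional ℝ E] [MeasurableSpace E] [BorelSpace E] {f : E → ℝ} {K : ℝ≥0}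
    (hf : LipschitzWith K f) {ε : ℝ} (hε : 0 < ε) :
    ∃ g : E → ℝ, ContDiff ℝ 1 g ∧ LipschitzWith K g ∧ ∀ x, |g x - f x| ≤ ε := by
  set μ : Measure E := Measure.addHaar
  obtain ⟨r, hr, hKr⟩ : ∃ r : ℝ, 0 < r ∧ K * r ≤ ε :=
    ⟨ε / (K + 1), by positivity, by
      rw [mul_div_assoc', div_le_iff₀ (by positivity)]; nlinarith [K.coe_nonneg]⟩
  let φ : ContDiffBump (0 : E) := ⟨r / 2, r, by positivity, by linarith⟩
  refine ⟨φ.normed μ ⋆[ContinuousLinearMap.lsmul ℝ ℝ, μ] f, ?_, ?_, fun x => ?_⟩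
  · exact φ.hasCompactSupport_normed.contDiff_convolution_left _ φ.contDiff_normed
      hf.continuous.locallyIntegrable
  · refine LipschitzWith.of_dist_le_mul fun x y => ?_
    have hint : ∀ z : E, Integrable (fun t => φ.normed μ t * f (z - t)) μ := fun z =>
      (φ.continuous_normed.mul (hf.continuous.comp (by fun_prop))).integrable_of_hasCompactSupport
        φ.hasCompactSupport_normed.mul_right
    simp only [convolution, ContinuousLinearMap.lsmul_apply, smul_eq_mul]
    rw [Real.dist_eq, ← integral_sub (hint x) (hint y)]
    refine (abs_integral_le_integral_abs).trans ?_
    calc _ ≤ ∫ t, φ.normed μ t * (K * dist x y) ∂μ := by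
          refine integral_mono ((hint x).sub (hint y)).abs (φ.integrable_normed.mul_const _)
            fun t => ?_
          rw [← mul_sub, abs_mul, abs_of_nonneg (φ.nonneg_normed t)]
          refine mul_le_mul_of_nonneg_left ?_ (φ.nonneg_normed t)
          have := hf.dist_le_mul (x - t) (y - t)
          rwa [Real.dist_eq, dist_sub_right] at this
      _ = _ := by rw [integral_mul_const, φ.integral_normed, one_mul]
  · have := φ.dist_normed_convolution_le (μ := μ) (x₀ := x) (ε := ε)
      hf.continuous.aestronglyMeasurable fun y hy => by
        refine (hf.dist_le_mul y x).trans (le_trans ?_ hKr)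
        gcongr
        exact (Metric.mem_ball.1 hy).le
    rwa [Real.dist_eq] at this

/-! ### Gaussian concentration -/

lemma lintegral_exp_strongDual_stdGaussian {E : Type*} [NormedAddCommGroup E]
    [InnerProductSpace ℝ E] [FiniteDimensional ℝ E] [MeasurableSpace E] [BorelSpace E]
    (l : StrongDual ℝ E) :
    ∫⁻ y, ENNReal.ofReal (Real.exp (l y)) ∂stdGaussian E =
      ENNReal.ofReal (Real.exp (‖l‖ ^ 2 / 2)) := by
  have hmap := IsGaussian.map_eq_gaussianReal (μ := stdGaussian E) l
  rw [integral_strongDual_stdGaussian, variance_dual_stdGaussian] at hmap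
  have h1 : ∫⁻ y, ENNReal.ofReal (Real.exp (l y)) ∂stdGaussian E =
      ∫⁻ t, ENNReal.ofReal (Real.exp t) ∂((stdGaussian E).map l) := by
    rw [lintegral_map (by fun_prop) (by fun_prop)]
  have hi := integrable_exp_mul_gaussianReal (μ := 0) (v := (‖l‖ ^ 2).toNNReal) 1
  simp only [one_mul] at hi
  rw [h1, hmap, ← ofReal_integral_eq_lintegral_ofReal hi (ae_of_all _ fun x => (Real.exp_pos _).le)]
  have h2 := congrFun (mgf_id_gaussianReal (μ := 0) (v := (‖l‖ ^ 2).toNNReal)) 1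
  simp only [mgf, id_eq, one_mul, zero_add, one_pow, mul_one] at h2
  rw [h2, Real.coe_toNNReal _ (by positivity)]

lemma lintegral_rotation_stdGaussian {E : Type*} [NormedAddCommGroup E]
    [InnerProductSpace ℝ E] [FiniteDimensional ℝ E] [MeasurableSpace E] [BorelSpace E]
    (θ : ℝ) {G : E × E → ℝ≥0∞} (hG : Measurable G) :
    ∫⁻ p, G (Real.cos θ • p.1 + Real.sin θ • p.2, -Real.sin θ • p.1 + Real.cos θ • p.2)
      ∂((stdGaussian E).prod (stdGaussian E)) =
    ∫⁻ x, ∫⁻ y, G (x, y) ∂stdGaussian E ∂stdGaussian E := by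
  have hrot := IsGaussian.map_rotation_eq_self_of_forall_strongDual_eq_zero (μ := stdGaussian E)
    (fun L => integral_strongDual_stdGaussian L) θ
  have hm : Measurable (ContinuousLinearMap.rotation (E := E) θ) :=
    (ContinuousLinearMap.continuous _).measurable
  have h := lintegral_map (μ := (stdGaussian E).prod (stdGaussian E)) hG hm
  rw [hrot, lintegral_prod _ hG.aemeasurable] at h
  rw [h]
  refine lintegral_congr fun p => ?_
  rw [ContinuousLinearMap.rotation_apply]

open scoped NNReal in
/-- The Maurey–Pisier inequality for `C¹` functions. -/
lemma lintegral_exp_sub_le_of_contDiff {E : Type*} [NormedAddCommGroup E]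
    [InnerProductSpace ℝ E] [FiniteDimensional ℝ E] [MeasurableSpace E] [BorelSpace E]
    {f : E → ℝ} {K : ℝ≥0} (hf : ContDiff ℝ 1 f) (hK : LipschitzWith K f) :
    ∫⁻ p, ENNReal.ofReal (Real.exp (f p.2 - f p.1)) ∂((stdGaussian E).prod (stdGaussian E)) ≤
      ENNReal.ofReal (Real.exp (Real.pi ^ 2 / 8 * K ^ 2)) := by
  have hπ := Real.pi_pos
  -- The uniform law on the angles of the quarter circle leading from the first Gaussian point to
  -- the second.
  set ν : Measure ℝ := ENNReal.ofReal (2 / Real.pi) • volume.restrict (Set.Ioc 0 (Real.pi / 2))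
    with hν
  have hνp : IsProbabilityMeasure ν := by
    constructor
    rw [hν, Measure.smul_apply, Measure.restrict_apply_univ, Real.volume_Ioc, smul_eq_mul,
      ← ENNReal.ofReal_mul (by positivity), ← ENNReal.ofReal_one]
    congr 1
    field_simp
    ring
  have hdf : Continuous (fderiv ℝ f) := hf.continuous_fderiv (by norm_num)
  -- The derivative of f along the arc, scaled by π/2 so that its ν-mean is f(p.2) - f(p.1); Jensen
  -- then moves the exponential inside the mean.
  obtain ⟨F, hF⟩ : ∃ F : ℝ → E × E → ℝ, ∀ θ p, F θ p = Real.pi / 2 *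
    fderiv ℝ f (Real.cos θ • p.1 + Real.sin θ • p.2) (-Real.sin θ • p.1 + Real.cos θ • p.2) :=
    ⟨_, fun _ _ => rfl⟩
  have hFc : Continuous (fun q : ℝ × E × E => F q.1 q.2) := by
    have h1 : Continuous fun q : ℝ × E × E => Real.cos q.1 • q.2.1 + Real.sin q.1 • q.2.2 := by
      fun_prop
    have h2 : Continuous fun q : ℝ × E × E => -Real.sin q.1 • q.2.1 + Real.cos q.1 • q.2.2 := by
      fun_prop
    simp only [hF]
    exact continuous_const.mul ((hdf.comp h1).clm_apply h2)
  have hpath : ∀ p : E × E, ∫ θ, F θ p ∂ν = f p.2 - f p.1 := by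
    intro p
    have hder : ∀ θ ∈ Set.uIcc 0 (Real.pi / 2),
        HasDerivAt (fun θ => f (Real.cos θ • p.1 + Real.sin θ • p.2))
        (fderiv ℝ f (Real.cos θ • p.1 + Real.sin θ • p.2)
          (-Real.sin θ • p.1 + Real.cos θ • p.2)) θ := fun θ _ =>
      ((hf.differentiable (by norm_num)) _).hasFDerivAt.comp_hasDerivAt θ
        (((Real.hasDerivAt_cos θ).smul_const p.1).add ((Real.hasDerivAt_sin θ).smul_const p.2))
    have hcont : Continuous fun θ => fderiv ℝ f (Real.cos θ • p.1 + Real.sin θ • p.2)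
          (-Real.sin θ • p.1 + Real.cos θ • p.2) :=
      (hdf.comp (by fun_prop)).clm_apply (by fun_prop)
    have := intervalIntegral.integral_eq_sub_of_hasDerivAt hder (hcont.intervalIntegrable _ _)
    rw [intervalIntegral.integral_of_le (by positivity)] at this
    simp only [Real.cos_pi_div_two, zero_smul, Real.sin_pi_div_two, one_smul, zero_add,
      Real.cos_zero, Real.sin_zero, add_zero] at this
    simp only [hF]
    rw [← this, hν, integral_smul_measure, integral_const_mul,
      ENNReal.toReal_ofReal (by positivity), smul_eq_mul, ← mul_assoc]
    have : 2 / Real.pi * (Real.pi / 2) = 1 := by field_simp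
    rw [this, one_mul]
  have hint : ∀ p : E × E, Integrable (fun θ => F θ p) ν := fun p => by
    refine Integrable.smul_measure ?_ ENNReal.ofReal_ne_top
    have : Continuous fun θ => F θ p := hFc.comp (continuous_id.prodMk continuous_const)
    exact (this.integrableOn_Icc (a := 0) (b := Real.pi / 2)).mono_set Set.Ioc_subset_Icc_self
  calc _ ≤ ∫⁻ p, ∫⁻ θ, ENNReal.ofReal (Real.exp (F θ p)) ∂ν ∂((stdGaussian E).prod (stdGaussian E)) := by
        refine lintegral_mono fun p => ?_
        rw [← hpath p]
        exact ofReal_exp_integral_le (hint p)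
    _ = ∫⁻ θ, ∫⁻ p, ENNReal.ofReal (Real.exp (F θ p)) ∂((stdGaussian E).prod (stdGaussian E)) ∂ν := by
        have hm : Continuous fun q : (E × E) × ℝ => ENNReal.ofReal (Real.exp (F q.2 q.1)) := by
          have h3 : Continuous fun q : (E × E) × ℝ => F q.2 q.1 :=
            hFc.comp (continuous_snd.prodMk continuous_fst)
          exact ENNReal.continuous_ofReal.comp (Real.continuous_exp.comp h3)
        exact lintegral_lintegral_swap hm.measurable.aemeasurable
    -- For a fixed angle, position and tangent on the arc are again independent standard Gaussians.
    -- Given the position, the exponent is a Gaussian variable of standard deviation at most πK/2.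
    _ ≤ ∫⁻ _, ENNReal.ofReal (Real.exp (Real.pi ^ 2 / 8 * K ^ 2)) ∂ν := by
        refine lintegral_mono fun θ => ?_
        obtain ⟨G, hGd⟩ : ∃ G : E × E → ℝ≥0∞, ∀ p, G p =
          ENNReal.ofReal (Real.exp (((Real.pi / 2) • fderiv ℝ f p.1) p.2)) := ⟨_, fun _ => rfl⟩
        have hG : Measurable G := by
          have h4 : Continuous fun p : E × E => ((Real.pi / 2) • fderiv ℝ f p.1) p.2 :=
            ((hdf.comp continuous_fst).const_smul (Real.pi / 2)).clm_apply continuous_snd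
          rw [funext hGd]
          exact (ENNReal.continuous_ofReal.comp (Real.continuous_exp.comp h4)).measurable
        calc ∫⁻ p, ENNReal.ofReal (Real.exp (F θ p)) ∂((stdGaussian E).prod (stdGaussian E))
            = ∫⁻ x, ∫⁻ y, G (x, y) ∂stdGaussian E ∂stdGaussian E := by
              rw [← lintegral_rotation_stdGaussian θ hG]
              refine lintegral_congr fun p => ?_
              rw [hGd, hF, _root_.smul_apply, smul_eq_mul]
          _ ≤ ∫⁻ _, ENNReal.ofReal (Real.exp (Real.pi ^ 2 / 8 * K ^ 2)) ∂stdGaussian E := by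
              refine lintegral_mono fun x => ?_
              simp only [hGd]
              rw [lintegral_exp_strongDual_stdGaussian]
              refine ENNReal.ofReal_le_ofReal (Real.exp_le_exp.2 ?_)
              have h1 : ‖fderiv ℝ f x‖ ≤ K := norm_fderiv_le_of_lipschitz ℝ hK
              rw [norm_smul, mul_pow, Real.norm_of_nonneg (by positivity)]
              have := pow_le_pow_left₀ (norm_nonneg _) h1 2
              have h2 : 0 ≤ (Real.pi / 2) ^ 2 := by positivity
              have := mul_le_mul_of_nonneg_left this h2
              linarith
          _ = _ := by simp
    _ = _ := by simp

open scoped NNReal in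
lemma integrable_of_lipschitz_of_integrable_norm {E : Type*} [NormedAddCommGroup E]
    [MeasurableSpace E] [BorelSpace E] [SecondCountableTopology E] {μ : Measure E}
    [IsFiniteMeasure μ] {f : E → ℝ} {K : ℝ≥0}
    (hK : LipschitzWith K f) (h : Integrable (fun x => ‖x‖) μ) : Integrable f μ := by
  refine ((h.const_mul (K : ℝ)).add (integrable_const |f 0|)).mono'
    hK.continuous.aestronglyMeasurable (ae_of_all _ fun x => ?_)
  have := hK.dist_le_mul x 0
  rw [Real.dist_eq, dist_zero_right] at this
  have h2 := abs_sub_abs_le_abs_sub (f x) (f 0)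
  simp only [Pi.add_apply, Real.norm_eq_abs]
  linarith

open scoped NNReal in
/-- Gaussian concentration for Lipschitz functions. -/
lemma lintegral_exp_le_of_lipschitz {E : Type*} [NormedAddCommGroup E]
    [InnerProductSpace ℝ E] [FiniteDimensional ℝ E] [MeasurableSpace E] [BorelSpace E]
    {f : E → ℝ} {K : ℝ≥0} (hK : LipschitzWith K f) :
    ∫⁻ x, ENNReal.ofReal (Real.exp (f x)) ∂stdGaussian E ≤
      ENNReal.ofReal (Real.exp (∫ x, f x ∂stdGaussian E + Real.pi ^ 2 / 8 * K ^ 2)) := by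
  set γ := stdGaussian E
  have hn : Integrable (fun x : E => ‖x‖) γ := (IsGaussian.integrable_id (μ := γ)).norm
  have key : ∀ ε : ℝ, 0 < ε → ∫⁻ x, ENNReal.ofReal (Real.exp (f x)) ∂γ ≤
      ENNReal.ofReal (Real.exp (∫ x, f x ∂γ + Real.pi ^ 2 / 8 * K ^ 2 + 2 * ε)) := by
    intro ε hε
    obtain ⟨g, hg, hgK, hgf⟩ := exists_contDiff_lipschitz_approx hK hε
    have hgi := integrable_of_lipschitz_of_integrable_norm hgK hn
    have hfi := integrable_of_lipschitz_of_integrable_norm hK hn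
    have h1 := lintegral_exp_sub_le_of_contDiff hg hgK
    have hcg := hgK.continuous
    have hcf := hK.continuous
    rw [lintegral_prod _ (by fun_prop)] at h1
    have h2 : ∀ x, ∫⁻ y, ENNReal.ofReal (Real.exp (g y - g x)) ∂γ =
        ENNReal.ofReal (Real.exp (-g x)) * ∫⁻ y, ENNReal.ofReal (Real.exp (g y)) ∂γ := by
      intro x
      rw [← lintegral_const_mul _ (by fun_prop)]
      congr with y
      rw [← ENNReal.ofReal_mul (Real.exp_pos _).le, ← Real.exp_add]
      congr 2; ring
    simp only [γ, h2] at h1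
    rw [lintegral_mul_const _ (by fun_prop)] at h1
    -- Jensen bounds the factor of the independent copy from below by exp(-∫g), which is then moved
    -- to the other side.
    have h3 := ofReal_exp_integral_le hgi.neg
    simp only [Pi.neg_apply, integral_neg] at h3
    have h4 := (mul_le_mul_left h3 (∫⁻ y, ENNReal.ofReal (Real.exp (g y)) ∂γ)).trans h1
    have h5 : ∫⁻ y, ENNReal.ofReal (Real.exp (g y)) ∂γ ≤
        ENNReal.ofReal (Real.exp (∫ x, g x ∂γ + Real.pi ^ 2 / 8 * K ^ 2)) := by
      have := mul_le_mul_right h4 (ENNReal.ofReal (Real.exp (∫ x, g x ∂γ)))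
      rwa [← mul_assoc, ← ENNReal.ofReal_mul (Real.exp_pos _).le, ← Real.exp_add,
        ← ENNReal.ofReal_mul (Real.exp_pos _).le, ← Real.exp_add, add_neg_cancel, Real.exp_zero,
        ENNReal.ofReal_one, one_mul] at this
    have h6 : ∫ x, g x ∂γ ≤ ∫ x, f x ∂γ + ε := by
      have : ∫ x, g x ∂γ ≤ ∫ x, (f x + ε) ∂γ :=
        integral_mono hgi (hfi.add (integrable_const ε)) fun x => by
          have := (abs_le.1 (hgf x)).2; simp only; linarith
      rwa [integral_add hfi (integrable_const ε), integral_const, probReal_univ, one_smul] at this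
    calc _ ≤ ∫⁻ x, ENNReal.ofReal (Real.exp ε) * ENNReal.ofReal (Real.exp (g x)) ∂γ := by
          refine lintegral_mono fun x => ?_
          rw [← ENNReal.ofReal_mul (Real.exp_pos _).le, ← Real.exp_add]
          refine ENNReal.ofReal_le_ofReal (Real.exp_le_exp.2 ?_)
          have := (abs_le.1 (hgf x)).1; linarith
      _ ≤ ENNReal.ofReal (Real.exp ε) *
          ENNReal.ofReal (Real.exp (∫ x, g x ∂γ + Real.pi ^ 2 / 8 * K ^ 2)) := by
          rw [lintegral_const_mul _ (by fun_prop)]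
          gcongr
      _ ≤ _ := by
          rw [← ENNReal.ofReal_mul (Real.exp_pos _).le, ← Real.exp_add]
          refine ENNReal.ofReal_le_ofReal (Real.exp_le_exp.2 ?_)
          linarith
  have hlim : Filter.Tendsto (fun ε : ℝ => ENNReal.ofReal
      (Real.exp (∫ x, f x ∂γ + Real.pi ^ 2 / 8 * K ^ 2 + 2 * ε))) (nhdsWithin 0 (Set.Ioi 0))
      (nhds (ENNReal.ofReal (Real.exp (∫ x, f x ∂γ + Real.pi ^ 2 / 8 * K ^ 2 + 2 * 0)))) := by
    refine Filter.Tendsto.mono_left ?_ nhdsWithin_le_nhds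
    exact Continuous.tendsto (ENNReal.continuous_ofReal.comp (by fun_prop)) 0
  rw [mul_zero, add_zero] at hlim
  exact ge_of_tendsto hlim (Filter.eventually_of_mem self_mem_nhdsWithin fun ε hε => key ε hε)

end Langevin
end

noncomputable section

namespace Langevin

open scoped NNReal

/-! ### From the log-Sobolev inequality to concentration -/

lemma norm_fderiv_exp_const_mul_le {E : Type*} [NormedAddCommGroup E] [NormedSpace ℝ E]
    {f : E → ℝ} {K : ℝ≥0} (hf : ContDiff ℝ 1 f) (hK : LipschitzWith K f) (t : ℝ) (z : E) :
    ‖fderiv ℝ (fun z => Real.exp (t * f z)) z‖ ≤ |t| * K * Real.exp (t * f z) := by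
  have h1 := (((hf.differentiable (by norm_num)) z).hasFDerivAt.const_mul t).exp
  rw [h1.fderiv, norm_smul, norm_smul, Real.norm_eq_abs, Real.norm_eq_abs,
    abs_of_pos (Real.exp_pos _), mul_comm (Real.exp _)]
  have h2 : ‖fderiv ℝ f z‖ ≤ K := norm_fderiv_le_of_lipschitz ℝ hK
  gcongr

lemma lipschitzWith_exp_const_mul {E : Type*} [NormedAddCommGroup E] [NormedSpace ℝ E]
    {f : E → ℝ} {K : ℝ≥0} (hf : ContDiff ℝ 1 f) (hK : LipschitzWith K f) {t B : ℝ}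
    (hB : ∀ z, Real.exp (t * f z) ≤ B) :
    LipschitzWith (Real.toNNReal (|t| * K * B)) (fun z => Real.exp (t * f z)) := by
  refine lipschitzWith_of_nnnorm_fderiv_le (𝕜 := ℝ)
    ((contDiff_const.mul hf).exp.differentiable (n := 1) (by norm_num)) fun z => ?_
  rw [← norm_toNNReal]
  refine Real.toNNReal_le_toNNReal ((norm_fderiv_exp_const_mul_le hf hK t z).trans ?_)
  exact mul_le_mul_of_nonneg_left (hB z) (by positivity)

/-- Herbst's argument for bounded `C¹` functions. -/
lemma LogSobolev.cgf_le {d : ℕ} {μ : Measure (Phase d)} [IsProbabilityMeasure μ] {C : ℝ}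
    (hC : 0 ≤ C) (hμ : LogSobolev μ C) {f : Phase d → ℝ} {K : ℝ≥0} (hf : ContDiff ℝ 1 f)
    (hK : LipschitzWith K f) {B : ℝ} (hB : ∀ z, |f z| ≤ B) :
    cgf f μ 1 ≤ ∫ z, f z ∂μ + C * K ^ 2 / 4 := by
  have hcf := hf.continuous
  have hint : ∀ t, Integrable (fun z => Real.exp (t * f z)) μ := fun t =>
    integrable_exp_mul_of_mem_Icc hcf.aemeasurable (ae_of_all _ fun z => abs_le.1 (hB z))
  have hset : interior (integrableExpSet f μ) = Set.univ := by
    rw [Set.eq_univ_of_forall (s := integrableExpSet f μ) hint, interior_univ]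
  have hmem : ∀ t, t ∈ interior (integrableExpSet f μ) := fun t => hset ▸ Set.mem_univ t
  have hM : ∀ t, 0 < mgf f μ t := fun t => mgf_pos (hint t)
  have hder : ∀ t, HasDerivAt (cgf f μ)
      ((∫ z, f z * Real.exp (t * f z) ∂μ) / mgf f μ t) t := fun t => by
    rw [← deriv_cgf (hmem t)]
    exact (analyticAt_cgf (hmem t)).differentiableAt.hasDerivAt
  have hent : ∀ t, t * ((∫ z, f z * Real.exp (t * f z) ∂μ) / mgf f μ t) - cgf f μ t ≤
      C * K ^ 2 / 4 * t ^ 2 := by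
    intro t
    -- With the test function exp(tf/2) the log-Sobolev inequality bounds the entropy of exp(tf),
    -- which is the moment generating function times t·cgf' - cgf.
    set g : Phase d → ℝ := fun z => Real.exp (t / 2 * f z) with hg
    have hgB : ∀ z, g z ≤ Real.exp (|t / 2| * B) := fun z => by
      refine Real.exp_le_exp.2 ((le_abs_self _).trans ?_)
      rw [abs_mul]; exact mul_le_mul_of_nonneg_left (hB z) (abs_nonneg _)
    have hg2 : ∀ z, g z ^ 2 = Real.exp (t * f z) := fun z => by
      rw [hg, ← Real.exp_nat_mul]; congr 1; push_cast; ring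
    have hgrad : ∀ z, ‖gradient g z‖ ≤ |t / 2| * K * g z := fun z => by
      rw [gradient, LinearIsometryEquiv.norm_map]
      exact norm_fderiv_exp_const_mul_le hf hK (t / 2) z
    have hgd : ContDiff ℝ 1 g := (contDiff_const.mul hf).exp
    have hgL := lipschitzWith_exp_const_mul hf hK hgB
    have key := hμ g hgd ⟨_, hgL⟩
      ⟨Real.exp (|t / 2| * B), fun z => by rw [abs_of_pos (Real.exp_pos _)]; exact hgB z⟩
    simp only [hg2, Real.log_exp] at key
    have h2 : ∫ z, ‖gradient g z‖ ^ 2 ∂μ ≤ t ^ 2 / 4 * K ^ 2 * mgf f μ t := by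
      rw [mgf, ← integral_const_mul]
      refine integral_mono_of_nonneg (ae_of_all _ fun z => by positivity)
        ((hint t).const_mul _) (ae_of_all _ fun z => ?_)
      have := pow_le_pow_left₀ (norm_nonneg _) (hgrad z) 2
      rw [mul_pow, mul_pow, hg2, sq_abs] at this
      refine this.trans (le_of_eq ?_)
      ring
    have h3 : ∫ z, Real.exp (t * f z) * (t * f z) ∂μ = t * ∫ z, f z * Real.exp (t * f z) ∂μ := by
      rw [← integral_const_mul]; congr with z; ring
    rw [h3] at key
    have h4 := mul_le_mul_of_nonneg_left h2 hC
    rw [show cgf f μ t = Real.log (mgf f μ t) from rfl, mul_div_assoc', sub_le_iff_le_add,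
      div_le_iff₀ (hM t)]
    have h5 : ∫ z, Real.exp (t * f z) ∂μ = mgf f μ t := rfl
    rw [h5] at key
    nlinarith
  -- The entropy bound says that the derivative of cgf(t)/t is at most CK²/4, so ψ is nonincreasing
  -- on the positive half-line; its limit at 0 is the mean of f.
  set ψ : ℝ → ℝ := fun t => cgf f μ t / t - C * K ^ 2 / 4 * t with hψ
  have hψd : ∀ t, 0 < t → HasDerivAt ψ ((((∫ z, f z * Real.exp (t * f z) ∂μ) / mgf f μ t) * t -
      cgf f μ t * 1) / t ^ 2 - C * K ^ 2 / 4 * 1) t := fun t ht =>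
    ((hder t).div (hasDerivAt_id t) ht.ne').sub ((hasDerivAt_id t).const_mul _)
  have hanti : AntitoneOn ψ (Set.Ioi 0) := by
    refine antitoneOn_of_deriv_nonpos (convex_Ioi 0)
      (fun t ht => (hψd t ht).continuousAt.continuousWithinAt)
      (fun t ht => (hψd t (by simpa using ht)).differentiableAt.differentiableWithinAt)
      fun t ht => ?_
    have ht' : 0 < t := by simpa using ht
    rw [(hψd t ht').deriv, sub_nonpos, div_le_iff₀ (by positivity)]
    have := hent t
    linarith
  have hlim : Filter.Tendsto ψ (nhdsWithin 0 (Set.Ioi 0)) (nhds (∫ z, f z ∂μ)) := by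
    have h0 : HasDerivAt (cgf f μ) (∫ z, f z ∂μ) 0 := by
      have := hder 0
      simpa using this
    have h1 := h0.tendsto_slope_zero_right
    have h2 : Filter.Tendsto (fun t : ℝ => C * K ^ 2 / 4 * t) (nhdsWithin 0 (Set.Ioi 0))
        (nhds (C * K ^ 2 / 4 * 0)) :=
      (Continuous.tendsto (by fun_prop) 0).mono_left nhdsWithin_le_nhds
    have h3 := h1.sub h2
    simp only [zero_add, cgf_zero, sub_zero, mul_zero, smul_eq_mul] at h3
    refine h3.congr fun t => ?_
    rw [hψ]; ring
  have h1 : ψ 1 ≤ ∫ z, f z ∂μ := by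
    refine ge_of_tendsto hlim ?_
    filter_upwards [Ioo_mem_nhdsGT (zero_lt_one (α := ℝ))] with t ht
    exact hanti (Set.mem_Ioi.2 ht.1) (Set.mem_Ioi.2 zero_lt_one) ht.2.le
  rw [hψ] at h1
  simp only [div_one, mul_one] at h1
  linarith

lemma LogSobolev.lintegral_exp_le_of_bounded {d : ℕ} {μ : Measure (Phase d)}
    [IsProbabilityMeasure μ] {C : ℝ}
    (hC : 0 ≤ C) (hμ : LogSobolev μ C) {f : Phase d → ℝ} {K : ℝ≥0} (hf : ContDiff ℝ 1 f)
    (hK : LipschitzWith K f) {B : ℝ} (hB : ∀ z, |f z| ≤ B) :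
    ∫⁻ z, ENNReal.ofReal (Real.exp (f z)) ∂μ ≤
      ENNReal.ofReal (Real.exp (∫ z, f z ∂μ + C * K ^ 2 / 4)) := by
  have hint : Integrable (fun z => Real.exp (1 * f z)) μ :=
    integrable_exp_mul_of_mem_Icc hf.continuous.aemeasurable
      (ae_of_all _ fun z => abs_le.1 (hB z))
  have h := hμ.cgf_le hC hf hK hB
  rw [cgf, Real.log_le_iff_le_exp (mgf_pos hint)] at h
  simp only [one_mul] at hint
  rw [← ofReal_integral_eq_lintegral_ofReal hint (ae_of_all _ fun z => (Real.exp_pos _).le)]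
  simp only [mgf, one_mul] at h
  exact ENNReal.ofReal_le_ofReal h

/-- A smooth, bounded and `1`-Lipschitz truncation of a real number. -/
def smoothTrunc (n : ℕ) (x : ℝ) : ℝ := (n + 1) * Real.arctan ((n + 1 : ℝ)⁻¹ * x)

lemma contDiff_smoothTrunc (n : ℕ) : ContDiff ℝ 1 (smoothTrunc n) := by
  unfold smoothTrunc
  exact contDiff_const.mul (Real.contDiff_arctan.comp (contDiff_const.mul contDiff_id))

lemma lipschitzWith_smoothTrunc (n : ℕ) : LipschitzWith 1 (smoothTrunc n) := by
  refine lipschitzWith_of_nnnorm_deriv_le ((contDiff_smoothTrunc n).differentiable (by norm_num))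
    fun x => ?_
  have h : HasDerivAt (smoothTrunc n) ((n + 1) * (1 / (1 + ((n + 1 : ℝ)⁻¹ * x) ^ 2) *
      ((n + 1 : ℝ)⁻¹ * 1))) x :=
    (((hasDerivAt_id x).const_mul _).arctan).const_mul _
  have hn : (0 : ℝ) < n + 1 := by positivity
  have h1 : (n + 1 : ℝ) * (1 / (1 + ((n + 1 : ℝ)⁻¹ * x) ^ 2) * ((n + 1 : ℝ)⁻¹ * 1)) =
      1 / (1 + ((n + 1 : ℝ)⁻¹ * x) ^ 2) := by field_simp
  rw [h.deriv, h1, ← NNReal.coe_le_coe, coe_nnnorm, Real.norm_of_nonneg (by positivity),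
    NNReal.coe_one, div_le_one (by positivity)]
  nlinarith [sq_nonneg ((n + 1 : ℝ)⁻¹ * x)]

lemma abs_smoothTrunc_le_abs (n : ℕ) (x : ℝ) : |smoothTrunc n x| ≤ |x| := by
  have := (lipschitzWith_smoothTrunc n).dist_le_mul x 0
  simpa [Real.dist_eq, smoothTrunc] using this

lemma abs_smoothTrunc_le (n : ℕ) (x : ℝ) : |smoothTrunc n x| ≤ (n + 1) * (Real.pi / 2) := by
  rw [smoothTrunc, abs_mul, abs_of_nonneg (by positivity : (0 : ℝ) ≤ n + 1)]
  exact mul_le_mul_of_nonneg_left (abs_le.2 ⟨(Real.neg_pi_div_two_lt_arctan _).le,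
    (Real.arctan_lt_pi_div_two _).le⟩) (by positivity)

lemma tendsto_smoothTrunc (x : ℝ) :
    Filter.Tendsto (fun n => smoothTrunc n x) Filter.atTop (nhds x) := by
  have h : HasDerivAt (fun t : ℝ => Real.arctan (t * x)) x 0 := by
    have := ((hasDerivAt_id (0 : ℝ)).mul_const x).arctan
    simpa using this
  have h1 := h.tendsto_slope_zero_right
  have h2 : Filter.Tendsto (fun n : ℕ => ((n : ℝ) + 1)⁻¹) Filter.atTop
      (nhdsWithin 0 (Set.Ioi 0)) := by
    refine tendsto_nhdsWithin_iff.2 ⟨?_, Filter.Eventually.of_forall fun n => ?_⟩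
    · simpa using tendsto_one_div_add_atTop_nhds_zero_nat (𝕜 := ℝ)
    · simp only [Set.mem_Ioi]; positivity
  refine (h1.comp h2).congr fun n => ?_
  simp [smoothTrunc]

/-- A measure satisfying a log-Sobolev inequality has a finite first moment. -/
lemma LogSobolev.integrable_norm {d : ℕ} {μ : Measure (Phase d)} [IsProbabilityMeasure μ] {C : ℝ}
    (hC : 0 ≤ C) (hμ : LogSobolev μ C) : Integrable (fun z => ‖z‖) μ := by
  obtain ⟨g₀, hg₀, hg₀L, hg₀n⟩ := exists_contDiff_lipschitz_approx
    (lipschitzWith_one_norm (E := Phase d)) zero_lt_one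
  obtain ⟨g, hg, hgL, hgn⟩ : ∃ g : Phase d → ℝ, ContDiff ℝ 1 g ∧ LipschitzWith 1 g ∧
      ∀ z, ‖z‖ ≤ g z := by
    refine ⟨fun z => g₀ z + 1, hg₀.add contDiff_const, ?_, fun z => ?_⟩
    · have := hg₀L.add (LipschitzWith.const (1 : ℝ)); simpa using this
    · have := (abs_le.1 (hg₀n z)).1; linarith
  have hg0 : ∀ z, 0 ≤ g z := fun z => (norm_nonneg z).trans (hgn z)
  set T : ℕ → Phase d → ℝ := fun n z => smoothTrunc n (g z) with hT
  have hTd : ∀ n, ContDiff ℝ 1 (T n) := fun n => (contDiff_smoothTrunc n).comp hg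
  have hTL : ∀ n, LipschitzWith 1 (T n) := fun n => by
    have := (lipschitzWith_smoothTrunc n).comp hgL; rwa [mul_one] at this
  have hTB : ∀ n z, |T n z| ≤ (n + 1) * (Real.pi / 2) := fun n z => abs_smoothTrunc_le n _
  have hTi : ∀ n, Integrable (T n) μ := fun n =>
    Integrable.of_bound (hTd n).continuous.aestronglyMeasurable _ (ae_of_all _ (hTB n))
  have hT0 : ∀ n z, 0 ≤ T n z := fun n z => by
    have : 0 ≤ Real.arctan ((n + 1 : ℝ)⁻¹ * g z) :=
      Real.arctan_nonneg.2 (mul_nonneg (by positivity) (hg0 z))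
    exact mul_nonneg (by positivity) this
  -- A sublevel set carrying half of the mass bounds ∫exp(-T_n) from below, uniformly in the
  -- truncation level.
  obtain ⟨N, hN⟩ : ∃ N : ℕ, μ.real {z | g z ≤ N} ≥ 1 / 2 := by
    have hmono : Monotone fun N : ℕ => {z : Phase d | g z ≤ N} := fun a b hab z hz =>
      (show g z ≤ a from hz).trans (Nat.cast_le.2 hab)
    have h1 := tendsto_measure_iUnion_atTop (μ := μ) hmono
    have h2 : ⋃ N : ℕ, {z : Phase d | g z ≤ N} = Set.univ := by
      refine Set.eq_univ_of_forall fun z => ?_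
      obtain ⟨N, hN⟩ := exists_nat_ge (g z)
      exact Set.mem_iUnion.2 ⟨N, hN⟩
    rw [h2, measure_univ] at h1
    have h3 := (ENNReal.tendsto_toReal ENNReal.one_ne_top).comp h1
    obtain ⟨N, hN⟩ := (h3.eventually (lt_mem_nhds (by norm_num : (1 / 2 : ℝ) <
      ENNReal.toReal 1))).exists
    exact ⟨N, hN.le⟩
  -- Herbst's bound for -T_n reads exp(-N)/2 ≤ exp(-∫T_n + C/4). This bounds the truncated means
  -- uniformly, without integrability of g being known yet.
  have hbound : ∀ n, ∫ z, T n z ∂μ ≤ N + C / 4 + Real.log 2 := by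
    intro n
    have h1 := hμ.lintegral_exp_le_of_bounded hC (hTd n).neg (K := 1) (hTL n).neg
      (B := (n + 1) * (Real.pi / 2)) fun z => by rw [abs_neg]; exact hTB n z
    have h2 : ENNReal.ofReal (Real.exp (-N)) * μ {z | g z ≤ N} ≤
        ∫⁻ z, ENNReal.ofReal (Real.exp (-T n z)) ∂μ := by
      have hs : MeasurableSet {z | g z ≤ N} := measurableSet_le hg.continuous.measurable
        measurable_const
      rw [← setLIntegral_const]
      refine (setLIntegral_mono' hs fun z hz => ?_).trans (setLIntegral_le_lintegral _ _)
      refine ENNReal.ofReal_le_ofReal (Real.exp_le_exp.2 (neg_le_neg ?_))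
      have := abs_smoothTrunc_le_abs n (g z)
      rw [abs_of_nonneg (hg0 z)] at this
      exact (le_abs_self _).trans (this.trans hz)
    have h3 := h2.trans h1
    rw [← ofReal_measureReal, ← ENNReal.ofReal_mul (Real.exp_pos _).le,
      ENNReal.ofReal_le_ofReal_iff (Real.exp_pos _).le] at h3
    have h4 : Real.exp (-N - Real.log 2) ≤ Real.exp (∫ z, -T n z ∂μ + C * 1 ^ 2 / 4) := by
      refine le_trans ?_ h3
      rw [Real.exp_sub, Real.exp_log (by norm_num), div_eq_mul_one_div]
      exact mul_le_mul_of_nonneg_left hN (Real.exp_pos _).le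
    rw [Real.exp_le_exp, integral_neg] at h4
    linarith
  have hfat : ∫⁻ z, ENNReal.ofReal (g z) ∂μ ≤ ENNReal.ofReal (N + C / 4 + Real.log 2) := by
    calc ∫⁻ z, ENNReal.ofReal (g z) ∂μ
        = ∫⁻ z, Filter.liminf (fun n => ENNReal.ofReal (T n z)) Filter.atTop ∂μ := by
          refine lintegral_congr fun z => ?_
          exact ((ENNReal.continuous_ofReal.tendsto _).comp
            (tendsto_smoothTrunc (g z))).liminf_eq.symm
      _ ≤ Filter.liminf (fun n => ∫⁻ z, ENNReal.ofReal (T n z) ∂μ) Filter.atTop :=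
          lintegral_liminf_le fun n => (hTd n).continuous.measurable.ennreal_ofReal
      _ ≤ _ := by
          refine Filter.liminf_le_of_le (by isBoundedDefault) fun b hb => ?_
          obtain ⟨n, hn⟩ := hb.exists
          refine hn.trans ?_
          rw [← ofReal_integral_eq_lintegral_ofReal (hTi n) (ae_of_all _ (hT0 n))]
          exact ENNReal.ofReal_le_ofReal (hbound n)
  have hgi : Integrable g μ := by
    refine ⟨hg.continuous.aestronglyMeasurable, ?_⟩
    rw [hasFiniteIntegral_iff_ofReal (ae_of_all _ hg0)]
    exact hfat.trans_lt ENNReal.ofReal_lt_top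
  exact hgi.mono' continuous_norm.aestronglyMeasurable
    (ae_of_all _ fun z => by simpa using hgn z)

/-- Concentration of Lipschitz functions under a log-Sobolev inequality. -/
lemma LogSobolev.lintegral_exp_le {d : ℕ} {μ : Measure (Phase d)} [IsProbabilityMeasure μ] {C : ℝ}
    (hC : 0 ≤ C) (hμ : LogSobolev μ C) {f : Phase d → ℝ} {K : ℝ≥0} (hK : LipschitzWith K f) :
    ∫⁻ z, ENNReal.ofReal (Real.exp (f z)) ∂μ ≤
      ENNReal.ofReal (Real.exp (∫ z, f z ∂μ + C * K ^ 2 / 4)) := by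
  have hn := hμ.integrable_norm hC
  have hfi := integrable_of_lipschitz_of_integrable_norm hK hn
  have key : ∀ ε : ℝ, 0 < ε → ∫⁻ x, ENNReal.ofReal (Real.exp (f x)) ∂μ ≤
      ENNReal.ofReal (Real.exp (∫ x, f x ∂μ + C * K ^ 2 / 4 + 2 * ε)) := by
    intro ε hε
    obtain ⟨g, hg, hgK, hgf⟩ := exists_contDiff_lipschitz_approx hK hε
    have hgi := integrable_of_lipschitz_of_integrable_norm hgK hn
    have h6 : ∫ x, g x ∂μ ≤ ∫ x, f x ∂μ + ε := by
      have : ∫ x, g x ∂μ ≤ ∫ x, (f x + ε) ∂μ :=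
        integral_mono hgi (hfi.add (integrable_const ε)) fun x => by
          have := (abs_le.1 (hgf x)).2; simp only; linarith
      rwa [integral_add hfi (integrable_const ε), integral_const, probReal_univ, one_smul] at this
    -- Truncation restores boundedness: the means converge by domination and the exponential
    -- integrals pass to the limit by Fatou's lemma.
    have hlim : Filter.Tendsto (fun n => ∫ z, smoothTrunc n (g z) ∂μ) Filter.atTop
        (nhds (∫ z, g z ∂μ)) :=
      tendsto_integral_of_dominated_convergence (fun z => |g z|)
        (fun n => ((contDiff_smoothTrunc n).comp hg).continuous.aestronglyMeasurable) hgi.abs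
        (fun n => ae_of_all _ fun z => abs_smoothTrunc_le_abs n (g z))
        (ae_of_all _ fun z => tendsto_smoothTrunc (g z))
    have hbd : ∀ n, ∫⁻ z, ENNReal.ofReal (Real.exp (smoothTrunc n (g z))) ∂μ ≤
        ENNReal.ofReal (Real.exp (∫ z, smoothTrunc n (g z) ∂μ + C * K ^ 2 / 4)) := fun n => by
      have hL := (lipschitzWith_smoothTrunc n).comp hgK
      rw [one_mul] at hL
      exact hμ.lintegral_exp_le_of_bounded hC ((contDiff_smoothTrunc n).comp hg) hL
        fun z => abs_smoothTrunc_le n (g z)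
    have hlim2 : Filter.Tendsto (fun n => ENNReal.ofReal
        (Real.exp (∫ z, smoothTrunc n (g z) ∂μ + C * K ^ 2 / 4))) Filter.atTop
        (nhds (ENNReal.ofReal (Real.exp (∫ z, g z ∂μ + C * K ^ 2 / 4)))) :=
      (ENNReal.continuous_ofReal.tendsto _).comp ((Real.continuous_exp.tendsto _).comp
        (hlim.add_const _))
    have hfat : ∫⁻ z, ENNReal.ofReal (Real.exp (g z)) ∂μ ≤
        ENNReal.ofReal (Real.exp (∫ z, g z ∂μ + C * K ^ 2 / 4)) := by
      calc ∫⁻ z, ENNReal.ofReal (Real.exp (g z)) ∂μ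
          = ∫⁻ z, Filter.liminf (fun n => ENNReal.ofReal (Real.exp (smoothTrunc n (g z))))
              Filter.atTop ∂μ := by
            refine lintegral_congr fun z => ?_
            exact ((ENNReal.continuous_ofReal.tendsto _).comp ((Real.continuous_exp.tendsto _).comp
              (tendsto_smoothTrunc (g z)))).liminf_eq.symm
        _ ≤ Filter.liminf (fun n => ∫⁻ z, ENNReal.ofReal (Real.exp (smoothTrunc n (g z))) ∂μ)
              Filter.atTop := lintegral_liminf_le fun n => (Real.continuous_exp.comp
                ((contDiff_smoothTrunc n).comp hg).continuous).measurable.ennreal_ofReal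
        _ ≤ Filter.liminf (fun n => ENNReal.ofReal
            (Real.exp (∫ z, smoothTrunc n (g z) ∂μ + C * K ^ 2 / 4))) Filter.atTop :=
            Filter.liminf_le_liminf (Filter.Eventually.of_forall hbd)
        _ = _ := hlim2.liminf_eq
    calc _ ≤ ∫⁻ x, ENNReal.ofReal (Real.exp ε) * ENNReal.ofReal (Real.exp (g x)) ∂μ := by
          refine lintegral_mono fun x => ?_
          rw [← ENNReal.ofReal_mul (Real.exp_pos _).le, ← Real.exp_add]
          refine ENNReal.ofReal_le_ofReal (Real.exp_le_exp.2 ?_)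
          have := (abs_le.1 (hgf x)).1; linarith
      _ ≤ ENNReal.ofReal (Real.exp ε) *
          ENNReal.ofReal (Real.exp (∫ x, g x ∂μ + C * K ^ 2 / 4)) := by
          have hcg := hgK.continuous
          rw [lintegral_const_mul _ (by fun_prop)]
          gcongr
      _ ≤ _ := by
          rw [← ENNReal.ofReal_mul (Real.exp_pos _).le, ← Real.exp_add]
          refine ENNReal.ofReal_le_ofReal (Real.exp_le_exp.2 ?_)
          linarith
  have hlim : Filter.Tendsto (fun ε : ℝ => ENNReal.ofReal
      (Real.exp (∫ x, f x ∂μ + C * K ^ 2 / 4 + 2 * ε))) (nhdsWithin 0 (Set.Ioi 0))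
      (nhds (ENNReal.ofReal (Real.exp (∫ x, f x ∂μ + C * K ^ 2 / 4 + 2 * 0)))) := by
    refine Filter.Tendsto.mono_left ?_ nhdsWithin_le_nhds
    exact Continuous.tendsto (ENNReal.continuous_ofReal.comp (by fun_prop)) 0
  rw [mul_zero, add_zero] at hlim
  exact ge_of_tendsto hlim (Filter.eventually_of_mem self_mem_nhdsWithin fun ε hε => key ε hε)

end Langevin
end

noncomputable section

namespace Langevin

/-! ### Laws of Markov chains -/

section Law

variable {S : Type*} [MeasurableSpace S]

/-- The law at time `k` of a Markov chain with kernel `κ` and initial law `ν`. -/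
def law (κ : Kernel S S) (ν : Measure S) : ℕ → Measure S
  | 0 => ν
  | k + 1 => (law κ ν k).bind κ

lemma law_zero (κ : Kernel S S) (ν : Measure S) : law κ ν 0 = ν := rfl

lemma law_succ (κ : Kernel S S) (ν : Measure S) (k : ℕ) :
    law κ ν (k + 1) = (law κ ν k).bind κ := rfl

instance isProbabilityMeasure_law (κ : Kernel S S) [IsMarkovKernel κ] (ν : Measure S)
    [IsProbabilityMeasure ν] (k : ℕ) : IsProbabilityMeasure (law κ ν k) := by
  induction k with
  | zero => rw [law_zero]; infer_instance
  | succ k ih => rw [law_succ]; infer_instance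

lemma lintegral_law_succ (κ : Kernel S S) (ν : Measure S) (k : ℕ) {f : S → ℝ≥0∞}
    (hf : Measurable f) :
    ∫⁻ z, f z ∂law κ ν (k + 1) = ∫⁻ z, ∫⁻ w, f w ∂κ z ∂law κ ν k := by
  rw [law_succ, Measure.lintegral_bind κ.measurable.aemeasurable hf.aemeasurable]

/-- The index of F counts the steps still to be made, so time-dependent Lyapunov functions with P
F_k ≤ F_(k+1) carry a moment at time k back to the initial law. -/
lemma lintegral_law_le (κ : Kernel S S) (ν : Measure S) {F : ℕ → S → ℝ≥0∞}
    (hF : ∀ k, Measurable (F k)) (h : ∀ k z, ∫⁻ w, F k w ∂κ z ≤ F (k + 1) z) (j k : ℕ) :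
    ∫⁻ z, F j z ∂law κ ν k ≤ ∫⁻ z, F (j + k) z ∂ν := by
  induction k generalizing j with
  | zero => rfl
  | succ k ih =>
    rw [lintegral_law_succ κ ν k (hF j)]
    refine (lintegral_mono (h j)).trans ((ih (j + 1)).trans (le_of_eq ?_))
    rw [add_right_comm, add_assoc]

end Law

section Kernel

variable {d : ℕ} {U : Pos d → ℝ} {L m γ δ : ℝ}

instance (U : Pos d → ℝ) (γ δ : ℝ) : IsMarkovKernel (obaboKernel U γ δ) :=
  isMarkovKernel_obaboKernel U γ δ

lemma obaboKernel_apply (z : Phase d) : obaboKernel U γ δ z =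
    ((stdGaussian (Pos d)).prod (stdGaussian (Pos d))).map
      (fun q => obaboStep U γ δ z q.1 q.2) := by
  have hm := measurable_obaboStep (U := U) γ δ
  rw [obaboKernel, Kernel.map_apply _ hm, Kernel.prod_apply, Kernel.id_apply, Kernel.const_apply,
    Measure.dirac_prod, Measure.map_map hm measurable_prodMk_left]
  rfl

lemma measurable_obaboStep_right (z : Phase d) :
    Measurable (fun q : Pos d × Pos d => obaboStep U γ δ z q.1 q.2) := by
  have h := (measurable_obaboStep (U := U) γ δ).comp (measurable_prodMk_left (x := z))
  simpa only [Function.comp_def] using h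

lemma lintegral_obaboKernel (z : Phase d) {f : Phase d → ℝ≥0∞} (hf : Measurable f) :
    ∫⁻ w, f w ∂obaboKernel U γ δ z =
      ∫⁻ g, ∫⁻ g', f (obaboStep U γ δ z g g') ∂stdGaussian (Pos d) ∂stdGaussian (Pos d) := by
  have hm := measurable_obaboStep_right (U := U) (γ := γ) (δ := δ) z
  rw [obaboKernel_apply, lintegral_map hf hm]
  have h := hf.comp hm
  simp only [Function.comp_def] at h
  rw [lintegral_prod _ h.aemeasurable]

end Kernel

/-! ### Moments along the unadjusted chain -/

section Moments

variable {d : ℕ} {U : Pos d → ℝ} {L m γ δ c : ℝ}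

/-- Young's inequality with weight h = δγ separates velocity and gradients; the factor 1 + h is
absorbed by η² = e^(-h). The two gradients are controlled by the form before and after the
noise-free step, which does not increase it. -/
lemma norm_snd_obaboStep_sq_le (hU : Potential U L m) (hP : Params L m γ δ) (hc1 : 4 ≤ c * γ ^ 2)
    (hc2 : c * L ≤ 1) {xs : Pos d} (hxs : gradient U xs = 0) (z : Phase d) :
    ‖(obaboStep U γ δ z 0 0).snd‖ ^ 2 ≤ Real.exp (-(δ * γ)) * ‖z.snd‖ ^ 2 +
      4 / 3 * (δ * L ^ 2 / γ) * quad γ c (z - mk xs 0) := by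
  have hδ := hP.δ_pos
  have hγ := hP.γ_pos
  have hh := hP.h_pos
  set h := δ * γ with hhd
  set e := eta γ δ with he
  have he0 : 0 < e := eta_pos γ δ
  have he2 : e ^ 2 = Real.exp (-h) := by
    rw [he, eta, ← Real.exp_nat_mul]; congr 1; push_cast; ring
  have hexp : e ^ 2 * (1 + h) ≤ 1 := by
    rw [he2, Real.exp_neg, inv_mul_le_iff₀ (Real.exp_pos _), mul_one, add_comm]
    exact Real.add_one_le_exp h
  set w := obaboStep U γ δ z 0 0 with hw
  set q := quad γ c (z - mk xs 0) with hq
  have hq0 : 0 ≤ q := quad_nonneg hγ hc1 _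
  have hx : 3 / 4 * ‖z.fst - xs‖ ^ 2 ≤ q := by
    simpa using (quad_bounds hγ hc1 (z - mk xs 0)).2.2.1
  have hr : (1 - rate m γ * δ) ^ 2 ≤ 1 := by
    have h1 := hP.m_pos
    have h2 := hP.m_le
    have h3 := hP.γ_sq
    have h4 := hP.h_le
    have h5 : 0 < rate m γ * δ := by unfold rate; positivity
    have h6 : rate m γ * δ ≤ 1 := by
      rw [rate, div_mul_eq_mul_div, div_le_one (by positivity)]
      have : m * δ * γ ≤ 1 * m := by nlinarith
      by_contra hneg
      push Not at hneg
      have h7 := mul_lt_mul_of_pos_right hneg hγ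
      nlinarith
    exact pow_le_one₀ (by linarith) (by linarith)
  have hx' : 3 / 4 * ‖w.fst - xs‖ ^ 2 ≤ q := by
    have h1 := quad_obaboStep_sub_le hU hP hc1 hc2 z (mk xs 0) 0 0
    rw [obaboStep_fixed hxs] at h1
    have h2 := (quad_bounds hγ hc1 (w - mk xs 0)).2.2.1
    have h3 := mul_le_mul_of_nonneg_right hr hq0
    rw [WithLp.sub_fst, show (mk xs 0).fst = xs from rfl] at h2
    linarith
  set G := gradient U z.fst + gradient U w.fst with hG
  have hG2 : ‖G‖ ^ 2 ≤ 16 / 3 * L ^ 2 * q := by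
    have h1 := norm_gradient_le hU.gradLip hxs z.fst
    have h2 := norm_gradient_le hU.gradLip hxs w.fst
    have h3 : ‖G‖ ≤ L * (‖z.fst - xs‖ + ‖w.fst - xs‖) :=
      (norm_add_le _ _).trans (by linarith)
    have h4 := pow_le_pow_left₀ (norm_nonneg _) h3 2
    have h5 : (‖z.fst - xs‖ + ‖w.fst - xs‖) ^ 2 ≤ 16 / 3 * q := by
      nlinarith [sq_nonneg (‖z.fst - xs‖ - ‖w.fst - xs‖)]
    have h6 := mul_le_mul_of_nonneg_left h5 (sq_nonneg L)
    rw [mul_pow] at h4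
    linarith
  have hsnd : w.snd = e • (e • z.snd - (δ / 2) • G) := by
    rw [hw, obaboStep_snd, ← hw]; simp [hG, he]
  have h1 : ‖e • z.snd - (δ / 2) • G‖ ^ 2 ≤
      e ^ 2 * (1 + h) * ‖z.snd‖ ^ 2 + (δ ^ 2 / 4) * (1 + 1 / h) * ‖G‖ ^ 2 := by
    have h2 : ‖e • z.snd - (δ / 2) • G‖ ≤ e * ‖z.snd‖ + δ / 2 * ‖G‖ := by
      refine (norm_sub_le _ _).trans (le_of_eq ?_)
      rw [norm_smul, norm_smul, Real.norm_of_nonneg he0.le, Real.norm_of_nonneg (by positivity)]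
    refine (pow_le_pow_left₀ (norm_nonneg _) h2 2).trans ?_
    have h3 : 0 ≤ (h * (e * ‖z.snd‖) - δ / 2 * ‖G‖) ^ 2 / h := by positivity
    have h4 : (h * (e * ‖z.snd‖) - δ / 2 * ‖G‖) ^ 2 / h =
      h * (e * ‖z.snd‖) ^ 2 - 2 * (e * ‖z.snd‖) * (δ / 2 * ‖G‖) + (δ / 2 * ‖G‖) ^ 2 * (1 / h) := by
      field_simp
      ring
    nlinarith
  rw [hsnd, norm_smul, mul_pow, Real.norm_of_nonneg he0.le, ← he2]
  have h2 := mul_le_mul_of_nonneg_left h1 (sq_nonneg e)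
  refine h2.trans ?_
  have h3 : e ^ 2 * (e ^ 2 * (1 + h) * ‖z.snd‖ ^ 2) ≤ e ^ 2 * (1 * ‖z.snd‖ ^ 2) := by gcongr
  have h4 : e ^ 2 * (δ ^ 2 / 4 * (1 + 1 / h) * ‖G‖ ^ 2) ≤ 4 / 3 * (δ * L ^ 2 / γ) * q := by
    have h5 : e ^ 2 * (δ ^ 2 / 4 * (1 + 1 / h) * ‖G‖ ^ 2) =
        δ / (4 * γ) * (e ^ 2 * (1 + h)) * ‖G‖ ^ 2 := by
      rw [hhd]; field_simp; ring
    rw [h5]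
    calc _ ≤ δ / (4 * γ) * 1 * (16 / 3 * L ^ 2 * q) := by gcongr
      _ = _ := by field_simp; ring
  linarith

/-- The moment of a perturbation of the velocity by a Gaussian variable. -/
lemma lintegral_quad_add_snd_le (hd : 0 < d) (hγ : 0 < γ) (hc1 : 4 ≤ c * γ ^ 2) {a b β Q : ℝ}
    (ha : 0 ≤ a) (hb : 0 ≤ b) (hβ : 0 < β) (hQ : 0 < Q) (σ : ℝ) (w : Phase d) :
    ∫⁻ g, ENNReal.ofReal ((a + b * quad γ c (w + mk 0 (σ • g)) +
      β * ‖(w + mk 0 (σ • g)).snd‖ ^ 2) ^ Q) ∂stdGaussian (Pos d) ≤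
    ENNReal.ofReal ((a + σ ^ 2 * (d + 2 * Q) * (b * c + β) + b * quad γ c w +
      β * ‖w.snd‖ ^ 2) ^ Q) := by
  have hc := c_pos hc1
  have hk : 0 < b * c + β := by positivity
  -- The coefficient of |x|² left over when the expression is completed to a square in the velocity,
  -- so that the shifted Gaussian moment bound applies.
  have hrest : 0 ≤ b - b ^ 2 / (γ ^ 2 * (b * c + β)) := by
    rw [sub_nonneg, div_le_iff₀ (by positivity)]
    have h1 : b * b * 4 ≤ b * b * (c * γ ^ 2) := by gcongr
    have h2 : 0 ≤ b * γ ^ 2 * β := by positivity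
    nlinarith [mul_nonneg hb hb]
  set u : Pos d := w.snd + (b / (γ * (b * c + β))) • w.fst with hu
  have e1 : ∀ v : Pos d, ‖v + (b / (γ * (b * c + β))) • w.fst‖ ^ 2 * (b * c + β) +
      (b - b ^ 2 / (γ ^ 2 * (b * c + β))) * ‖w.fst‖ ^ 2 =
      b * (‖w.fst‖ ^ 2 + 2 / γ * inner ℝ w.fst v + c * ‖v‖ ^ 2) + β * ‖v‖ ^ 2 := by
    intro v
    rw [norm_add_sq_real, real_inner_smul_right, norm_smul, mul_pow,
      Real.norm_of_nonneg (by positivity), real_inner_comm]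
    field_simp
    ring
  have e2 : ∀ g : Pos d, a + b * quad γ c (w + mk 0 (σ • g)) +
      β * ‖(w + mk 0 (σ • g)).snd‖ ^ 2 =
      (a + (b - b ^ 2 / (γ ^ 2 * (b * c + β))) * ‖w.fst‖ ^ 2) +
        (b * c + β) * ‖u + σ • g‖ ^ 2 := by
    intro g
    have h1 := e1 (w.snd + σ • g)
    have h2 : u + σ • g = w.snd + σ • g + (b / (γ * (b * c + β))) • w.fst := by
      rw [hu]; abel
    rw [h2, quad]
    rw [WithLp.add_fst, WithLp.add_snd, show (mk (0 : Pos d) (σ • g)).fst = 0 from rfl,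
      show (mk (0 : Pos d) (σ • g)).snd = σ • g from rfl, add_zero]
    linarith
  simp only [e2]
  refine (lintegral_rpow_add_norm_sq_le hd σ u (by positivity) hk.le hQ).trans (le_of_eq ?_)
  have h3 := e1 w.snd
  rw [← hu] at h3
  rw [quad]
  congr 2
  linarith

/-- One step of the drift condition for the functions
`(a + b quad(z - z⋆) + β |v|²)^Q`. -/
lemma lintegral_obaboKernel_le (hd : 0 < d) (hU : Potential U L m) (hP : Params L m γ δ)
    (hc1 : 4 ≤ c * γ ^ 2) (hc2 : c * L ≤ 1) {xs : Pos d} (hxs : gradient U xs = 0)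
    {a b β a' b' β' Q : ℝ} (ha : 0 ≤ a) (hb : 0 ≤ b) (hβ : 0 < β) (hQ : 0 < Q)
    (hβ' : Real.exp (-(δ * γ)) * β ≤ β')
    (hb' : (1 - rate m γ * δ) ^ 2 * b + 4 / 3 * (δ * L ^ 2 / γ) * β ≤ b')
    (ha' : a + (1 - Real.exp (-(δ * γ))) * (d + 2 * Q) * (b * c + β) +
      (1 - Real.exp (-(δ * γ))) / Real.exp (-(δ * γ)) * (d + 2 * Q) * (b' * c + β') ≤ a')
    (z : Phase d) :
    ∫⁻ w, ENNReal.ofReal ((a + b * quad γ c (w - mk xs 0) + β * ‖w.snd‖ ^ 2) ^ Q)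
        ∂obaboKernel U γ δ z ≤
      ENNReal.ofReal ((a' + b' * quad γ c (z - mk xs 0) + β' * ‖z.snd‖ ^ 2) ^ Q) := by
  have hγ := hP.γ_pos
  have hL := hP.L_pos
  have hδ := hP.δ_pos
  have hc := c_pos hc1
  have hη := eta_pos γ δ
  have hη2 : eta γ δ ^ 2 = Real.exp (-(δ * γ)) := by
    rw [eta, ← Real.exp_nat_mul]; congr 1; push_cast; ring
  have hη1 : 0 ≤ 1 - eta γ δ ^ 2 := by
    have := pow_le_one₀ (n := 2) hη.le hP.eta_le_one; linarith
  have hη1' : 0 ≤ 1 - Real.exp (-(δ * γ)) := by rw [← hη2]; exact hη1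
  set σ := √(1 - eta γ δ ^ 2) with hσ
  have hσ2 : σ ^ 2 = 1 - Real.exp (-(δ * γ)) := by rw [hσ, Real.sq_sqrt hη1, hη2]
  have hb'0 : 0 ≤ b' := le_trans (by positivity) hb'
  have hβ'0 : 0 < β' := lt_of_lt_of_le (by positivity) hβ'
  have hcq := continuous_quad (d := d) γ c
  have hmeas : Measurable fun w : Phase d => ENNReal.ofReal ((a + b * quad γ c (w - mk xs 0) +
      β * ‖w.snd‖ ^ 2) ^ Q) := by
    have h1 : Continuous fun w : Phase d => a + b * quad γ c (w - mk xs 0) + β * ‖w.snd‖ ^ 2 := by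
      have := hcq.comp (continuous_id.sub continuous_const : Continuous fun w : Phase d => w - mk xs 0)
      simp only [Function.comp_def] at this
      fun_prop
    exact (h1.measurable.pow_const Q).ennreal_ofReal
  rw [lintegral_obaboKernel z hmeas]
  -- The constant after g' has been integrated out. The other Gaussian vector, moved into the
  -- starting point with scale σ/η, is integrated afterwards against the new coefficients b' and β'.
  set a₁ := a + (1 - Real.exp (-(δ * γ))) * (d + 2 * Q) * (b * c + β) with ha₁
  have ha₁0 : 0 ≤ a₁ := by positivity
  calc _ ≤ ∫⁻ g, ENNReal.ofReal ((a₁ + b' * quad γ c ((z - mk xs 0) + mk 0 ((σ / eta γ δ) • g)) +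
          β' * ‖((z - mk xs 0) + mk 0 ((σ / eta γ δ) • g)).snd‖ ^ 2) ^ Q) ∂stdGaussian (Pos d) := by
        refine lintegral_mono fun g => ?_
        set z' := z + mk 0 ((σ / eta γ δ) • g) with hz'
        set T := obaboStep U γ δ z' 0 0 with hT
        have h1 : ∀ g', obaboStep U γ δ z g g' = T + mk 0 (σ • g') := fun g' => obaboStep_eq z g g'
        have h2 : ∀ g' : Pos d, T + mk 0 (σ • g') - mk xs 0 = (T - mk xs 0) + mk 0 (σ • g') :=
          fun g' => by abel
        have h3 : ∀ g' : Pos d, (T + mk 0 (σ • g')).snd = ((T - mk xs 0) + mk 0 (σ • g')).snd :=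
          fun g' => by simp
        simp only [h1]
        simp only [h2, h3]
        refine (lintegral_quad_add_snd_le hd hγ hc1 ha hb hβ hQ σ (T - mk xs 0)).trans ?_
        refine ENNReal.ofReal_le_ofReal ?_
        have h4 : (z - mk xs 0) + mk 0 ((σ / eta γ δ) • g) = z' - mk xs 0 := by rw [hz']; abel
        rw [h4, hσ2]
        have h5 := quad_obaboStep_sub_le hU hP hc1 hc2 z' (mk xs 0) 0 0
        rw [obaboStep_fixed hxs, ← hT] at h5
        have h6 := norm_snd_obaboStep_sq_le hU hP hc1 hc2 hxs z'
        rw [← hT] at h6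
        have h7 : (T - mk xs 0).snd = T.snd := by simp
        have h8 : (z' - mk xs 0).snd = z'.snd := by simp
        rw [h7, h8]
        have hq0 := quad_nonneg hγ hc1 (z' - mk xs 0)
        have hq1 := quad_nonneg hγ hc1 (T - mk xs 0)
        refine Real.rpow_le_rpow (by positivity) ?_ hQ.le
        have i1 := mul_le_mul_of_nonneg_left h5 hb
        have i2 := mul_le_mul_of_nonneg_left h6 hβ.le
        have i3 := mul_le_mul_of_nonneg_right hβ' (sq_nonneg ‖z'.snd‖)
        have i4 := mul_le_mul_of_nonneg_right hb' hq0
        linarith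
    _ ≤ _ := by
        refine (lintegral_quad_add_snd_le hd hγ hc1 ha₁0 hb'0 hβ'0 hQ (σ / eta γ δ) _).trans ?_
        refine ENNReal.ofReal_le_ofReal ?_
        have hq0 := quad_nonneg hγ hc1 (z - mk xs 0)
        refine Real.rpow_le_rpow (by positivity) ?_ hQ.le
        have h7 : (z - mk xs 0).snd = z.snd := by simp
        rw [h7, div_pow, hσ2, hη2]
        linarith

end Moments

end Langevin
end

/-! ### Time-dependent Lyapunov functions and moments of the unadjusted chain. -/

noncomputable section

namespace Langevin

section Params

variable {L m γ δ : ℝ}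

lemma Params.rate_pos (hP : Params L m γ δ) : 0 < rate m γ * δ := by
  have := hP.m_pos; have := hP.γ_pos; have := hP.δ_pos
  unfold rate; positivity

lemma Params.rate_le (hP : Params L m γ δ) : rate m γ * δ ≤ δ * γ / 12 := by
  have h1 := hP.γ_pos
  have h2 : m ≤ γ ^ 2 / 4 := by have := hP.γ_sq; have := hP.m_le; linarith
  rw [rate, div_mul_eq_mul_div, div_le_iff₀ (by positivity)]
  nlinarith [mul_le_mul_of_nonneg_left h2 hP.δ_pos.le]

lemma Params.rate_le_one (hP : Params L m γ δ) : rate m γ * δ ≤ 1 := by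
  have := hP.rate_le; have := hP.h_le; linarith

lemma Params.exp_bounds (hP : Params L m γ δ) :
    1 - δ * γ ≤ Real.exp (-(δ * γ)) ∧ Real.exp (-(δ * γ)) ≤ 1 - δ * γ + (δ * γ) ^ 2 / 2 := by
  have h0 := hP.h_pos
  have h1 := hP.h_le
  have := exp_half_bounds (h := 2 * (δ * γ)) (by linarith) (by linarith)
  rw [show 2 * (δ * γ) / 2 = δ * γ by ring] at this
  refine ⟨this.1, this.2.trans (by nlinarith)⟩

/-- The coefficient of the quadratic form in the Lyapunov functions. -/
def lyapB (L : ℝ) : ℝ := 4 / 3 + 5 / 12 * L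

/-- The additive constant in the Lyapunov functions. -/
def lyapP (L m : ℝ) : ℝ := 121 / 10 * lyapB L / m

/-- A bound for the stationary second moment, per degree of freedom. -/
def lyapS (L m : ℝ) : ℝ := lyapP L m + 201 / 100

/-- The prefactor in the exponential decay of the moments. -/
def lyapM (L : ℝ) : ℝ := 1 + lyapB L * (1 + 1 / L)

/-- The Lyapunov function for the moment of order `2Q` after `k` steps. -/
def lyap {d : ℕ} (L m γ δ Q : ℝ) (xs : Pos d) (k : ℕ) (z : Phase d) : ℝ :=
  ((d + 2 * Q) * (lyapS L m - lyapP L m * (1 - rate m γ * δ) ^ (2 * k) -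
    2 * Real.exp (-(δ * γ)) ^ k) +
    (lyapB L * (1 - rate m γ * δ) ^ (2 * k) - 5 / 12 * L * Real.exp (-(δ * γ)) ^ k) *
      quad γ (4 / γ ^ 2) (z - mk xs 0) + Real.exp (-(δ * γ)) ^ k * ‖z.snd‖ ^ 2) ^ Q

variable {d : ℕ} {U : Pos d → ℝ} {xs : Pos d}

lemma continuous_lyap_base (a b β : ℝ) : Continuous fun z : Phase d =>
    a + b * quad γ (4 / γ ^ 2) (z - mk xs 0) + β * ‖z.snd‖ ^ 2 := by
  have := (continuous_quad (d := d) γ (4 / γ ^ 2)).comp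
    (continuous_id.sub continuous_const : Continuous fun w : Phase d => w - mk xs 0)
  simp only [Function.comp_def] at this
  fun_prop

lemma measurable_lyap (Q : ℝ) (k : ℕ) : Measurable (lyap L m γ δ Q xs k) :=
  (continuous_lyap_base _ _ _).measurable.pow_const Q

lemma lyapB_pos (hP : Params L m γ δ) : 0 < lyapB L := by
  have := hP.L_pos; unfold lyapB; positivity

lemma lyapP_pos (hP : Params L m γ δ) : 0 < lyapP L m := by
  have := lyapB_pos hP; have := hP.m_pos; unfold lyapP; positivity

/-- The velocity term decays strictly faster than the quadratic form. The gap, of order δγ, pays for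
the transfer of the gradient force from velocity to form. -/
lemma Params.exp_le_sq (hP : Params L m γ δ) :
    4 / 5 * (δ * γ) ≤ (1 - rate m γ * δ) ^ 2 - Real.exp (-(δ * γ)) := by
  have h1 := hP.exp_bounds.2
  have h2 := hP.rate_le
  have h3 := hP.h_le
  have h4 := hP.h_pos
  nlinarith [sq_nonneg (rate m γ * δ)]

-- The three coefficients solve the recursions of `lintegral_obaboKernel_le`: β decays like e^(-δγ),
-- the coefficient of the form compensates the gradient contribution, and the constant collects the
-- Gaussian input of both refreshments.
set_option maxHeartbeats 600000 in
lemma lyap_step (hd : 0 < d) (hU : Potential U L m) (hP : Params L m γ δ)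
    (hxs : gradient U xs = 0) {Q : ℝ} (hQ : 0 < Q) (k : ℕ) (z : Phase d) :
    ∫⁻ w, ENNReal.ofReal (lyap L m γ δ Q xs k w) ∂obaboKernel U γ δ z ≤
      ENNReal.ofReal (lyap L m γ δ Q xs (k + 1) z) := by
  have hγ := hP.γ_pos
  have hδ := hP.δ_pos
  have hL := hP.L_pos
  have hm := hP.m_pos
  have hB := lyapB_pos hP
  have hPp := lyapP_pos hP
  have hκ0 := hP.rate_pos
  have hκ1 := hP.rate_le
  have hh := hP.h_le
  have hh0 := hP.h_pos
  have hgap := hP.exp_le_sq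
  obtain ⟨hρ1, hρ2⟩ := hP.exp_bounds
  have hκρ : rate m γ * δ ≤ 1 := hP.rate_le_one
  set ρ := Real.exp (-(δ * γ)) with hρ
  have hρ0 : 0 < ρ := Real.exp_pos _
  set r := 1 - rate m γ * δ with hr
  have hr0 : 0 ≤ r := by rw [hr]; linarith
  have hρr : ρ ≤ r ^ 2 := by linarith
  have hρrk : ρ ^ k ≤ r ^ (2 * k) := by
    rw [pow_mul]; exact pow_le_pow_left₀ hρ0.le hρr k
  have hr1 : r ≤ 1 := by rw [hr]; linarith
  have hr2k : r ^ (2 * k) ≤ 1 := pow_le_one₀ hr0 hr1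
  have hρ1' : ρ ≤ 1 := by nlinarith
  have hρk : ρ ^ k ≤ 1 := pow_le_one₀ hρ0.le hρ1'
  have hρk0 : 0 < ρ ^ k := pow_pos hρ0 k
  have hrk0 : 0 ≤ r ^ (2 * k) := pow_nonneg hr0 _
  have hc : 4 / γ ^ 2 * γ ^ 2 = 4 := by field_simp
  have hc2 : 4 / γ ^ 2 * L ≤ 1 := by
    rw [div_mul_eq_mul_div, div_le_one (by positivity)]; exact hP.γ_sq
  have hFB : 5 / 12 * L ≤ lyapB L := by unfold lyapB; linarith
  have hsucc : r ^ (2 * (k + 1)) = r ^ (2 * k) * r ^ 2 := by ring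
  unfold lyap
  refine lintegral_obaboKernel_le hd hU hP hc.ge hc2 hxs ?_ ?_ hρk0 hQ ?_ ?_ ?_ z
  · have : 0 ≤ lyapS L m - lyapP L m * r ^ (2 * k) - 2 * ρ ^ k := by
      unfold lyapS; nlinarith
    positivity
  · rw [sub_nonneg]
    exact mul_le_mul hFB hρrk hρk0.le hB.le
  · exact le_of_eq (pow_succ' ρ k).symm
  -- The constant 5/12 is fixed here: 5/12 · 4/5 · Lδγ = Lδγ/3, which is at least (4/3)δL²/γ
  -- precisely because γ² ≥ 4L.
  · have h1 : 4 / 3 * (δ * L ^ 2 / γ) ≤ 5 / 12 * L * (r ^ 2 - ρ) := by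
      refine le_trans ?_ (mul_le_mul_of_nonneg_left hgap (by positivity))
      rw [mul_div_assoc', div_le_iff₀ hγ]
      have := mul_le_mul_of_nonneg_left hP.γ_sq (by positivity : 0 ≤ δ * L)
      nlinarith
    have h2 := mul_le_mul_of_nonneg_right h1 hρk0.le
    rw [hsucc, pow_succ ρ k]
    nlinarith
  · have hD : (0 : ℝ) ≤ d + 2 * Q := by positivity
    have hFk : 0 ≤ 5 / 12 * L * ρ ^ k := by positivity
    have hFk1 : 0 ≤ 5 / 12 * L * ρ ^ (k + 1) := by positivity
    set c := 4 / γ ^ 2 with hcd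
    have hc0 : 0 < c := by positivity
    have hinv : (1 - ρ) / ρ ≤ δ * γ * (1 + 2 * (δ * γ)) := by
      rw [div_le_iff₀ hρ0]
      have : 0 ≤ δ * γ * (1 + 2 * (δ * γ)) := by positivity
      nlinarith [mul_le_mul_of_nonneg_left hρ1 this]
    have hinv0 : 0 ≤ (1 - ρ) / ρ := div_nonneg (by linarith) hρ0.le
    have hr21 : r ^ 2 ≤ 1 := pow_le_one₀ hr0 hr1
    -- Noise entering through the form: to leading order 8Bδ/γ per step, against P·2κδ = P·2mδ/(3γ).
    -- Equality would be P = 12B/m; the value 12.1 covers the second-order terms.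
    have h1 : (1 - ρ) * (lyapB L * c) + (1 - ρ) / ρ * (lyapB L * r ^ 2 * c) ≤
        lyapP L m * (1 - r ^ 2) := by
      have i1 : (1 - ρ) * (lyapB L * c) + (1 - ρ) / ρ * (lyapB L * r ^ 2 * c) ≤
          δ * γ * (2 + 2 * (δ * γ)) * (lyapB L * c) := by
        have j1 : (1 - ρ) * (lyapB L * c) ≤ δ * γ * (lyapB L * c) :=
          mul_le_mul_of_nonneg_right (by linarith) (by positivity)
        have j2 : (1 - ρ) / ρ * (lyapB L * r ^ 2 * c) ≤
            δ * γ * (1 + 2 * (δ * γ)) * (lyapB L * 1 * c) :=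
          mul_le_mul hinv (by gcongr) (by positivity) (by positivity)
        linarith
      refine i1.trans ?_
      have i2 : 1 - r ^ 2 = rate m γ * δ * (2 - rate m γ * δ) := by rw [hr]; ring
      have i3 : lyapP L m * (rate m γ * δ) = 121 / 30 * (lyapB L * δ / γ) := by
        rw [lyapP, rate]; field_simp; ring
      have i4 : δ * γ * (lyapB L * c) = 4 * (lyapB L * δ / γ) := by
        rw [hcd]; field_simp
      have i5 : 0 ≤ lyapB L * δ / γ := by positivity
      rw [i2, ← mul_assoc (lyapP L m), i3]
      have i6 : δ * γ * (2 + 2 * (δ * γ)) * (lyapB L * c) =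
        4 * (lyapB L * δ / γ) * (2 + 2 * (δ * γ)) := by rw [← i4]; ring
      rw [i6]
      have i7 : 4 * (2 + 2 * (δ * γ)) ≤ 121 / 30 * (2 - rate m γ * δ) := by linarith
      have i8 := mul_le_mul_of_nonneg_right i7 i5
      linarith
    have h2 := mul_le_mul_of_nonneg_right h1 hrk0
    -- Both refreshments feed the same amount into the |v|² part, whence the coefficient 2 in
    -- `lyap`.
    have h3 : (1 - ρ) / ρ * ρ ^ (k + 1) = (1 - ρ) * ρ ^ k := by
      rw [pow_succ]; field_simp
    have h4 : 0 ≤ (1 - ρ) * (5 / 12 * L * ρ ^ k * c) := mul_nonneg (by linarith) (by positivity)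
    have h5 : 0 ≤ (1 - ρ) / ρ * (5 / 12 * L * ρ ^ (k + 1) * c) := by positivity
    have h6 : (1 - ρ) * ((lyapB L * r ^ (2 * k) - 5 / 12 * L * ρ ^ k) * c + ρ ^ k) +
        (1 - ρ) / ρ * ((lyapB L * r ^ (2 * (k + 1)) - 5 / 12 * L * ρ ^ (k + 1)) * c +
          ρ ^ (k + 1)) ≤ lyapP L m * r ^ (2 * k) * (1 - r ^ 2) + 2 * ρ ^ k * (1 - ρ) := by
      rw [hsucc]
      linarith
    have h7 := mul_le_mul_of_nonneg_left h6 hD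
    rw [hsucc, pow_succ ρ k] at *
    linarith

lemma lyap_le (hP : Params L m γ δ) {Q : ℝ} (hQ : 0 < Q) (k : ℕ) (z : Phase d) :
    lyap L m γ δ Q xs k z ≤ ((d + 2 * Q) * lyapS L m +
      (1 - rate m γ * δ) ^ (2 * k) * (lyapM L * ‖z - mk xs 0‖ ^ 2)) ^ Q := by
  have hγ := hP.γ_pos
  have hL := hP.L_pos
  have hB := lyapB_pos hP
  have hPp := lyapP_pos hP
  have hgap := hP.exp_le_sq
  have hh0 := hP.h_pos
  have hκρ : rate m γ * δ ≤ 1 := hP.rate_le_one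
  have hκ0 := hP.rate_pos
  unfold lyap
  set ρ := Real.exp (-(δ * γ)) with hρ
  have hρ0 : 0 < ρ := Real.exp_pos _
  set r := 1 - rate m γ * δ with hr
  have hr0 : 0 ≤ r := by rw [hr]; linarith
  have hr1 : r ≤ 1 := by rw [hr]; linarith
  have hρr : ρ ≤ r ^ 2 := by linarith
  have hρrk : ρ ^ k ≤ r ^ (2 * k) := by
    rw [pow_mul]; exact pow_le_pow_left₀ hρ0.le hρr k
  have hr2k : r ^ (2 * k) ≤ 1 := pow_le_one₀ hr0 hr1
  have hρk : ρ ^ k ≤ 1 := hρrk.trans hr2k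
  have hρk0 : 0 < ρ ^ k := pow_pos hρ0 k
  have hrk0 : 0 ≤ r ^ (2 * k) := pow_nonneg hr0 _
  have hc : 4 / γ ^ 2 * γ ^ 2 = 4 := by field_simp
  have hq0 := quad_nonneg hγ hc.ge (z - mk xs 0)
  have hq1 := (quad_bounds hγ hc.ge (z - mk xs 0)).2.2.2
  have hFB : 5 / 12 * L ≤ lyapB L := by unfold lyapB; linarith
  have hcL : 4 / γ ^ 2 ≤ 1 / L := by
    rw [div_le_div_iff₀ (by positivity) hL]; have := hP.γ_sq; linarith
  refine Real.rpow_le_rpow ?_ ?_ hQ.le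
  · have h1 : 0 ≤ lyapS L m - lyapP L m * r ^ (2 * k) - 2 * ρ ^ k := by
      unfold lyapS; nlinarith
    have h2 : 0 ≤ lyapB L * r ^ (2 * k) - 5 / 12 * L * ρ ^ k := by
      rw [sub_nonneg]; exact mul_le_mul hFB hρrk hρk0.le hB.le
    positivity
  · have h1 : (d + 2 * Q) * (lyapS L m - lyapP L m * r ^ (2 * k) - 2 * ρ ^ k) ≤
        (d + 2 * Q) * lyapS L m := by
      refine mul_le_mul_of_nonneg_left ?_ (by positivity)
      have := mul_nonneg hPp.le hrk0
      linarith
    have hs : ‖z.snd‖ ^ 2 ≤ ‖z - mk xs 0‖ ^ 2 := by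
      rw [norm_sub_mk_sq]; nlinarith [sq_nonneg ‖z.fst - xs‖]
    have h2 : ρ ^ k * ‖z.snd‖ ^ 2 ≤ r ^ (2 * k) * ‖z - mk xs 0‖ ^ 2 :=
      mul_le_mul hρrk hs (by positivity) hrk0
    have h3 : quad γ (4 / γ ^ 2) (z - mk xs 0) ≤ (1 + 1 / L) * ‖z - mk xs 0‖ ^ 2 :=
      hq1.trans (by gcongr)
    have h4 : (lyapB L * r ^ (2 * k) - 5 / 12 * L * ρ ^ k) * quad γ (4 / γ ^ 2) (z - mk xs 0) ≤
        lyapB L * r ^ (2 * k) * ((1 + 1 / L) * ‖z - mk xs 0‖ ^ 2) := by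
      refine le_trans (mul_le_mul_of_nonneg_right (sub_le_self _ (by positivity)) hq0) ?_
      exact mul_le_mul_of_nonneg_left h3 (by positivity)
    unfold lyapM
    linarith

/-- The initial coefficients are tuned for use: 4/3 of the form dominates |x - x⋆|², the velocity
has weight 1, and the surplus 1/100 per degree of freedom covers the partial refreshment preceding
the Verlet step. -/
lemma le_lyap_zero {Q : ℝ} (z : Phase d) :
    (((d + 2 * Q) * (1 / 100)) + 4 / 3 * quad γ (4 / γ ^ 2) (z - mk xs 0) + ‖z.snd‖ ^ 2) ^ Q ≤
      lyap L m γ δ Q xs 0 z := by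
  unfold lyap lyapS lyapB
  refine le_of_eq ?_
  simp only [mul_zero, pow_zero]
  congr 1
  ring

/-- Moments along the unadjusted chain. -/
lemma lintegral_law_lyap_le (hd : 0 < d) (hU : Potential U L m) (hP : Params L m γ δ)
    (hxs : gradient U xs = 0) {Q : ℝ} (hQ : 0 < Q) (ν : Measure (Phase d)) (k : ℕ) :
    ∫⁻ z, ENNReal.ofReal ((((d + 2 * Q) * (1 / 100)) + 4 / 3 * quad γ (4 / γ ^ 2) (z - mk xs 0) +
        ‖z.snd‖ ^ 2) ^ Q) ∂law (obaboKernel U γ δ) ν k ≤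
      ∫⁻ z, ENNReal.ofReal (((d + 2 * Q) * lyapS L m +
        (1 - rate m γ * δ) ^ (2 * k) * (lyapM L * ‖z - mk xs 0‖ ^ 2)) ^ Q) ∂ν := by
  have h := lintegral_law_le (obaboKernel U γ δ) ν
    (F := fun k z => ENNReal.ofReal (lyap L m γ δ Q xs k z))
    (fun k => (measurable_lyap Q k).ennreal_ofReal) (lyap_step hd hU hP hxs hQ) 0 k
  rw [zero_add] at h
  refine le_trans (lintegral_mono fun z => ENNReal.ofReal_le_ofReal (le_lyap_zero z))
    (h.trans (lintegral_mono fun z => ENNReal.ofReal_le_ofReal (lyap_le hP hQ k z)))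

lemma lintegral_law_norm_le (hd : 0 < d) (hU : Potential U L m) (hP : Params L m γ δ)
    (hxs : gradient U xs = 0) {Q : ℝ} (hQ : 0 < Q) (ν : Measure (Phase d)) (k : ℕ) :
    ∫⁻ z, ENNReal.ofReal ((‖z - mk xs 0‖ ^ 2) ^ Q) ∂law (obaboKernel U γ δ) ν k ≤
      ∫⁻ z, ENNReal.ofReal (((d + 2 * Q) * lyapS L m +
        (1 - rate m γ * δ) ^ (2 * k) * (lyapM L * ‖z - mk xs 0‖ ^ 2)) ^ Q) ∂ν := by
  refine le_trans (lintegral_mono fun z => ENNReal.ofReal_le_ofReal ?_)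
    (lintegral_law_lyap_le hd hU hP hxs hQ ν k)
  refine Real.rpow_le_rpow (by positivity) ?_ hQ.le
  have hγ := hP.γ_pos
  have hc : 4 / γ ^ 2 * γ ^ 2 = 4 := by field_simp
  have h1 := (quad_bounds hγ hc.ge (z - mk xs 0)).2.2.1
  rw [WithLp.sub_fst, show (mk xs 0).fst = xs from rfl] at h1
  rw [norm_sub_mk_sq]
  have : (0 : ℝ) ≤ (d + 2 * Q) * (1 / 100) := by positivity
  linarith

end Params

end Langevin
end

/-! ### The transition operator and the invariant probability measure. -/

noncomputable section

namespace Langevin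

open scoped NNReal Topology

lemma integral_bind_of_integrable {S : Type*} [MeasurableSpace S] (κ : Kernel S S)
    [IsSFiniteKernel κ] (ν : Measure S) [SFinite ν] {f : S → ℝ} (hf : Integrable f (ν.bind κ)) :
    ∫ z, f z ∂ν.bind κ = ∫ z, ∫ w, f w ∂κ z ∂ν := by
  rw [Measure.comp_eq_comp_const_apply] at hf ⊢
  rw [Kernel.integral_comp hf, Kernel.const_apply]

/-- Bounded Lipschitz functions separate probability measures. -/
lemma ext_of_forall_integral_eq_of_lipschitz {S : Type*} [PseudoMetricSpace S] [MeasurableSpace S]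
    [BorelSpace S] {μ ν : Measure S} [IsProbabilityMeasure μ] [IsProbabilityMeasure ν]
    (h : ∀ f : S → ℝ, (∃ K, LipschitzWith K f) → (∀ z, 0 ≤ f z) → (∀ z, f z ≤ 1) →
      ∫ z, f z ∂μ = ∫ z, f z ∂ν) : μ = ν := by
  refine ext_of_generate_finite _ (by rw [BorelSpace.measurable_eq (α := S),
    borel_eq_generateFrom_isClosed]) isPiSystem_isClosed (fun F hF => ?_) (by simp)
  have hpos : ∀ n : ℕ, (0 : ℝ) < 1 / (n + 1) := fun n => by positivity
  have h1 := tendsto_integral_thickenedIndicator_of_isClosed μ hF hpos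
    tendsto_one_div_add_atTop_nhds_zero_nat
  have h2 := tendsto_integral_thickenedIndicator_of_isClosed ν hF hpos
    tendsto_one_div_add_atTop_nhds_zero_nat
  have h3 : ∀ n : ℕ, ∫ z, (thickenedIndicator (hpos n) F z : ℝ) ∂μ =
      ∫ z, (thickenedIndicator (hpos n) F z : ℝ) ∂ν := fun n => by
    refine h _ ⟨_, (lipschitzWith_thickenedIndicator (hpos n) F)⟩ (fun z => NNReal.coe_nonneg _)
      fun z => ?_
    exact_mod_cast thickenedIndicator_le_one (hpos n) F z
  simp only [h3] at h1
  have h4 := tendsto_nhds_unique h1 h2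
  exact (measureReal_eq_measureReal_iff).1 h4

/-- Lipschitz functions for the norm associated with the quadratic form `quad γ c`. -/
def QuadLip {d : ℕ} (γ c Λ : ℝ) (f : Phase d → ℝ) : Prop :=
  ∀ z w, |f z - f w| ≤ Λ * √(quad γ c (z - w))

/-- The transition operator of the unadjusted chain. -/
def transition {d : ℕ} (U : Pos d → ℝ) (γ δ : ℝ) (f : Phase d → ℝ) (z : Phase d) : ℝ :=
  ∫ w, f w ∂obaboKernel U γ δ z

section Transition

variable {d : ℕ} {U : Pos d → ℝ} {L m γ δ c Λ : ℝ} {xs : Pos d} {f : Phase d → ℝ}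

lemma QuadLip.lipschitzWith (hγ : 0 < γ) (hc1 : 4 ≤ c * γ ^ 2) (hΛ : 0 ≤ Λ)
    (hf : QuadLip γ c Λ f) : LipschitzWith (Real.toNNReal (Λ * √(1 + c))) f := by
  have hc := c_pos hc1
  refine LipschitzWith.of_dist_le_mul fun z w => ?_
  rw [Real.dist_eq, Real.coe_toNNReal _ (by positivity), mul_assoc, dist_eq_norm]
  refine (hf z w).trans (mul_le_mul_of_nonneg_left ?_ hΛ)
  rw [← Real.sqrt_sq (norm_nonneg (z - w)), ← Real.sqrt_mul (by positivity)]
  exact Real.sqrt_le_sqrt (quad_bounds hγ hc1 _).2.2.2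

lemma norm_sq_le_quad (hγ : 0 < γ) (hc1 : 4 ≤ c * γ ^ 2) (z : Phase d) :
    ‖z‖ ^ 2 ≤ 2 * max 1 (1 / c) * quad γ c z := by
  have hc := c_pos hc1
  have h1 := (quad_bounds hγ hc1 z).1
  have h2 : 1 ≤ max 1 (1 / c) := le_max_left _ _
  have h3 : 1 ≤ max 1 (1 / c) * c := by
    have := mul_le_mul_of_nonneg_right (le_max_right 1 (1 / c)) hc.le
    have h4 : 1 / c * c = 1 := by field_simp
    linarith
  rw [norm_sq_phase]
  have h4 := mul_le_mul_of_nonneg_left h1 (by positivity : 0 ≤ 2 * max 1 (1 / c))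
  have h5 := mul_le_mul_of_nonneg_right h2 (sq_nonneg ‖z.fst‖)
  have h6 := mul_le_mul_of_nonneg_right h3 (sq_nonneg ‖z.snd‖)
  linarith

lemma quadLip_of_lipschitzWith (hγ : 0 < γ) (hc1 : 4 ≤ c * γ ^ 2) {K : ℝ≥0}
    (hf : LipschitzWith K f) : QuadLip γ c (K * √(2 * max 1 (1 / c))) f := by
  intro z w
  have h := hf.dist_le_mul z w
  rw [Real.dist_eq, dist_eq_norm] at h
  refine h.trans ?_
  rw [mul_assoc, ← Real.sqrt_mul (by positivity)]
  refine mul_le_mul_of_nonneg_left ?_ K.coe_nonneg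
  exact Real.le_sqrt_of_sq_le (norm_sq_le_quad hγ hc1 _)

lemma lintegral_law_dirac_norm_lt_top (hd : 0 < d) (hU : Potential U L m) (hP : Params L m γ δ)
    (hxs : gradient U xs = 0) (z : Phase d) (k : ℕ) :
    Integrable (fun w => ‖w‖) (law (obaboKernel U γ δ) (Measure.dirac z) k) := by
  have h := lintegral_law_norm_le hd hU hP hxs (Q := 1) one_pos (Measure.dirac z) k
  rw [lintegral_dirac] at h
  simp only [Real.rpow_one] at h
  have h2 : Integrable (fun w : Phase d => ‖w - mk xs 0‖ ^ 2)
      (law (obaboKernel U γ δ) (Measure.dirac z) k) := by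
    refine ⟨(by fun_prop : Continuous fun w : Phase d => ‖w - mk xs 0‖ ^ 2).aestronglyMeasurable, ?_⟩
    rw [hasFiniteIntegral_iff_ofReal (ae_of_all _ fun w => by positivity)]
    exact h.trans_lt ENNReal.ofReal_lt_top
  refine (h2.add (integrable_const (1 + ‖mk xs (0 : Pos d)‖))).mono'
    continuous_norm.aestronglyMeasurable (ae_of_all _ fun w => ?_)
  simp only [norm_norm, Pi.add_apply]
  have h3 : ‖w‖ ≤ ‖w - mk xs 0‖ + ‖mk xs (0 : Pos d)‖ := by
    have := norm_add_le (w - mk xs 0) (mk xs 0); rwa [sub_add_cancel] at this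
  nlinarith [sq_nonneg (‖w - mk xs 0‖ - 1), sq_nonneg ‖w - mk xs 0‖]

lemma law_dirac_one (κ : Kernel (Phase d) (Phase d)) (z : Phase d) :
    law κ (Measure.dirac z) 1 = κ z := by
  rw [law_succ, law_zero, Measure.dirac_bind κ.measurable]

lemma integrable_norm_obaboKernel (hd : 0 < d) (hU : Potential U L m) (hP : Params L m γ δ)
    (z : Phase d) : Integrable (fun w => ‖w‖) (obaboKernel U γ δ z) := by
  obtain ⟨xs, hxs, -⟩ := exists_isMin hU.contDiff hP.m_pos hU.strongConv
  rw [← law_dirac_one]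
  exact lintegral_law_dirac_norm_lt_top hd hU hP hxs z 1

lemma QuadLip.integrable_obaboKernel (hf : QuadLip γ c Λ f) (hd : 0 < d) (hU : Potential U L m)
    (hP : Params L m γ δ) (hc1 : 4 ≤ c * γ ^ 2) (hΛ : 0 ≤ Λ) (z : Phase d) :
    Integrable f (obaboKernel U γ δ z) :=
  integrable_of_lipschitz_of_integrable_norm (hf.lipschitzWith hP.γ_pos hc1 hΛ)
    (integrable_norm_obaboKernel hd hU hP z)

lemma transition_eq (hf : Measurable f) (z : Phase d) : transition U γ δ f z =
    ∫ q, f (obaboStep U γ δ z q.1 q.2) ∂(stdGaussian (Pos d)).prod (stdGaussian (Pos d)) := by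
  have hm := measurable_obaboStep_right (U := U) (γ := γ) (δ := δ) z
  rw [transition, obaboKernel_apply, integral_map hm.aemeasurable hf.aestronglyMeasurable]

/-- The transition operator contracts the Lipschitz seminorm. -/
lemma QuadLip.transition (hf : QuadLip γ c Λ f) (hd : 0 < d) (hU : Potential U L m)
    (hP : Params L m γ δ) (hc1 : 4 ≤ c * γ ^ 2) (hc2 : c * L ≤ 1) (hΛ : 0 ≤ Λ) :
    QuadLip γ c ((1 - rate m γ * δ) * Λ) (transition U γ δ f) := by
  intro z w
  have hγ := hP.γ_pos
  have hr : 0 ≤ 1 - rate m γ * δ := by have := hP.rate_le_one; linarith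
  have hfc := (hf.lipschitzWith hγ hc1 hΛ).continuous
  have hint : ∀ z, Integrable (fun q : Pos d × Pos d => f (obaboStep U γ δ z q.1 q.2))
      ((stdGaussian (Pos d)).prod (stdGaussian (Pos d))) := fun z => by
    have hm := measurable_obaboStep_right (U := U) (γ := γ) (δ := δ) z
    have h := hf.integrable_obaboKernel hd hU hP hc1 hΛ z
    rw [obaboKernel_apply, integrable_map_measure hfc.aestronglyMeasurable hm.aemeasurable] at h
    exact h
  rw [transition_eq hfc.measurable, transition_eq hfc.measurable,
    ← integral_sub (hint z) (hint w)]
  refine abs_integral_le_integral_abs.trans ?_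
  have : ∫ _ : Pos d × Pos d, (1 - rate m γ * δ) * Λ * √(quad γ c (z - w))
      ∂(stdGaussian (Pos d)).prod (stdGaussian (Pos d)) =
      (1 - rate m γ * δ) * Λ * √(quad γ c (z - w)) := by
    rw [integral_const, probReal_univ, one_smul]
  rw [← this]
  refine integral_mono ((hint z).sub (hint w)).abs (integrable_const _) fun q => ?_
  refine (hf _ _).trans ?_
  rw [mul_comm (1 - rate m γ * δ), mul_assoc]
  refine mul_le_mul_of_nonneg_left ?_ hΛ
  refine (Real.sqrt_le_sqrt (quad_obaboStep_sub_le hU hP hc1 hc2 z w q.1 q.2)).trans ?_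
  rw [Real.sqrt_mul (sq_nonneg _), Real.sqrt_sq hr]

lemma QuadLip.iterate_transition (hf : QuadLip γ c Λ f) (hd : 0 < d) (hU : Potential U L m)
    (hP : Params L m γ δ) (hc1 : 4 ≤ c * γ ^ 2) (hc2 : c * L ≤ 1) (hΛ : 0 ≤ Λ) (k : ℕ) :
    QuadLip γ c ((1 - rate m γ * δ) ^ k * Λ) ((Langevin.transition U γ δ)^[k] f) := by
  have hr : 0 ≤ 1 - rate m γ * δ := by have := hP.rate_le_one; linarith
  induction k with
  | zero => simpa using hf
  | succ k ih =>
    rw [Function.iterate_succ_apply', pow_succ', mul_assoc]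
    exact ih.transition hd hU hP hc1 hc2 (by positivity)

lemma abs_iterate_transition_le {B : ℝ} (hf : ∀ z, |f z| ≤ B) (k : ℕ) (z : Phase d) :
    |(transition U γ δ)^[k] f z| ≤ B := by
  induction k generalizing z with
  | zero => exact hf z
  | succ k ih =>
    rw [Function.iterate_succ_apply', transition, ← Real.norm_eq_abs]
    refine (norm_integral_le_of_norm_le_const (ae_of_all _ ih)).trans (le_of_eq ?_)
    rw [probReal_univ, mul_one]

lemma integral_law_eq (hd : 0 < d) (hU : Potential U L m) (hP : Params L m γ δ)
    {K : ℝ≥0} (hf : LipschitzWith K f) {B : ℝ} (hB : ∀ z, |f z| ≤ B) (ν : Measure (Phase d))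
    [IsProbabilityMeasure ν] (k : ℕ) :
    ∫ z, f z ∂law (obaboKernel U γ δ) ν k = ∫ z, (transition U γ δ)^[k] f z ∂ν := by
  have hγ := hP.γ_pos
  have hc : 4 / γ ^ 2 * γ ^ 2 = 4 := by field_simp
  have hc2 : 4 / γ ^ 2 * L ≤ 1 := by
    rw [div_mul_eq_mul_div, div_le_one (by positivity)]; exact hP.γ_sq
  have hq := quadLip_of_lipschitzWith (γ := γ) (c := 4 / γ ^ 2) hγ hc.ge hf
  have hr : 0 ≤ 1 - rate m γ * δ := by have := hP.rate_le_one; linarith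
  -- The induction needs the statement for all iterates of f, since each step of the law is traded
  -- for one application of the operator.
  suffices h : ∀ j, ∫ z, (transition U γ δ)^[j] f z ∂law (obaboKernel U γ δ) ν k =
      ∫ z, (transition U γ δ)^[j + k] f z ∂ν by simpa using h 0
  induction k with
  | zero => intro j; rfl
  | succ k ih =>
    intro j
    have hcont := ((hq.iterate_transition hd hU hP hc.ge hc2 (by positivity) j).lipschitzWith hγ
      hc.ge (by positivity)).continuous
    rw [law_succ, integral_bind_of_integrable]
    · have := ih (j + 1)
      rw [Function.iterate_succ_apply'] at this
      rw [add_right_comm, add_assoc] at this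
      exact this
    · exact Integrable.of_bound hcont.aestronglyMeasurable B
        (ae_of_all _ fun z => abs_iterate_transition_le hB j z)

/-- Bounded Lipschitz observables forget the initial condition. -/
lemma tendsto_integral_iterate_sub (hd : 0 < d) (hU : Potential U L m) (hP : Params L m γ δ)
    {K : ℝ≥0} (hf : LipschitzWith K f) {B : ℝ} (hB : ∀ z, |f z| ≤ B) (ν : Measure (Phase d))
    [IsProbabilityMeasure ν] (w : Phase d) :
    Filter.Tendsto (fun k => ∫ z, (transition U γ δ)^[k] f z ∂ν - (transition U γ δ)^[k] f w)
      Filter.atTop (𝓝 0) := by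
  have hγ := hP.γ_pos
  have hc : 4 / γ ^ 2 * γ ^ 2 = 4 := by field_simp
  have hc2 : 4 / γ ^ 2 * L ≤ 1 := by
    rw [div_mul_eq_mul_div, div_le_one (by positivity)]; exact hP.γ_sq
  have hq := quadLip_of_lipschitzWith (γ := γ) (c := 4 / γ ^ 2) hγ hc.ge hf
  have hr : 0 ≤ 1 - rate m γ * δ := by have := hP.rate_le_one; linarith
  have hr1 : 1 - rate m γ * δ < 1 := by have := hP.rate_pos; linarith
  have hql := fun k => hq.iterate_transition hd hU hP hc.ge hc2 (by positivity) k
  have hcont := fun k => ((hql k).lipschitzWith hγ hc.ge (by positivity)).continuous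
  have hB0 : 0 ≤ B := (abs_nonneg _).trans (hB 0)
  have hint : ∀ k, Integrable ((transition U γ δ)^[k] f) ν := fun k =>
    Integrable.of_bound (hcont k).aestronglyMeasurable B
      (ae_of_all _ fun z => abs_iterate_transition_le hB k z)
  have h1 : ∀ k, ∫ z, (transition U γ δ)^[k] f z ∂ν - (transition U γ δ)^[k] f w =
      ∫ z, ((transition U γ δ)^[k] f z - (transition U γ δ)^[k] f w) ∂ν := fun k => by
    rw [integral_sub (hint k) (integrable_const _), integral_const, probReal_univ, one_smul]
  simp only [h1]
  have h2 := tendsto_integral_of_dominated_convergence (μ := ν)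
    (F := fun k z => (transition U γ δ)^[k] f z - (transition U γ δ)^[k] f w) (f := fun _ => 0)
    (fun _ => B + B) (fun k => ((hcont k).sub continuous_const).aestronglyMeasurable)
    (integrable_const _) (fun k => ae_of_all _ fun z => (abs_sub _ _).trans
      (add_le_add (abs_iterate_transition_le hB k z) (abs_iterate_transition_le hB k w)))
    (ae_of_all _ fun z => ?_)
  · simpa using h2
  · refine squeeze_zero_norm (fun k => hql k z w) ?_
    have h3 := (tendsto_pow_atTop_nhds_zero_of_lt_one hr hr1).mul_const
      (K * √(2 * max 1 (1 / (4 / γ ^ 2))) * √(quad γ (4 / γ ^ 2) (z - w)))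
    rw [zero_mul] at h3
    refine h3.congr fun k => ?_
    ring

lemma law_eq_of_invariant {κ : Kernel (Phase d) (Phase d)} {ν : Measure (Phase d)}
    (hν : κ.Invariant ν) (k : ℕ) : law κ ν k = ν := by
  induction k with
  | zero => rfl
  | succ k ih => rw [law_succ, ih, hν]

/-- Uniqueness of the invariant probability measure. -/
lemma invariant_unique (hd : 0 < d) (hU : Potential U L m) (hP : Params L m γ δ)
    {μ ν : Measure (Phase d)} [IsProbabilityMeasure μ] [IsProbabilityMeasure ν]
    (hμ : (obaboKernel U γ δ).Invariant μ) (hν : (obaboKernel U γ δ).Invariant ν) : μ = ν := by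
  refine ext_of_forall_integral_eq_of_lipschitz fun f ⟨K, hf⟩ h0 h1 => ?_
  have hB : ∀ z, |f z| ≤ 1 := fun z => by rw [abs_of_nonneg (h0 z)]; exact h1 z
  have l1 := tendsto_integral_iterate_sub hd hU hP hf hB μ 0
  have l2 := tendsto_integral_iterate_sub hd hU hP hf hB ν 0
  have l3 := l1.sub l2
  have e : ∀ k, ∫ z, (transition U γ δ)^[k] f z ∂μ - (transition U γ δ)^[k] f 0 -
      (∫ z, (transition U γ δ)^[k] f z ∂ν - (transition U γ δ)^[k] f 0) =
      ∫ z, f z ∂μ - ∫ z, f z ∂ν := fun k => by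
    rw [← integral_law_eq hd hU hP hf hB μ k, ← integral_law_eq hd hU hP hf hB ν k,
      law_eq_of_invariant hμ, law_eq_of_invariant hν]
    ring
  simp only [e, sub_zero] at l3
  exact sub_eq_zero.1 (tendsto_nhds_unique tendsto_const_nhds l3)

/-- Started at the equilibrium point, the chain has second moments bounded uniformly in time;
Markov's inequality and compactness of balls do the rest. -/
lemma isTightMeasureSet_law (hd : 0 < d) (hU : Potential U L m) (hP : Params L m γ δ)
    (hxs : gradient U xs = 0) : IsTightMeasureSet
      (Set.range fun k => law (obaboKernel U γ δ) (Measure.dirac (mk xs 0)) k) := by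
  rw [isTightMeasureSet_iff_exists_isCompact_measure_compl_le]
  intro ε hε
  set C := ENNReal.ofReal ((d + 2 * 1) * lyapS L m) with hC
  obtain ⟨R, hR0, hR⟩ : ∃ R : ℝ≥0, 0 < R ∧ C / (R : ℝ≥0∞) ≤ ε := by
    rcases eq_or_ne ε ⊤ with rfl | hε'
    · exact ⟨1, one_pos, le_top⟩
    · refine ⟨(C / ε).toNNReal + 1, by positivity, ?_⟩
      rw [ENNReal.div_le_iff_le_mul (Or.inl (by simp)) (Or.inl (by simp)), mul_comm,
        ← ENNReal.div_le_iff_le_mul (Or.inl hε.ne') (Or.inl hε')]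
      have : C / ε ≠ ⊤ := (ENNReal.div_lt_top ENNReal.ofReal_ne_top hε.ne').ne
      rw [ENNReal.coe_add, ENNReal.coe_toNNReal this]
      exact le_self_add
  refine ⟨Metric.closedBall (mk xs 0) (√R), isCompact_closedBall _ _, ?_⟩
  rintro μ ⟨k, rfl⟩
  have h := lintegral_law_norm_le hd hU hP hxs (Q := 1) one_pos (Measure.dirac (mk xs 0)) k
  rw [lintegral_dirac] at h
  simp only [Real.rpow_one, sub_self, norm_zero, zero_pow two_ne_zero, mul_zero, add_zero] at h
  refine le_trans ?_ hR
  have hmeas : Measurable fun z : Phase d => ENNReal.ofReal (‖z - mk xs 0‖ ^ 2) := by fun_prop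
  refine le_trans (measure_mono fun z hz => ?_)
    ((meas_ge_le_lintegral_div hmeas.aemeasurable (ε := (R : ℝ≥0∞)) (by simp [hR0.ne'])
      ENNReal.coe_ne_top).trans (ENNReal.div_le_div_right h _))
  simp only [Set.mem_compl_iff, Metric.mem_closedBall, not_le, dist_eq_norm] at hz
  simp only [Set.mem_ofPred_eq]
  rw [← ENNReal.ofReal_coe_nnreal]
  refine ENNReal.ofReal_le_ofReal ?_
  have := pow_le_pow_left₀ (Real.sqrt_nonneg _) hz.le 2
  rwa [Real.sq_sqrt R.coe_nonneg] at this

/-- Existence of an invariant probability measure. -/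
lemma exists_invariant (hd : 0 < d) (hU : Potential U L m) (hP : Params L m γ δ) :
    ∃ π : Measure (Phase d), IsProbabilityMeasure π ∧ (obaboKernel U γ δ).Invariant π := by
  obtain ⟨xs, hxs, -⟩ := exists_isMin hU.contDiff hP.m_pos hU.strongConv
  set μ : ℕ → ProbabilityMeasure (Phase d) := fun k =>
    ⟨law (obaboKernel U γ δ) (Measure.dirac (mk xs 0)) k, inferInstance⟩ with hμ
  have htight : IsTightMeasureSet
      {((ρ : ProbabilityMeasure (Phase d)) : Measure (Phase d)) | ρ ∈ Set.range μ} := by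
    refine (isTightMeasureSet_law hd hU hP hxs).subset ?_
    rintro _ ⟨_, ⟨k, rfl⟩, rfl⟩
    exact ⟨k, rfl⟩
  have hcomp := isCompact_closure_of_isTightMeasureSet htight
  -- Prokhorov gives a weak cluster point of the laws themselves; no Cesàro averages are required.
  obtain ⟨π, -, hπ⟩ := hcomp.exists_mapClusterPt (f := Filter.atTop) (u := μ)
    (Filter.le_principal_iff.2 (Filter.mem_map.2 (Filter.univ_mem' fun k =>
      subset_closure ⟨k, rfl⟩)))
  obtain ⟨F, hF, hlim⟩ := mapClusterPt_iff_ultrafilter.1 hπ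
  rw [ProbabilityMeasure.tendsto_iff_forall_integral_tendsto] at hlim
  refine ⟨π, inferInstance, ?_⟩
  have hγ := hP.γ_pos
  have hc : 4 / γ ^ 2 * γ ^ 2 = 4 := by field_simp
  have hc2 : 4 / γ ^ 2 * L ≤ 1 := by
    rw [div_mul_eq_mul_div, div_le_one (by positivity)]; exact hP.γ_sq
  refine ext_of_forall_integral_eq_of_lipschitz fun f ⟨K, hf⟩ h0 h1 => ?_
  have hB : ∀ z, |f z| ≤ 1 := fun z => by rw [abs_of_nonneg (h0 z)]; exact h1 z
  have hq := quadLip_of_lipschitzWith (γ := γ) (c := 4 / γ ^ 2) hγ hc.ge hf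
  have hPL := (hq.transition hd hU hP hc.ge hc2 (by positivity)).lipschitzWith hγ hc.ge
    (mul_nonneg (by have := hP.rate_le_one; linarith) (by positivity))
  have hPB : ∀ z, |transition U γ δ f z| ≤ 1 := fun z => abs_iterate_transition_le hB 1 z
  rw [integral_bind_of_integrable _ _ (Integrable.of_bound hf.continuous.aestronglyMeasurable 1
    (ae_of_all _ hB))]
  have l1 := hlim (BoundedContinuousFunction.ofNormedAddCommGroup f hf.continuous 1 hB)
  have l2 := hlim (BoundedContinuousFunction.ofNormedAddCommGroup (transition U γ δ f)
    hPL.continuous 1 hPB)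
  simp only [BoundedContinuousFunction.coe_ofNormedAddCommGroup] at l1 l2
  -- Comparing the start x⋆ with the start after one step shows that the integrals of f at times k +
  -- 1 and k become equal in the limit. As P f is again bounded and continuous, the cluster point is
  -- invariant.
  have l3 := (tendsto_integral_iterate_sub hd hU hP hf hB
    (law (obaboKernel U γ δ) (Measure.dirac (mk xs 0)) 1) (mk xs 0)).mono_left hF
  have e : ∀ k, ∫ z, (transition U γ δ)^[k] f z ∂law (obaboKernel U γ δ)
      (Measure.dirac (mk xs 0)) 1 - (transition U γ δ)^[k] f (mk xs 0) =
      ∫ z, transition U γ δ f z ∂(μ k : Measure (Phase d)) - ∫ z, f z ∂(μ k : Measure (Phase d)) := by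
    intro k
    have e1 := integral_law_eq hd hU hP hf hB (Measure.dirac (mk xs 0)) k
    have e2 := integral_law_eq hd hU hP hPL hPB (Measure.dirac (mk xs 0)) k
    have hqk := hq.iterate_transition hd hU hP hc.ge hc2 (by positivity) k
    have hr : 0 ≤ 1 - rate m γ * δ := by have := hP.rate_le_one; linarith
    have e3 := integral_law_eq hd hU hP
      (hqk.lipschitzWith hγ hc.ge (by positivity))
      (fun z => abs_iterate_transition_le hB k z) (Measure.dirac (mk xs 0)) 1
    rw [e3]
    rw [integral_dirac] at e1 e2 ⊢
    rw [show ((μ k : ProbabilityMeasure (Phase d)) : Measure (Phase d)) =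
      law (obaboKernel U γ δ) (Measure.dirac (mk xs 0)) k from rfl, e1, e2]
    rw [← Function.iterate_succ_apply (transition U γ δ) k f, ← Function.iterate_add_apply,
      add_comm]
  simp only [e] at l3
  have l4 := tendsto_nhds_unique l3 (l2.sub l1)
  have := sub_eq_zero.1 l4.symm
  exact this

end Transition

end Langevin
end

/-! ### Moments of the invariant measure. -/

noncomputable section

namespace Langevin

open scoped NNReal Topology

section InvariantMoments

variable {d : ℕ} {U : Pos d → ℝ} {L m γ δ : ℝ} {xs : Pos d}

/-- Truncation at R preserves the drift inequality and makes everything integrable. Invariance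
bounds the truncated moment by the integral of the k-step Lyapunov bound, whose dependence on z
disappears as k grows; then R tends to infinity by monotone convergence. -/
lemma lintegral_norm_invariant_lt_top (hd : 0 < d) (hU : Potential U L m) (hP : Params L m γ δ)
    (hxs : gradient U xs = 0) {π : Measure (Phase d)} [IsProbabilityMeasure π]
    (hπ : (obaboKernel U γ δ).Invariant π) {Q : ℝ} (hQ : 0 < Q) :
    ∫⁻ z, ENNReal.ofReal ((‖z - mk xs 0‖ ^ 2) ^ Q) ∂π < ⊤ := by
  set C := ENNReal.ofReal (((d + 2 * Q) * lyapS L m) ^ Q) with hC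
  have hr : 0 ≤ 1 - rate m γ * δ := by have := hP.rate_le_one; linarith
  have hr1 : 1 - rate m γ * δ < 1 := by have := hP.rate_pos; linarith
  have key : ∀ R : ℕ, ∫⁻ z, min (R : ℝ≥0∞) (ENNReal.ofReal ((‖z - mk xs 0‖ ^ 2) ^ Q)) ∂π ≤ C := by
    intro R
    have hγ := hP.γ_pos
    have hc : 4 / γ ^ 2 * γ ^ 2 = 4 := by field_simp
    have hle0 : ∀ z, ENNReal.ofReal ((‖z - mk xs 0‖ ^ 2) ^ Q) ≤
        ENNReal.ofReal (lyap L m γ δ Q xs 0 z) := fun z => by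
      refine ENNReal.ofReal_le_ofReal (le_trans ?_ (le_lyap_zero z))
      refine Real.rpow_le_rpow (by positivity) ?_ hQ.le
      have h1 := (quad_bounds hγ hc.ge (z - mk xs 0)).2.2.1
      rw [WithLp.sub_fst, show (mk xs 0).fst = xs from rfl] at h1
      rw [norm_sub_mk_sq]
      have : (0 : ℝ) ≤ (d + 2 * Q) * (1 / 100) := by positivity
      linarith
    have h := fun k => lintegral_law_le (obaboKernel U γ δ) π
      (F := fun k z => min (R : ℝ≥0∞) (ENNReal.ofReal (lyap L m γ δ Q xs k z)))
      (fun k => measurable_const.min (measurable_lyap Q k).ennreal_ofReal)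
      (fun k z => le_min ((lintegral_mono fun w => min_le_left _ _).trans (by simp))
        ((lintegral_mono fun w => min_le_right _ _).trans (lyap_step hd hU hP hxs hQ k z))) 0 k
    simp only [law_eq_of_invariant hπ, zero_add] at h
    have hlim : Filter.Tendsto (fun k : ℕ => ∫⁻ z, min (R : ℝ≥0∞)
        (ENNReal.ofReal (((d + 2 * Q) * lyapS L m +
          (1 - rate m γ * δ) ^ (2 * k) * (lyapM L * ‖z - mk xs 0‖ ^ 2)) ^ Q)) ∂π) Filter.atTop
        (𝓝 (∫⁻ _, min (R : ℝ≥0∞) C ∂π)) := by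
      refine tendsto_lintegral_of_dominated_convergence (fun _ => (R : ℝ≥0∞)) (fun k => ?_)
        (fun k => ae_of_all _ fun z => min_le_left _ _) (by simp) (ae_of_all _ fun z => ?_)
      · have hcont : Continuous fun z : Phase d => (d + 2 * Q) * lyapS L m +
          (1 - rate m γ * δ) ^ (2 * k) * (lyapM L * ‖z - mk xs 0‖ ^ 2) := by fun_prop
        exact measurable_const.min (hcont.measurable.pow_const Q).ennreal_ofReal
      · refine tendsto_const_nhds.min ((ENNReal.continuous_ofReal.tendsto _).comp ?_)
        have h1 : Filter.Tendsto (fun k : ℕ => (1 - rate m γ * δ) ^ (2 * k)) Filter.atTop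
            (𝓝 0) := by
          have := tendsto_pow_atTop_nhds_zero_of_lt_one (sq_nonneg _)
            (pow_lt_one₀ hr hr1 two_ne_zero)
          simpa only [pow_mul] using this
        have h2 := (h1.mul_const (lyapM L * ‖z - mk xs 0‖ ^ 2)).const_add
          ((d + 2 * Q) * lyapS L m)
        rw [zero_mul, add_zero] at h2
        exact ((Real.continuous_rpow_const hQ.le).tendsto _).comp h2
    have h2 : ∀ k, ∫⁻ z, min (R : ℝ≥0∞) (ENNReal.ofReal ((‖z - mk xs 0‖ ^ 2) ^ Q)) ∂π ≤
        ∫⁻ z, min (R : ℝ≥0∞) (ENNReal.ofReal (((d + 2 * Q) * lyapS L m +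
          (1 - rate m γ * δ) ^ (2 * k) * (lyapM L * ‖z - mk xs 0‖ ^ 2)) ^ Q)) ∂π := fun k =>
      (lintegral_mono fun z => min_le_min_left _ (hle0 z)).trans ((h k).trans
        (lintegral_mono fun z => min_le_min_left _
          (ENNReal.ofReal_le_ofReal (lyap_le hP hQ k z))))
    refine (ge_of_tendsto' hlim h2).trans ?_
    rw [lintegral_const, measure_univ, mul_one]
    exact min_le_right _ _
  have hsup : ∀ z : Phase d, ENNReal.ofReal ((‖z - mk xs 0‖ ^ 2) ^ Q) =
      ⨆ R : ℕ, min (R : ℝ≥0∞) (ENNReal.ofReal ((‖z - mk xs 0‖ ^ 2) ^ Q)) := fun z => by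
    have := iSup_inf_eq (fun R : ℕ => (R : ℝ≥0∞)) (ENNReal.ofReal ((‖z - mk xs 0‖ ^ 2) ^ Q))
    rw [ENNReal.iSup_natCast, top_inf_eq] at this
    exact this
  have hmeas : Measurable fun z : Phase d => ENNReal.ofReal ((‖z - mk xs 0‖ ^ 2) ^ Q) :=
    ((by fun_prop : Continuous fun z : Phase d => ‖z - mk xs 0‖ ^ 2).measurable.pow_const
      Q).ennreal_ofReal
  rw [lintegral_congr hsup, lintegral_iSup (fun R => measurable_const.min hmeas)
    fun a b hab z => min_le_min_right _ (by exact_mod_cast hab)]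
  exact (iSup_le key).trans_lt ENNReal.ofReal_lt_top

lemma InP_of_invariant (hd : 0 < d) (hU : Potential U L m) (hP : Params L m γ δ)
    {π : Measure (Phase d)} [IsProbabilityMeasure π]
    (hπ : (obaboKernel U γ δ).Invariant π) {p : ℝ} (hp : 1 ≤ p) : InP p π := by
  obtain ⟨xs, hxs, -⟩ := exists_isMin hU.contDiff hP.m_pos hU.strongConv
  have h := lintegral_norm_invariant_lt_top hd hU hP hxs hπ (Q := p / 2) (by linarith)
  have e : ∀ z : Phase d, (‖z - mk xs 0‖ ^ 2) ^ (p / 2) = ‖z - mk xs 0‖ ^ p := fun z => by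
    rw [← Real.rpow_natCast, ← Real.rpow_mul (norm_nonneg _)]; congr 1; push_cast; ring
  simp only [e] at h
  refine ⟨inferInstance, ?_⟩
  have hp' : ENNReal.ofReal p ≠ 0 := by simp; linarith
  have h1 : MemLp (fun z : Phase d => z - mk xs 0) (ENNReal.ofReal p) π := by
    rw [← integrable_norm_rpow_iff (by fun_prop) hp' ENNReal.ofReal_ne_top,
      ENNReal.toReal_ofReal (by linarith)]
    refine ⟨((by fun_prop : Continuous fun z : Phase d => ‖z - mk xs 0‖).measurable.pow_const
      p).aestronglyMeasurable, ?_⟩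
    rwa [hasFiniteIntegral_iff_ofReal (ae_of_all _ fun w => by positivity)]
  have h2 := h1.add (memLp_const (mk xs 0))
  have h3 : (fun z : Phase d => z - mk xs 0) + (fun _ => mk xs 0) = id := by
    ext1 z; simp
  rw [h3, ← integrable_norm_rpow_iff (by fun_prop) hp' ENNReal.ofReal_ne_top,
      ENNReal.toReal_ofReal (by linarith)] at h2
  exact h2

end InvariantMoments

/-! ### The rejection probability and the additive error -/

section Rejection

variable {d : ℕ} {U : Pos d → ℝ} {L m γ δ : ℝ} {xs : Pos d}

/-- The mean rejection probability of the adjusted chain from `z`. -/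
def rej (U : Pos d → ℝ) (γ δ : ℝ) (z : Phase d) : ℝ≥0∞ :=
  ∫⁻ g, ENNReal.ofReal (1 - accept U δ (stepO γ δ z g)) ∂stdGaussian (Pos d)

/-- The expected number of rejections, along the unadjusted chain, before time `n`. -/
def sumRej (U : Pos d → ℝ) (γ δ : ℝ) (ν : Measure (Phase d)) (n : ℕ) : ℝ≥0∞ :=
  ∑ k ∈ Finset.range n, ∫⁻ z, rej U γ δ z ∂law (obaboKernel U γ δ) ν k

lemma measurable_rej_integrand (hU : Measurable U) :
    Measurable fun p : Phase d × Pos d => ENNReal.ofReal (1 - accept U δ (stepO γ δ p.1 p.2)) :=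
  (measurable_const.sub ((measurable_accept hU δ).comp (measurable_stepO γ δ))).ennreal_ofReal

lemma measurable_rej (hU : Measurable U) : Measurable (rej U γ δ) :=
  (measurable_rej_integrand hU).lintegral_prod_right'

lemma accept_pos (z : Phase d) : 0 < accept U δ z := Real.exp_pos _

lemma rej_le_one (z : Phase d) : rej U γ δ z ≤ 1 := by
  refine (lintegral_mono fun g => ENNReal.ofReal_le_ofReal
    (sub_le_self 1 (accept_pos _).le)).trans ?_
  simp

/-- From 1 - e^(-t) ≤ t; only an upper bound of the energy error matters. -/
lemma one_sub_accept_le {z : Phase d} {B : ℝ} (hB : 0 ≤ B)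
    (h : hamiltonian U (verlet U δ z) - hamiltonian U z ≤ B) : 1 - accept U δ z ≤ B := by
  have h1 := Real.add_one_le_exp (-max (hamiltonian U (verlet U δ z) - hamiltonian U z) 0)
  have h2 : max (hamiltonian U (verlet U δ z) - hamiltonian U z) 0 ≤ B := max_le h hB
  unfold accept
  linarith

/-- The moment after the first partial refreshment of the velocity. -/
lemma lintegral_stepO_le (hd : 0 < d) (hP : Params L m γ δ) {Q : ℝ} (hQ : 0 < Q) (z : Phase d) :
    ∫⁻ g, ENNReal.ofReal ((‖stepO γ δ z g - mk xs 0‖ ^ 2) ^ Q) ∂stdGaussian (Pos d) ≤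
      ENNReal.ofReal ((((d + 2 * Q) * (1 / 100)) + 4 / 3 * quad γ (4 / γ ^ 2) (z - mk xs 0) +
        ‖z.snd‖ ^ 2) ^ Q) := by
  have hη := eta_pos γ δ
  have hγ := hP.γ_pos
  have hc : 4 / γ ^ 2 * γ ^ 2 = 4 := by field_simp
  have hη2 : eta γ δ ^ 2 ≤ 1 := pow_le_one₀ hη.le hP.eta_le_one
  have e : ∀ g, ‖stepO γ δ z g - mk xs 0‖ ^ 2 =
      ‖z.fst - xs‖ ^ 2 + 1 * ‖eta γ δ • z.snd + √(1 - eta γ δ ^ 2) • g‖ ^ 2 := fun g => by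
    rw [norm_sub_mk_sq, one_mul]; rfl
  simp only [e]
  refine (lintegral_rpow_add_norm_sq_le hd _ _ (by positivity) zero_le_one hQ).trans
    (ENNReal.ofReal_le_ofReal (Real.rpow_le_rpow (by positivity) ?_ hQ.le))
  rw [Real.sq_sqrt (by linarith), norm_smul, mul_pow, Real.norm_of_nonneg hη.le]
  have h1 := (quad_bounds hγ hc.ge (z - mk xs 0)).2.2.1
  rw [WithLp.sub_fst, show (mk xs 0).fst = xs from rfl] at h1
  have h2 := mul_le_mul_of_nonneg_right hη2 (sq_nonneg ‖z.snd‖)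
  -- The variance of the refreshment is at most δγ ≤ 1/132, which fits into the surplus 1/100 of
  -- `le_lyap_zero`.
  have h3 : 1 - eta γ δ ^ 2 ≤ 1 / 100 := by
    have := hP.exp_bounds.1
    have h4 : eta γ δ ^ 2 = Real.exp (-(δ * γ)) := by
      rw [eta, ← Real.exp_nat_mul]; congr 1; push_cast; ring
    have := hP.h_le
    rw [h4]; linarith
  have h5 := mul_le_mul_of_nonneg_left h3 (by positivity : (0 : ℝ) ≤ d + 2 * Q)
  linarith

/-- Moments of the state at which the Verlet step is proposed. -/
lemma lintegral_law_stepO_le (hd : 0 < d) (hU : Potential U L m) (hP : Params L m γ δ)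
    (hxs : gradient U xs = 0) {Q : ℝ} (hQ : 0 < Q) (ν : Measure (Phase d)) (k : ℕ) :
    ∫⁻ z, ∫⁻ g, ENNReal.ofReal ((‖stepO γ δ z g - mk xs 0‖ ^ 2) ^ Q) ∂stdGaussian (Pos d)
        ∂law (obaboKernel U γ δ) ν k ≤
      ∫⁻ z, ENNReal.ofReal (((d + 2 * Q) * lyapS L m +
        (1 - rate m γ * δ) ^ (2 * k) * (lyapM L * ‖z - mk xs 0‖ ^ 2)) ^ Q) ∂ν :=
  (lintegral_mono fun z => lintegral_stepO_le hd hP hQ z).trans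
    (lintegral_law_lyap_le hd hU hP hxs hQ ν k)

end Rejection

end Langevin
end

/-! ### Comparison of the Lyapunov constants with the stated ones. -/

noncomputable section

namespace Langevin

open scoped NNReal

section Constants

variable {L m γ δ : ℝ}

/-- With s = max(√L, 1/√L), K₁ is √3 s, and √3 ≥ 5/3 gives a polynomial lower bound in s. The later
comparisons of constants thereby become polynomial inequalities. -/
lemma K₁_add_sq_ge (hL : 0 < L) : ∃ s, 1 ≤ s ∧ √L ≤ s ∧ 1 ≤ s * √L ∧ L ≤ s ^ 2 ∧ 1 / L ≤ s ^ 2 ∧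
    3 * s ^ 2 + 10 * s + 9 ≤ (K₁ L + 3) ^ 2 := by
  have h0 : 0 < √L := Real.sqrt_pos.2 hL
  have hsq : √L ^ 2 = L := Real.sq_sqrt hL.le
  refine ⟨max √L (1 / √L), ?_, le_max_left _ _, ?_, ?_, ?_, ?_⟩
  · rcases le_total 1 √L with h | h
    · exact h.trans (le_max_left _ _)
    · exact ((one_le_div h0).2 h).trans (le_max_right _ _)
  · have := mul_le_mul_of_nonneg_right (le_max_right √L (1 / √L)) h0.le
    rwa [div_mul_cancel₀ _ h0.ne'] at this
  · exact hsq.symm.le.trans (pow_le_pow_left₀ h0.le (le_max_left _ _) 2)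
  · have := pow_le_pow_left₀ (by positivity) (le_max_right √L (1 / √L)) 2
    rwa [div_pow, one_pow, hsq] at this
  · have h3 : (5 / 3 : ℝ) ≤ √3 := Real.le_sqrt_of_sq_le (by norm_num)
    have h4 : √3 ^ 2 = 3 := Real.sq_sqrt (by norm_num)
    have h5 : 0 < max √L (1 / √L) := h0.trans_le (le_max_left _ _)
    unfold K₁
    nlinarith

lemma K₁_nonneg (L : ℝ) : 0 ≤ K₁ L :=
  mul_nonneg (Real.sqrt_nonneg _) ((Real.sqrt_nonneg _).trans (le_max_left _ _))

/-- The K₃ term is nonnegative and can be dropped: the moment bounds only require the part 1 + 1/√m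
of A. -/
lemma momentConst_ge (hP : Params L m γ δ) : 1 + 1 / √m ≤ momentConst L m γ δ := by
  have hL := hP.L_pos
  have hm := hP.m_pos
  have hδ := hP.δ_pos
  have hγ := hP.γ_pos
  have h1 := K₁_nonneg L
  have h2 : 0 ≤ 2 * δ * K₁ L * K₃ L m δ / rate m γ := by
    unfold K₃ rate; positivity
  unfold momentConst
  linarith

lemma momentConst_sq_ge (hP : Params L m γ δ) : 1 + 1 / m ≤ momentConst L m γ δ ^ 2 := by
  have hm := hP.m_pos
  have h := momentConst_ge hP
  have h0 : 0 < √m := Real.sqrt_pos.2 hm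
  have h1 : (1 / √m) ^ 2 = 1 / m := by rw [div_pow, one_pow, Real.sq_sqrt hm.le]
  have h2 := pow_le_pow_left₀ (by positivity) h 2
  have h3 : 0 < 1 / √m := by positivity
  nlinarith

lemma momentConst_pos (hP : Params L m γ δ) : 0 < momentConst L m γ δ := by
  have hm := hP.m_pos
  exact lt_of_lt_of_le (by positivity) (momentConst_ge hP)

lemma lyapM_le (hL : 0 < L) : lyapM L ≤ 3 / 5 * (K₁ L + 3) ^ 2 := by
  obtain ⟨s, hs1, -, -, hsL, hsL', hK⟩ := K₁_add_sq_ge hL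
  have : lyapM L = 11 / 4 + 5 / 12 * L + 4 / 3 * (1 / L) := by
    unfold lyapM lyapB; field_simp; ring
  rw [this]
  nlinarith

lemma lyapM_pos (hL : 0 < L) : 0 < lyapM L := by
  unfold lyapM lyapB; positivity

lemma lyapS_pos (hP : Params L m γ δ) : 0 < lyapS L m := by
  have := lyapP_pos hP; unfold lyapS; linarith

/-- The divisor 17/20 is the convexity weight given to the stationary part of the moments in
`sum_lintegral_cubic_le`; the factor 2 comes from d + ℓ + 1 ≤ 2(d + ℓ - 1). -/
lemma lyapS_le (hP : Params L m γ δ) :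
    2 * lyapS L m / (17 / 20) ≤ 4 * (K₁ L + 3) ^ 2 * momentConst L m γ δ ^ 2 := by
  have hm := hP.m_pos
  obtain ⟨s, hs1, -, -, hsL, hsL', hK⟩ := K₁_add_sq_ge hP.L_pos
  have h1 := mul_le_mul (by linarith : 4 * (3 * s ^ 2 + 10 * s + 9) ≤ 4 * (K₁ L + 3) ^ 2)
    (momentConst_sq_ge hP) (by positivity) (by positivity)
  refine le_trans ?_ h1
  have h2 : lyapS L m = (121 / 10 * (4 / 3 + 5 / 12 * L)) * (1 / m) + 201 / 100 := by
    unfold lyapS lyapP lyapB; field_simp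
  have hm' : 0 < 1 / m := by positivity
  rw [h2]
  have h3 : 0 ≤ (4 * (3 * s ^ 2 + 10 * s + 9) -
    2 * (121 / 10 * (4 / 3 + 5 / 12 * L)) / (17 / 20)) * (1 / m) :=
    mul_nonneg (by nlinarith) hm'.le
  nlinarith

/-- The factor 3 stands for d + 2 ≤ 3d. Part of the room is found in 1/κ = 3γ/m ≥ 6√L/m. -/
lemma lyapS_le' (hP : Params L m γ δ) : 3 * lyapS L m ≤
    2 * (K₁ L + 3) ^ 2 * momentConst L m γ δ ^ 2 * (1 + 1 / rate m γ) := by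
  have hm := hP.m_pos
  have hL := hP.L_pos
  have hγ := hP.γ_pos
  obtain ⟨s, hs1, hs, hst, hsL, hsL', hK⟩ := K₁_add_sq_ge hL
  have hsq : √L ^ 2 = L := Real.sq_sqrt hL.le
  set t := √L with ht
  have ht0 : 0 < t := Real.sqrt_pos.2 hL
  have h2t : 2 * t ≤ γ := by
    refine le_of_sq_le_sq ?_ hγ.le
    rw [mul_pow, hsq]; have := hP.γ_sq; linarith
  have hκ : 6 * t * (1 / m) ≤ 1 / rate m γ := by
    rw [rate, one_div_div, mul_one_div, div_le_div_iff_of_pos_right hm]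
    linarith
  have hm' : 0 < 1 / m := by positivity
  have h0 : 2 * (3 * s ^ 2 + 10 * s + 9) * (1 + 1 / m) * (1 + 6 * t * (1 / m)) ≤
      2 * (K₁ L + 3) ^ 2 * momentConst L m γ δ ^ 2 * (1 + 1 / rate m γ) := by
    have := momentConst_sq_ge hP
    gcongr
  refine le_trans ?_ h0
  have h2 : lyapS L m = (121 / 10 * (4 / 3 + 5 / 12 * L)) * (1 / m) + 201 / 100 := by
    unfold lyapS lyapP lyapB; field_simp
  have h3 : t ^ 2 ≤ s ^ 2 * t := by nlinarith
  have h4 : 3 * (121 / 10 * (4 / 3 + 5 / 12 * L)) ≤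
      2 * (3 * s ^ 2 + 10 * s + 9) * (1 + 6 * t) := by
    rw [← hsq]
    nlinarith
  have h5 := mul_le_mul_of_nonneg_right h4 hm'.le
  have h6 : 0 ≤ 2 * (3 * s ^ 2 + 10 * s + 9) * (1 / m) * (6 * t * (1 / m)) := by positivity
  rw [h2]
  nlinarith

/-- The dimension-free factor in `K_ten`. -/
def cubicFactor (L m γ δ ℓ : ℝ) : ℝ :=
  (2 : ℝ) ^ ℓ * (K₁ L + 3) ^ (ℓ + 1) * momentConst L m γ δ ^ (ℓ + 1)

lemma K_ten_eq (L m γ δ ℓ Lℓ : ℝ) : K_ten L m γ δ ℓ Lℓ =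
    (1 + cubicFactor L m γ δ ℓ * (1 / rate m γ + 1)) * cubicConst L δ ℓ Lℓ := rfl

lemma rpow_eq_cubicFactor (hP : Params L m γ δ) (ℓ : ℝ) :
    (4 * (K₁ L + 3) ^ 2 * momentConst L m γ δ ^ 2) ^ ((ℓ + 1) / 2) =
      2 * cubicFactor L m γ δ ℓ := by
  have h1 := K₁_nonneg L
  have h2 := momentConst_pos hP
  have h3 : 4 * (K₁ L + 3) ^ 2 * momentConst L m γ δ ^ 2 =
      (2 * (K₁ L + 3) * momentConst L m γ δ) ^ (2 : ℝ) := by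
    rw [Real.rpow_two]; ring
  rw [h3, ← Real.rpow_mul (by positivity), mul_div_cancel₀ _ (two_ne_zero),
    Real.mul_rpow (by positivity) h2.le, Real.mul_rpow (by norm_num) (by positivity),
    Real.rpow_add_one (by norm_num), cubicFactor]
  ring

lemma cubicFactor_pos (hP : Params L m γ δ) (ℓ : ℝ) : 0 < cubicFactor L m γ δ ℓ := by
  have h1 := K₁_nonneg L
  have h2 := momentConst_pos hP
  unfold cubicFactor
  positivity

lemma cubicConst_pos (hL : 0 < L) (hδ : 0 < δ) (ℓ : ℝ) {Lℓ : ℝ} (hLℓ : 0 < Lℓ) :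
    0 < cubicConst L δ ℓ Lℓ := by
  unfold cubicConst; positivity

lemma sum_pow_le (hP : Params L m γ δ) (n : ℕ) :
    ∑ k ∈ Finset.range n, (1 - rate m γ * δ) ^ (2 * k) ≤ 1 / (rate m γ * δ) := by
  have h0 := hP.rate_pos
  have h1 := hP.rate_le_one
  set r := 1 - rate m γ * δ with hr
  have hr0 : 0 ≤ r := by rw [hr]; linarith
  have hr1 : r ≤ 1 := by rw [hr]; linarith
  have h2 : ∑ k ∈ Finset.range n, r ^ (2 * k) ≤ ∑ k ∈ Finset.range n, r ^ k :=
    Finset.sum_le_sum fun k _ => pow_le_pow_of_le_one hr0 hr1 (by omega)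
  refine h2.trans ?_
  rw [le_div_iff₀ h0, show rate m γ * δ = 1 - r by rw [hr]; ring, geom_sum_mul_neg]
  have := pow_nonneg hr0 n
  linarith

/-- Since δ√L ≤ 1/264, it remains to bound L^(3/2) by the mean of L and L². -/
lemma Params.δ_mul_L_sq (hP : Params L m γ δ) : δ * L ^ 2 ≤ (L + L ^ 2) / 100 := by
  have hL := hP.L_pos
  have hδ := hP.δ_pos
  have hγ := hP.γ_pos
  have hsq : √L ^ 2 = L := Real.sq_sqrt hL.le
  set t := √L with ht
  have ht0 : 0 < t := Real.sqrt_pos.2 hL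
  have h2t : 2 * t ≤ γ := by
    refine le_of_sq_le_sq ?_ hγ.le
    rw [mul_pow, hsq]; have := hP.γ_sq; linarith
  have h1 : δ * t ≤ 1 / 264 := by
    have := mul_le_mul_of_nonneg_left h2t hδ.le
    have := hP.h_le
    linarith
  have h2 : δ * L ^ 2 = δ * t * (t * L) := by rw [← hsq]; ring
  have h3 : t * L ≤ (L + L ^ 2) / 2 := by
    rw [← hsq]; nlinarith [sq_nonneg (t - 1), mul_nonneg (sq_nonneg t) (sq_nonneg (t - 1))]
  rw [h2]
  have h4 := mul_le_mul h1 h3 (by positivity) (by norm_num)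
  nlinarith

end Constants

/-! ### The expected number of rejections along the unadjusted chain. -/

section Bounds

variable {d : ℕ} {U : Pos d → ℝ} {L m γ δ : ℝ} {xs : Pos d}

lemma integrable_norm_sub_rpow {ν : Measure (Phase d)} [IsFiniteMeasure ν] {p : ℝ} (hp : 1 ≤ p)
    (h : Integrable (fun z => ‖z‖ ^ p) ν) (c : Phase d) :
    Integrable (fun z => ‖z - c‖ ^ p) ν := by
  have hp' : ENNReal.ofReal p ≠ 0 := by simp; linarith
  have hp2 : (ENNReal.ofReal p).toReal = p := ENNReal.toReal_ofReal (by linarith)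
  have h1 : MemLp (id : Phase d → Phase d) (ENNReal.ofReal p) ν := by
    rw [← integrable_norm_rpow_iff (by fun_prop) hp' ENNReal.ofReal_ne_top, hp2]
    exact h
  have h2 := h1.sub (memLp_const c)
  rw [← integrable_norm_rpow_iff (by fun_prop) hp' ENNReal.ofReal_ne_top, hp2] at h2
  exact h2

lemma lintegral_norm_sub_rpow {ν : Measure (Phase d)} {p : ℝ} (hp : 1 ≤ p) (h : InP p ν)
    (c : Pos d) :
    ∫⁻ z, ENNReal.ofReal (‖z - mk c 0‖ ^ p) ∂ν = ENNReal.ofReal (momentAt c p ν) := by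
  have := h.1
  rw [momentAt, ofReal_integral_eq_lintegral_ofReal (integrable_norm_sub_rpow hp h.2 _)
    (ae_of_all _ fun z => by positivity)]

lemma momentAt_nonneg (c : Pos d) (p : ℝ) (ν : Measure (Phase d)) : 0 ≤ momentAt c p ν :=
  integral_nonneg fun z => by positivity

/-- Each step costs δ² times a second moment. The stationary part of the moments gives δ²nd; the
initial part decays geometrically and sums to 1/(κδ), which leaves one power of δ. -/
lemma sumRej_le_quadratic (hd : 0 < d) (hU : Potential U L m) (hP : Params L m γ δ)
    (hxs : gradient U xs = 0) {ν : Measure (Phase d)} (hν : InP 2 ν) (n : ℕ) :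
    sumRej U γ δ ν n ≤
      ENNReal.ofReal (δ * K₉ L m γ δ * (momentAt xs 2 ν + δ * n * d)) := by
  have := hν.1
  have hL := hP.L_pos
  have hδ := hP.δ_pos
  have hm := hP.m_pos
  have hγ := hP.γ_pos
  have hd1 : (1 : ℝ) ≤ d := by exact_mod_cast hd
  have hκ : 0 < rate m γ := by unfold rate; positivity
  set B := δ * L / 8 + (1 + δ / 4 + δ ^ 2 * L / 4) * (1 + δ ^ 2 * (L ^ 2 / 4)) with hB
  have hB0 : 0 < B := by rw [hB]; positivity
  set M₂ := momentAt xs 2 ν with hM₂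
  have hM₂0 : 0 ≤ M₂ := momentAt_nonneg _ _ _
  have hS := lyapS_pos hP
  have hM := lyapM_pos hL
  have hmom : ∫⁻ z, ENNReal.ofReal (‖z - mk xs 0‖ ^ 2) ∂ν = ENNReal.ofReal M₂ := by
    have := lintegral_norm_sub_rpow one_le_two hν xs
    simpa only [Real.rpow_two] using this
  have hterm : ∀ k, ∫⁻ z, rej U γ δ z ∂law (obaboKernel U γ δ) ν k ≤
      ENNReal.ofReal (δ ^ 2 * (L * B) * ((d + 2) * lyapS L m +
        (1 - rate m γ * δ) ^ (2 * k) * (lyapM L * M₂))) := by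
    intro k
    have hr : 0 ≤ (1 - rate m γ * δ) ^ (2 * k) := by rw [pow_mul]; positivity
    have h1 := lintegral_law_stepO_le hd hU hP hxs (Q := 1) one_pos ν k
    simp only [Real.rpow_one, mul_one] at h1
    calc _ ≤ ∫⁻ z, ∫⁻ g, ENNReal.ofReal (δ ^ 2 * (L * B)) *
          ENNReal.ofReal (‖stepO γ δ z g - mk xs 0‖ ^ 2) ∂stdGaussian (Pos d)
            ∂law (obaboKernel U γ δ) ν k := by
          refine lintegral_mono fun z => lintegral_mono fun g => ?_
          rw [← ENNReal.ofReal_mul (by positivity)]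
          exact ENNReal.ofReal_le_ofReal (one_sub_accept_le (by positivity)
            (energy_error_le_quadratic hU.contDiff hL hU.gradLip hm hU.strongConv hδ hxs _))
      _ = ENNReal.ofReal (δ ^ 2 * (L * B)) * ∫⁻ z, ∫⁻ g,
          ENNReal.ofReal (‖stepO γ δ z g - mk xs 0‖ ^ 2) ∂stdGaussian (Pos d)
            ∂law (obaboKernel U γ δ) ν k := by
          rw [← lintegral_const_mul' _ _ ENNReal.ofReal_ne_top]
          exact lintegral_congr fun z => lintegral_const_mul' _ _ ENNReal.ofReal_ne_top
      _ ≤ ENNReal.ofReal (δ ^ 2 * (L * B)) * ∫⁻ z, ENNReal.ofReal ((d + 2) * lyapS L m +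
        (1 - rate m γ * δ) ^ (2 * k) * (lyapM L * ‖z - mk xs 0‖ ^ 2)) ∂ν := by gcongr
      _ = _ := by
          have h2 : ∀ z : Phase d, ENNReal.ofReal ((d + 2) * lyapS L m +
              (1 - rate m γ * δ) ^ (2 * k) * (lyapM L * ‖z - mk xs 0‖ ^ 2)) =
              ENNReal.ofReal ((d + 2) * lyapS L m) + ENNReal.ofReal
                ((1 - rate m γ * δ) ^ (2 * k) * lyapM L) * ENNReal.ofReal (‖z - mk xs 0‖ ^ 2) := by
            intro z
            rw [ENNReal.ofReal_add (by positivity) (by positivity),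
              ← ENNReal.ofReal_mul (by positivity), mul_assoc]
          simp only [h2]
          rw [lintegral_add_left measurable_const, lintegral_const, measure_univ, mul_one,
            lintegral_const_mul' _ _ ENNReal.ofReal_ne_top, hmom,
            ← ENNReal.ofReal_mul (by positivity), ← ENNReal.ofReal_add (by positivity)
              (by positivity), ← ENNReal.ofReal_mul (by positivity)]
          congr 1
          ring
  unfold sumRej
  refine (Finset.sum_le_sum fun k _ => hterm k).trans ?_
  rw [← ENNReal.ofReal_sum_of_nonneg fun k _ => by
    have hr : 0 ≤ (1 - rate m γ * δ) ^ (2 * k) := by rw [pow_mul]; positivity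
    positivity]
  refine ENNReal.ofReal_le_ofReal ?_
  rw [← Finset.mul_sum, Finset.sum_add_distrib, Finset.sum_const, Finset.card_range,
    ← Finset.sum_mul, nsmul_eq_mul]
  have hsum := sum_pow_le hP n
  have hA := momentConst_sq_ge hP
  have hm' : 0 < 1 / m := by positivity
  set X := 2 * (K₁ L + 3) ^ 2 * momentConst L m γ δ ^ 2 * (1 + 1 / rate m γ) with hX
  have hK9 : K₉ L m γ δ = X * (L * B) := by rw [hX, K₉, hB]; ring
  have hS3 : 3 * lyapS L m ≤ X := lyapS_le' hP
  have hMX : lyapM L * (1 / (rate m γ * δ)) ≤ X / δ := by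
    have h0 : lyapM L * (1 / (rate m γ * δ)) = lyapM L * (1 / rate m γ) / δ := by field_simp
    rw [h0, div_le_div_iff_of_pos_right hδ]
    have h1 := lyapM_le hL
    have h2 : lyapM L * (1 / rate m γ) ≤ 2 * (K₁ L + 3) ^ 2 * 1 * (1 + 1 / rate m γ) := by
      have h3 : 0 < 1 / rate m γ := by positivity
      have h4 := mul_le_mul_of_nonneg_right h1 h3.le
      nlinarith [sq_nonneg (K₁ L + 3), mul_nonneg (sq_nonneg (K₁ L + 3)) h3.le]
    refine h2.trans ?_
    rw [hX]
    have : 1 ≤ momentConst L m γ δ ^ 2 := by linarith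
    gcongr
  have e1 : (n : ℝ) * ((d + 2) * lyapS L m) ≤ n * (d * X) := by
    refine mul_le_mul_of_nonneg_left ?_ (Nat.cast_nonneg n)
    have : (d + 2) * lyapS L m ≤ (3 * d) * lyapS L m := by gcongr; linarith
    have h2 := mul_le_mul_of_nonneg_left hS3 (by positivity : (0 : ℝ) ≤ d)
    linarith
  have e2 : (∑ k ∈ Finset.range n, (1 - rate m γ * δ) ^ (2 * k)) * (lyapM L * M₂) ≤
      X / δ * M₂ := by
    have h1 := mul_le_mul_of_nonneg_right hsum (by positivity : 0 ≤ lyapM L * M₂)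
    have h2 := mul_le_mul_of_nonneg_right hMX hM₂0
    linarith
  have e3 := mul_le_mul_of_nonneg_left (add_le_add e1 e2) (by positivity : 0 ≤ δ ^ 2 * (L * B))
  refine e3.trans (le_of_eq ?_)
  rw [hK9]
  field_simp
  ring

set_option maxHeartbeats 800000 in
/-- Summing the moments of order `ℓ + 1` along the unadjusted chain. -/
lemma sum_lintegral_cubic_le (hd : 0 < d) (hU : Potential U L m) (hP : Params L m γ δ)
    (hxs : gradient U xs = 0) {ℓ C : ℝ} (hℓ : 2 ≤ ℓ) (hC : 0 < C) {ν : Measure (Phase d)}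
    (hν : InP (ℓ + 1) ν) (n : ℕ) :
    ∑ k ∈ Finset.range n, ∫⁻ z, ∫⁻ g, ENNReal.ofReal (δ ^ 3 * (51 / 100 * C) *
        (1 + ‖stepO γ δ z g - mk xs 0‖ ^ (ℓ + 1))) ∂stdGaussian (Pos d)
          ∂law (obaboKernel U γ δ) ν k ≤
      ENNReal.ofReal (δ ^ 2 * ((1 + cubicFactor L m γ δ ℓ * (1 / rate m γ + 1)) * C) *
        (momentAt xs (ℓ + 1) ν + δ * n * (d + ℓ - 1) ^ ((ℓ + 1) / 2))) := by
  have := hν.1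
  have hL := hP.L_pos
  have hδ := hP.δ_pos
  have hm := hP.m_pos
  have hγ := hP.γ_pos
  have hd1 : (1 : ℝ) ≤ d := by exact_mod_cast hd
  have hκ : 0 < rate m γ := by unfold rate; positivity
  set Q := (ℓ + 1) / 2 with hQ
  have hQ1 : 1 ≤ Q := by rw [hQ]; linarith
  have hQ0 : 0 < Q := by linarith
  have hpow : ∀ z : Phase d, ‖z‖ ^ (ℓ + 1) = (‖z‖ ^ 2) ^ Q := fun z => by
    rw [← Real.rpow_natCast, ← Real.rpow_mul (norm_nonneg _)]; congr 1; push_cast; rw [hQ]; ring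
  set Y := cubicFactor L m γ δ ℓ with hY
  have hY0 : 0 < Y := cubicFactor_pos hP ℓ
  set X := 4 * (K₁ L + 3) ^ 2 * momentConst L m γ δ ^ 2 with hX
  have hX0 : 0 ≤ X := by rw [hX]; positivity
  have hXY : X ^ Q = 2 * Y := rpow_eq_cubicFactor hP ℓ
  set Mℓ := momentAt xs (ℓ + 1) ν with hMℓ
  have hMℓ0 : 0 ≤ Mℓ := momentAt_nonneg _ _ _
  have hS := lyapS_pos hP
  have hM := lyapM_pos hL
  set D := ((d : ℝ) + ℓ - 1) ^ Q with hD
  have hD1 : 1 ≤ D := Real.one_le_rpow (by linarith) hQ0.le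
  have hmom : ∫⁻ z, ENNReal.ofReal ((‖z - mk xs 0‖ ^ 2) ^ Q) ∂ν = ENNReal.ofReal Mℓ := by
    have := lintegral_norm_sub_rpow (by linarith : 1 ≤ ℓ + 1) hν xs
    simpa only [hpow] using this
  have hconv : ∀ k, ∀ z : Phase d, ((d + 2 * Q) * lyapS L m +
      (1 - rate m γ * δ) ^ (2 * k) * (lyapM L * ‖z - mk xs 0‖ ^ 2)) ^ Q ≤
      17 / 10 * Y * D + 3 / 10 * Y * (1 - rate m γ * δ) ^ (2 * k) * (‖z - mk xs 0‖ ^ 2) ^ Q := by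
    intro k z
    have hr0 : 0 ≤ 1 - rate m γ * δ := by have := hP.rate_le_one; linarith
    have hr1 : 1 - rate m γ * δ ≤ 1 := by have := hP.rate_pos; linarith
    set ρ := (1 - rate m γ * δ) ^ (2 * k) with hρ
    have hρ0 : 0 ≤ ρ := pow_nonneg hr0 _
    have hρ1 : ρ ≤ 1 := pow_le_one₀ hr0 hr1
    set x := ‖z - mk xs 0‖ ^ 2 with hx
    have hx0 : 0 ≤ x := by positivity
    -- Convexity of the power separates the stationary from the initial part. The weight 17/20 on
    -- the first keeps its constant small: 0.51 · 1.7 = 0.867 < 1 at the end.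
    have h1 := (convexOn_rpow hQ1).2 (x := (d + 2 * Q) * lyapS L m / (17 / 20))
      (y := ρ * (lyapM L * x) / (3 / 20)) (by simp only [Set.mem_Ici]; positivity)
      (by simp only [Set.mem_Ici]; positivity) (by norm_num : (0 : ℝ) ≤ 17 / 20)
      (by norm_num : (0 : ℝ) ≤ 3 / 20) (by norm_num)
    simp only [smul_eq_mul] at h1
    rw [mul_div_cancel₀ ((d + 2 * Q) * lyapS L m) (by norm_num : (17 / 20 : ℝ) ≠ 0),
      mul_div_cancel₀ (ρ * (lyapM L * x)) (by norm_num : (3 / 20 : ℝ) ≠ 0)] at h1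
    refine h1.trans ?_
    have h2 : ((d + 2 * Q) * lyapS L m / (17 / 20)) ^ Q ≤ 2 * Y * D := by
      rw [← hXY, hD, ← Real.mul_rpow hX0 (by linarith)]
      refine Real.rpow_le_rpow (by positivity) ?_ hQ0.le
      have h3 := lyapS_le hP
      have h4 : (d + 2 * Q) * lyapS L m / (17 / 20) ≤
          (d + ℓ - 1) * (2 * lyapS L m / (17 / 20)) := by
        -- Here 2Q = ℓ + 1, and the inequality amounts to d + ℓ ≥ 3.
        have h6 : (d : ℝ) + 2 * Q ≤ 2 * (d + ℓ - 1) := by rw [hQ]; linarith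
        have h7 := mul_le_mul_of_nonneg_right h6 hS.le
        linarith
      have h5 := mul_le_mul_of_nonneg_left h3 (by linarith : 0 ≤ (d : ℝ) + ℓ - 1)
      linarith
    have h3 : (ρ * (lyapM L * x) / (3 / 20)) ^ Q ≤ 2 * Y * ρ * x ^ Q := by
      have h4 : ρ * (lyapM L * x) / (3 / 20) ≤ X * ρ * x := by
        have h5 := lyapM_le hL
        have h6 := momentConst_sq_ge hP
        have hm' : 0 < 1 / m := by positivity
        have h7 : lyapM L / (3 / 20) ≤ X := by
          rw [div_le_iff₀ (by norm_num), hX]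
          have := mul_le_mul_of_nonneg_left (by linarith : 1 ≤ momentConst L m γ δ ^ 2)
            (sq_nonneg (K₁ L + 3))
          linarith
        have h8 := mul_le_mul_of_nonneg_right h7 (mul_nonneg hρ0 hx0)
        refine le_trans (le_of_eq ?_) (h8.trans (le_of_eq ?_)) <;> ring
      refine (Real.rpow_le_rpow (by positivity) h4 hQ0.le).trans ?_
      rw [Real.mul_rpow (by positivity) hx0, Real.mul_rpow hX0 hρ0, hXY]
      -- Because ρ ≤ 1 and Q ≥ 1; this retains a geometric factor for the summation over time.
      have h9 : ρ ^ Q ≤ ρ := by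
        rcases hρ0.eq_or_lt with h | h
        · rw [← h, Real.zero_rpow hQ0.ne']
        · have := Real.rpow_le_rpow_of_exponent_ge h hρ1 hQ1
          rwa [Real.rpow_one] at this
      gcongr
    linarith
  have hterm : ∀ k, ∫⁻ z, ∫⁻ g, ENNReal.ofReal (δ ^ 3 * (51 / 100 * C) *
        (1 + ‖stepO γ δ z g - mk xs 0‖ ^ (ℓ + 1))) ∂stdGaussian (Pos d)
          ∂law (obaboKernel U γ δ) ν k ≤
      ENNReal.ofReal (δ ^ 3 * (51 / 100 * C) * (1 + (17 / 10 * Y * D +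
        3 / 10 * Y * (1 - rate m γ * δ) ^ (2 * k) * Mℓ))) := by
    intro k
    have hr : 0 ≤ (1 - rate m γ * δ) ^ (2 * k) := by rw [pow_mul]; positivity
    have h1 := lintegral_law_stepO_le hd hU hP hxs hQ0 ν k
    have h2 : ∀ (z : Phase d) (g : Pos d), ENNReal.ofReal (δ ^ 3 * (51 / 100 * C) *
        (1 + ‖stepO γ δ z g - mk xs 0‖ ^ (ℓ + 1))) = ENNReal.ofReal (δ ^ 3 * (51 / 100 * C)) *
        (1 + ENNReal.ofReal ((‖stepO γ δ z g - mk xs 0‖ ^ 2) ^ Q)) := fun z g => by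
      rw [hpow, ENNReal.ofReal_mul (by positivity), ENNReal.ofReal_add zero_le_one (by positivity),
        ENNReal.ofReal_one]
    simp only [h2]
    have h3 : ∀ z : Phase d, ∫⁻ g, ENNReal.ofReal (δ ^ 3 * (51 / 100 * C)) *
        (1 + ENNReal.ofReal ((‖stepO γ δ z g - mk xs 0‖ ^ 2) ^ Q)) ∂stdGaussian (Pos d) =
        ENNReal.ofReal (δ ^ 3 * (51 / 100 * C)) * (1 + ∫⁻ g,
          ENNReal.ofReal ((‖stepO γ δ z g - mk xs 0‖ ^ 2) ^ Q) ∂stdGaussian (Pos d)) := fun z => by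
      rw [lintegral_const_mul' _ _ ENNReal.ofReal_ne_top, lintegral_add_left measurable_const,
        lintegral_const, measure_univ, mul_one]
    simp only [h3]
    rw [lintegral_const_mul' _ _ ENNReal.ofReal_ne_top, lintegral_add_left measurable_const,
        lintegral_const, measure_univ, mul_one,
        ENNReal.ofReal_mul (p := δ ^ 3 * (51 / 100 * C)) (by positivity),
        ENNReal.ofReal_add zero_le_one (by positivity), ENNReal.ofReal_one]
    gcongr
    refine h1.trans ((lintegral_mono fun z => ENNReal.ofReal_le_ofReal (hconv k z)).trans
      (le_of_eq ?_))
    have h4 : ∀ z : Phase d, ENNReal.ofReal (17 / 10 * Y * D +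
        3 / 10 * Y * (1 - rate m γ * δ) ^ (2 * k) * (‖z - mk xs 0‖ ^ 2) ^ Q) =
        ENNReal.ofReal (17 / 10 * Y * D) + ENNReal.ofReal
          (3 / 10 * Y * (1 - rate m γ * δ) ^ (2 * k)) *
            ENNReal.ofReal ((‖z - mk xs 0‖ ^ 2) ^ Q) := by
      intro z
      rw [ENNReal.ofReal_add (by positivity) (by positivity), ← ENNReal.ofReal_mul (by positivity)]
    simp only [h4]
    rw [lintegral_add_left measurable_const, lintegral_const, measure_univ, mul_one,
      lintegral_const_mul' _ _ ENNReal.ofReal_ne_top, hmom,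
      ← ENNReal.ofReal_mul (by positivity), ← ENNReal.ofReal_add (by positivity) (by positivity)]
  refine (Finset.sum_le_sum fun k _ => hterm k).trans ?_
  rw [← ENNReal.ofReal_sum_of_nonneg fun k _ => by
    have hr : 0 ≤ (1 - rate m γ * δ) ^ (2 * k) := by rw [pow_mul]; positivity
    positivity]
  refine ENNReal.ofReal_le_ofReal ?_
  have hsum := sum_pow_le hP n
  have e1 : ∑ k ∈ Finset.range n, δ ^ 3 * (51 / 100 * C) * (1 + (17 / 10 * Y * D +
        3 / 10 * Y * (1 - rate m γ * δ) ^ (2 * k) * Mℓ)) = δ ^ 3 * (51 / 100 * C) *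
      (n * (1 + 17 / 10 * Y * D) + 3 / 10 * Y * Mℓ *
        ∑ k ∈ Finset.range n, (1 - rate m γ * δ) ^ (2 * k)) := by
    rw [← Finset.mul_sum, Finset.sum_add_distrib, Finset.sum_add_distrib, Finset.sum_const,
      Finset.sum_const, Finset.card_range, Finset.mul_sum, nsmul_eq_mul, nsmul_eq_mul]
    congr 1
    have : ∀ k, 3 / 10 * Y * (1 - rate m γ * δ) ^ (2 * k) * Mℓ =
      3 / 10 * Y * Mℓ * (1 - rate m γ * δ) ^ (2 * k) := fun k => by ring
    simp only [this]
    ring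
  rw [e1]
  have hκ' : 0 < 1 / rate m γ := by positivity
  have e2 : 3 / 10 * Y * Mℓ * ∑ k ∈ Finset.range n, (1 - rate m γ * δ) ^ (2 * k) ≤
      3 / 10 * Y * Mℓ * (1 / rate m γ * (1 / δ)) := by
    rw [← one_div_mul_one_div] at hsum
    exact mul_le_mul_of_nonneg_left hsum (by positivity)
  have e3 := mul_le_mul_of_nonneg_left (add_le_add_right e2 (n * (1 + 17 / 10 * Y * D)))
    (by positivity : 0 ≤ δ ^ 3 * (51 / 100 * C))
  refine e3.trans ?_
  have e4 : δ ^ 3 * (51 / 100 * C) * (n * (1 + 17 / 10 * Y * D) +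
      3 / 10 * Y * Mℓ * (1 / rate m γ * (1 / δ))) = δ ^ 2 * C * (δ * n * (51 / 100 * 1 +
        867 / 1000 * (Y * D)) + 153 / 1000 * (Y * (1 / rate m γ)) * Mℓ) := by
    field_simp; ring
  rw [e4, show δ ^ 2 * ((1 + Y * (1 / rate m γ + 1)) * C) * (Mℓ + δ * n * D) =
    δ ^ 2 * C * ((1 + Y * (1 / rate m γ + 1)) * (Mℓ + δ * n * D)) by ring]
  refine mul_le_mul_of_nonneg_left ?_ (by positivity)
  have i1 : 0 ≤ δ * n := by positivity
  have i2 : 0 ≤ Y * (1 / rate m γ) := by positivity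
  -- Since D ≥ 1, the isolated constant 51/100 fits into the summand 1 of `K_ten`, and 0.867 Y D
  -- into the summand Y.
  have i3 : 51 / 100 * 1 + 867 / 1000 * (Y * D) ≤ (1 + Y * (1 / rate m γ + 1)) * D := by
    have : 0 ≤ Y * (1 / rate m γ) * D := by positivity
    have : 0 ≤ Y * D := by positivity
    nlinarith
  have i4 := mul_le_mul_of_nonneg_left i3 i1
  have i5 : 153 / 1000 * (Y * (1 / rate m γ)) * Mℓ ≤ (1 + Y * (1 / rate m γ + 1)) * Mℓ :=
    mul_le_mul_of_nonneg_right (by nlinarith) hMℓ0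
  linarith

lemma sumRej_le_cubic (hd : 0 < d) (hU : Potential U L m) (hP : Params L m γ δ)
    (hxs : gradient U xs = 0) {ℓ Lℓ : ℝ} (hℓ : 2 ≤ ℓ) (hLℓ : 0 < Lℓ) (hH : HessPol U ℓ Lℓ xs)
    {ν : Measure (Phase d)} (hν : InP (ℓ + 1) ν) (n : ℕ) :
    sumRej U γ δ ν n ≤ ENNReal.ofReal (δ ^ 2 * K_ten L m γ δ ℓ Lℓ *
        (momentAt xs (ℓ + 1) ν + δ * n * (d + ℓ - 1) ^ ((ℓ + 1) / 2))) := by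
  have hL := hP.L_pos
  have hδ := hP.δ_pos
  have hC := cubicConst_pos (L := L) (δ := δ) hL hδ ℓ hLℓ
  rw [K_ten_eq]
  refine le_trans (Finset.sum_le_sum fun k _ => lintegral_mono fun z => lintegral_mono fun g => ?_)
    (sum_lintegral_cubic_le hd hU hP hxs hℓ hC hν n)
  exact ENNReal.ofReal_le_ofReal (one_sub_accept_le (by positivity)
    (energy_error_le_cubic hU.contDiff hL hU.gradLip hδ hP.δ_mul_L_sq hxs hℓ hLℓ hH _))

end Bounds

end Langevin
end

noncomputable section

namespace Langevin

open scoped NNReal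

/-! ### The easy half of the Kantorovich duality -/

section Duality

variable {d : ℕ} {μ ν : Measure (Phase d)}

lemma wasserstein_ne_top [IsProbabilityMeasure μ] [IsProbabilityMeasure ν]
    (hμ : Integrable (fun z => ‖z‖) μ) (hν : Integrable (fun z => ‖z‖) ν) :
    wasserstein μ ν ≠ ⊤ := by
  refine ne_top_of_le_ne_top ?_ (iInf_le _ ⟨μ.prod ν, by simp, by simp⟩)
  have h : ∫⁻ q, edist q.1 q.2 ∂μ.prod ν ≤ ∫⁻ q : Phase d × Phase d, (‖q.1‖ₑ + ‖q.2‖ₑ) ∂μ.prod ν :=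
    lintegral_mono fun q => by rw [edist_eq_enorm_sub]; exact enorm_sub_le
  refine ne_top_of_le_ne_top ?_ h
  rw [lintegral_add_left (by fun_prop), lintegral_prod _ (by fun_prop),
    lintegral_prod _ (by fun_prop)]
  simp only [lintegral_const, measure_univ, mul_one]
  have h1 := hμ.2
  have h2 := hν.2
  simp only [HasFiniteIntegral, enorm_norm] at h1 h2
  exact (ENNReal.add_lt_top.2 ⟨h1, h2⟩).ne

lemma abs_integral_sub_le_wasserstein [IsProbabilityMeasure μ] [IsProbabilityMeasure ν]
    (hμ : Integrable (fun z => ‖z‖) μ) (hν : Integrable (fun z => ‖z‖) ν) {f : Phase d → ℝ}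
    {K : ℝ≥0} (hf : LipschitzWith K f) :
    |∫ z, f z ∂μ - ∫ z, f z ∂ν| ≤ K * (wasserstein μ ν).toReal := by
  have hfμ := integrable_of_lipschitz_of_integrable_norm hf hμ
  have hfν := integrable_of_lipschitz_of_integrable_norm hf hν
  have key : ENNReal.ofReal |∫ z, f z ∂μ - ∫ z, f z ∂ν| ≤ K * wasserstein μ ν := by
    have : Nonempty {ρ : Measure (Phase d × Phase d) // ρ.fst = μ ∧ ρ.snd = ν} :=
      ⟨⟨μ.prod ν, by simp, by simp⟩⟩
    rw [wasserstein, ENNReal.mul_iInf fun h => absurd h ENNReal.coe_ne_top]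
    refine le_iInf fun ⟨ρ, h1, h2⟩ => ?_
    have i1 : Integrable (fun q : Phase d × Phase d => f q.1) ρ := by
      rw [← h1] at hfμ
      exact (integrable_map_measure hfμ.1 (by fun_prop)).1 hfμ
    have i2 : Integrable (fun q : Phase d × Phase d => f q.2) ρ := by
      rw [← h2] at hfν
      exact (integrable_map_measure hfν.1 (by fun_prop)).1 hfν
    have e1 : ∫ z, f z ∂μ = ∫ q, f q.1 ∂ρ := by
      rw [← h1, Measure.fst, integral_map (by fun_prop) hf.continuous.aestronglyMeasurable]
    have e2 : ∫ z, f z ∂ν = ∫ q, f q.2 ∂ρ := by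
      rw [← h2, Measure.snd, integral_map (by fun_prop) hf.continuous.aestronglyMeasurable]
    rw [e1, e2, ← integral_sub i1 i2, ← Real.enorm_eq_ofReal_abs]
    refine (enorm_integral_le_lintegral_enorm _).trans ?_
    rw [← lintegral_const_mul' _ _ ENNReal.coe_ne_top]
    refine lintegral_mono fun q => ?_
    rw [← edist_eq_enorm_sub]
    exact hf q.1 q.2
  have h := ENNReal.toReal_mono (ENNReal.mul_ne_top ENNReal.coe_ne_top
    (wasserstein_ne_top hμ hν)) key
  rwa [ENNReal.toReal_ofReal (abs_nonneg _), ENNReal.toReal_mul, ENNReal.coe_toReal] at h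

end Duality

/-! ### The Gibbs measure -/

section Gibbs

variable {d : ℕ} {U : Pos d → ℝ} {L m : ℝ}

lemma integrable_exp_neg_mul_norm_sq {E : Type*} [NormedAddCommGroup E] [InnerProductSpace ℝ E]
    [FiniteDimensional ℝ E] [MeasurableSpace E] [BorelSpace E] {b : ℝ} (hb : 0 < b) (c : E) :
    Integrable (fun v : E => Real.exp (-b * ‖v - c‖ ^ 2)) := by
  have h := GaussianFourier.integrable_cexp_neg_mul_sq_norm_add (V := E) (b := (b : ℂ))
    (by simpa using hb) 0 0
  have h2 : Integrable (fun v : E => Real.exp (-b * ‖v‖ ^ 2)) := by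
    have := h.re
    refine this.congr (ae_of_all _ fun v => ?_)
    simp only [zero_mul, add_zero]
    rw [show -(b : ℂ) * (‖v‖ : ℂ) ^ 2 = ((-b * ‖v‖ ^ 2 : ℝ) : ℂ) by push_cast; ring]
    exact Complex.exp_ofReal_re _
  exact h2.comp_sub_right c

lemma continuous_hamiltonian (hU : Continuous U) : Continuous (hamiltonian U) := by
  unfold hamiltonian; fun_prop

/-- Quadratic growth of H around its minimum gives a Gaussian majorant of the density. -/
lemma gibbs_spec (hU : Potential U L m) (hm : 0 < m) :
    IsProbabilityMeasure (gibbs U) ∧ Integrable (fun z => ‖z‖) (gibbs U) := by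
  obtain ⟨xs, -, hmin⟩ := exists_isMin hU.contDiff hm hU.strongConv
  -- Half of the growth rate is set aside: exp(-b|z - z⋆|²) ensures integrability while the other
  -- half absorbs the factor |z|.
  obtain ⟨b, hb, hbm, hb1⟩ : ∃ b : ℝ, 0 < b ∧ 2 * b ≤ m / 2 ∧ 2 * b ≤ 1 / 2 :=
    ⟨min (m / 4) (1 / 4), by positivity, by have := min_le_left (m / 4) (1 / 4); linarith,
      by have := min_le_right (m / 4) (1 / 4 : ℝ); linarith⟩
  have hc := continuous_hamiltonian hU.contDiff.continuous
  have hH : ∀ z : Phase d, U xs + 2 * b * ‖z - mk xs 0‖ ^ 2 ≤ hamiltonian U z := fun z => by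
    have h1 := hmin z.fst
    rw [norm_sub_mk_sq, hamiltonian]
    nlinarith [sq_nonneg ‖z.fst - xs‖, sq_nonneg ‖z.snd‖]
  have hbase := (integrable_exp_neg_mul_norm_sq hb (mk xs (0 : Pos d))).const_mul
    (Real.exp (-U xs))
  have hexp : ∀ z : Phase d, Real.exp (-hamiltonian U z) ≤
      Real.exp (-U xs) * Real.exp (-b * ‖z - mk xs 0‖ ^ 2) := fun z => by
    rw [← Real.exp_add]
    refine Real.exp_le_exp.2 ?_
    have := hH z
    nlinarith [mul_nonneg hb.le (sq_nonneg ‖z - mk xs 0‖)]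
  have hint : Integrable (fun z => Real.exp (-hamiltonian U z)) (volume : Measure (Phase d)) :=
    hbase.mono' (by fun_prop : Continuous fun z => Real.exp (-hamiltonian U z)).aestronglyMeasurable
      (ae_of_all _ fun z => by rw [Real.norm_of_nonneg (Real.exp_pos _).le]; exact hexp z)
  refine ⟨isProbabilityMeasure_tilted hint, ?_⟩
  rw [gibbs, integrable_tilted_iff hint]
  refine (hbase.const_mul (‖mk xs (0 : Pos d)‖ + 1 + 1 / b)).mono'
    (by fun_prop : Continuous fun z => Real.exp (-hamiltonian U z) • ‖z‖).aestronglyMeasurable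
    (ae_of_all _ fun z => ?_)
  rw [smul_eq_mul, Real.norm_of_nonneg (by positivity)]
  set t := ‖z - mk xs 0‖ with ht
  have h1 : ‖z‖ ≤ t + ‖mk xs (0 : Pos d)‖ := by
    have := norm_add_le (z - mk xs 0) (mk xs 0); rwa [sub_add_cancel] at this
  have h2 : t ≤ (1 + 1 / b) * Real.exp (b * t ^ 2) := by
    have h3 := Real.add_one_le_exp (b * t ^ 2)
    have h4 : t ≤ 1 + t ^ 2 := by nlinarith [sq_nonneg (t - 1)]
    have h5 : 1 / b * (b * t ^ 2) = t ^ 2 := by field_simp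
    have h6 : 0 < 1 / b := by positivity
    nlinarith [mul_le_mul_of_nonneg_left h3 h6.le, sq_nonneg t]
  have h3 : ‖z‖ ≤ (‖mk xs (0 : Pos d)‖ + 1 + 1 / b) * Real.exp (b * t ^ 2) := by
    have h4 : 1 ≤ Real.exp (b * t ^ 2) := Real.one_le_exp (by positivity)
    nlinarith [norm_nonneg (mk xs (0 : Pos d))]
  have h4 : Real.exp (-hamiltonian U z) ≤ Real.exp (-U xs) * Real.exp (-(2 * b) * t ^ 2) := by
    rw [← Real.exp_add]
    refine Real.exp_le_exp.2 ?_
    have := hH z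
    linarith
  have h5 := mul_le_mul h4 h3 (norm_nonneg _) (by positivity)
  refine h5.trans (le_of_eq ?_)
  have h6 : Real.exp (-(2 * b) * t ^ 2) * Real.exp (b * t ^ 2) = Real.exp (-b * t ^ 2) := by
    rw [← Real.exp_add]; congr 1; ring
  rw [← h6]
  ring

end Gibbs

/-! ### Exponential moments for one transition -/

section ExpMoment

variable {d : ℕ} {U : Pos d → ℝ} {L m γ δ c Λ : ℝ} {f : Phase d → ℝ}

lemma sqrt_quad_smul_snd (hc : 0 ≤ c) (a : ℝ) (g : Pos d) :
    √(quad γ c (mk 0 (a • g))) = √c * |a| * ‖g‖ := by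
  rw [quad_snd, Real.sqrt_mul hc, Real.sqrt_sq (norm_nonneg _), norm_smul, Real.norm_eq_abs,
    mul_assoc]

/-- Gaussian concentration is used twice, first in g', then for the mean over g' as a function of g.
The latter is Lipschitz with σ/η in place of σ, after g is moved into the starting point and the
contraction is applied. -/
lemma QuadLip.lintegral_exp_obaboKernel_le (hf : QuadLip γ c Λ f) (hd : 0 < d)
    (hU : Potential U L m) (hP : Params L m γ δ) (hc1 : 4 ≤ c * γ ^ 2) (hc2 : c * L ≤ 1)
    (hΛ : 0 ≤ Λ) (z : Phase d) :
    ∫⁻ w, ENNReal.ofReal (Real.exp (f w)) ∂obaboKernel U γ δ z ≤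
      ENNReal.ofReal (Real.exp (Langevin.transition U γ δ f z +
        26 / 10 * (Λ ^ 2 * (c * (δ * γ))))) := by
  have hγ := hP.γ_pos
  have hc := c_pos hc1
  have hη := eta_pos γ δ
  have hη2 : eta γ δ ^ 2 = Real.exp (-(δ * γ)) := by
    rw [eta, ← Real.exp_nat_mul]; congr 1; push_cast; ring
  have hη1 : 0 ≤ 1 - eta γ δ ^ 2 := by
    have := pow_le_one₀ (n := 2) hη.le hP.eta_le_one; linarith
  set σ := √(1 - eta γ δ ^ 2) with hσ
  have hσ0 : 0 ≤ σ := Real.sqrt_nonneg _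
  have hσ2 : σ ^ 2 = 1 - eta γ δ ^ 2 := Real.sq_sqrt hη1
  have hr : 0 ≤ 1 - rate m γ * δ := by have := hP.rate_le_one; linarith
  have hr1 : 1 - rate m γ * δ ≤ 1 := by have := hP.rate_pos; linarith
  have hfc := (hf.lipschitzWith hγ hc1 hΛ).continuous
  set G := stdGaussian (Pos d) with hG
  -- Lipschitz in the second Gaussian variable
  have hin : ∀ g, LipschitzWith (Real.toNNReal (Λ * (√c * σ)))
      (fun g' => f (obaboStep U γ δ z g g')) := fun g => by
    refine LipschitzWith.of_dist_le_mul fun g₁ g₂ => ?_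
    rw [Real.dist_eq, Real.coe_toNNReal _ (by positivity), dist_eq_norm, mul_assoc]
    refine (hf _ _).trans (mul_le_mul_of_nonneg_left (le_of_eq ?_) hΛ)
    rw [obaboStep_eq z g g₁, obaboStep_eq z g g₂, add_sub_add_left_eq_sub]
    have : mk (0 : Pos d) (σ • g₁) - mk 0 (σ • g₂) = mk 0 (σ • (g₁ - g₂)) := by
      apply phase_ext <;> simp [smul_sub]
    rw [this, sqrt_quad_smul_snd hc.le, abs_of_nonneg hσ0]
  have hn : Integrable (fun x : Pos d => ‖x‖) G := (IsGaussian.integrable_id (μ := G)).norm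
  have hini : ∀ g, Integrable (fun g' => f (obaboStep U γ δ z g g')) G := fun g =>
    integrable_of_lipschitz_of_integrable_norm (hin g) hn
  set F : Pos d → ℝ := fun g => ∫ g', f (obaboStep U γ δ z g g') ∂G with hF
  have hout : LipschitzWith (Real.toNNReal (Λ * (√c * (σ / eta γ δ)))) F := by
    refine LipschitzWith.of_dist_le_mul fun g₁ g₂ => ?_
    rw [Real.dist_eq, Real.coe_toNNReal _ (by positivity), dist_eq_norm, hF,
      ← integral_sub (hini g₁) (hini g₂)]
    refine abs_integral_le_integral_abs.trans ?_
    have : ∫ _ : Pos d, Λ * (√c * (σ / eta γ δ)) * ‖g₁ - g₂‖ ∂G =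
        Λ * (√c * (σ / eta γ δ)) * ‖g₁ - g₂‖ := by
      rw [integral_const, probReal_univ, one_smul]
    rw [← this]
    refine integral_mono ((hini g₁).sub (hini g₂)).abs (integrable_const _) fun g' => ?_
    refine (hf _ _).trans ?_
    rw [mul_assoc]
    refine mul_le_mul_of_nonneg_left ?_ hΛ
    rw [obaboStep_eq z g₁ g', obaboStep_eq z g₂ g', add_sub_add_right_eq_sub]
    refine (Real.sqrt_le_sqrt (quad_obaboStep_sub_le hU hP hc1 hc2 _ _ 0 0)).trans ?_
    rw [Real.sqrt_mul (sq_nonneg _), Real.sqrt_sq hr, add_sub_add_left_eq_sub]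
    have : mk (0 : Pos d) ((σ / eta γ δ) • g₁) - mk 0 ((σ / eta γ δ) • g₂) =
        mk 0 ((σ / eta γ δ) • (g₁ - g₂)) := by
      apply phase_ext <;> simp [smul_sub]
    rw [this, sqrt_quad_smul_snd hc.le, abs_of_nonneg (by positivity)]
    exact mul_le_of_le_one_left (by positivity) hr1
  have htr : Langevin.transition U γ δ f z = ∫ g, F g ∂G := by
    have hm := measurable_obaboStep_right (U := U) (γ := γ) (δ := δ) z
    have h := hf.integrable_obaboKernel hd hU hP hc1 hΛ z
    rw [obaboKernel_apply, integrable_map_measure hfc.aestronglyMeasurable hm.aemeasurable] at h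
    simp only [Function.comp_def] at h
    rw [transition_eq hfc.measurable, integral_prod _ h]
  rw [lintegral_obaboKernel z (hfc.measurable.exp.ennreal_ofReal)]
  have e1 : ∀ g, ∫⁻ g', ENNReal.ofReal (Real.exp (f (obaboStep U γ δ z g g'))) ∂G ≤
      ENNReal.ofReal (Real.exp (Real.pi ^ 2 / 8 * (Λ * (√c * σ)) ^ 2)) *
        ENNReal.ofReal (Real.exp (F g)) := fun g => by
    refine (lintegral_exp_le_of_lipschitz (hin g)).trans (le_of_eq ?_)
    rw [← ENNReal.ofReal_mul (Real.exp_pos _).le, ← Real.exp_add,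
      Real.coe_toNNReal _ (by positivity), add_comm]
  refine (lintegral_mono e1).trans ?_
  rw [lintegral_const_mul' _ _ ENNReal.ofReal_ne_top]
  refine (mul_le_mul_right (lintegral_exp_le_of_lipschitz hout) _).trans ?_
  rw [← ENNReal.ofReal_mul (Real.exp_pos _).le, ← Real.exp_add,
      Real.coe_toNNReal _ (by positivity), ← htr]
  refine ENNReal.ofReal_le_ofReal (Real.exp_le_exp.2 ?_)
  have hρ := hP.exp_bounds.1
  have hh := hP.h_le
  have hh0 := hP.h_pos
  rw [← hη2] at hρ
  have hcσ : √c ^ 2 = c := Real.sq_sqrt hc.le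
  have hη20 : 0 < eta γ δ ^ 2 := by positivity
  have k1 : (Λ * (√c * σ)) ^ 2 ≤ Λ ^ 2 * (c * (δ * γ)) := by
    rw [mul_pow, mul_pow, hcσ, hσ2]
    gcongr
    linarith
  have k2 : (Λ * (√c * (σ / eta γ δ))) ^ 2 ≤ Λ ^ 2 * (c * (δ * γ)) * (101 / 100) := by
    rw [mul_pow, mul_pow, hcσ, div_pow, hσ2, mul_assoc, mul_assoc]
    have : (1 - eta γ δ ^ 2) / eta γ δ ^ 2 ≤ δ * γ * (101 / 100) := by
      rw [div_le_iff₀ hη20]; nlinarith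
    gcongr
  -- The two variances add up to at most 2.01 δγ; together with π²/8 < 1.25 this stays below 2.6.
  have hpi : Real.pi ^ 2 / 8 ≤ 1592 / 1000 * (785 / 1000) := by
    have := Real.pi_lt_d2
    nlinarith [Real.pi_pos]
  have k0 : 0 ≤ Λ ^ 2 * (c * (δ * γ)) := by positivity
  have hpi0 : 0 ≤ Real.pi ^ 2 / 8 := by positivity
  have k3 := mul_le_mul hpi (add_le_add k1 k2) (by positivity) (by norm_num)
  nlinarith

end ExpMoment

end Langevin
end

noncomputable section

namespace Langevin

/-! ### Comparison of the two kernels -/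

section Comparison

variable {d : ℕ} {U : Pos d → ℝ} {γ δ : ℝ}

/-- For equal g and g' the two steps differ only when w exceeds the acceptance probability, an event
of probability 1 - α. There h is at most 1, which is why truncated functions are used later. -/
lemma lintegral_ombaboKernel_le (hU : Measurable U) (z : Phase d) {h : Phase d → ℝ≥0∞}
    (hm : Measurable h) (h1 : ∀ w, h w ≤ 1) :
    ∫⁻ w, h w ∂ombaboKernel U γ δ z ≤ ∫⁻ w, h w ∂obaboKernel U γ δ z + rej U γ δ z := by
  have hmeas := measurable_ombaboStep hU γ δ
  have hmz : Measurable fun q : (Pos d × Pos d) × ℝ =>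
      ombaboStep U γ δ z q.1.1 q.1.2 q.2 := by
    have h := hmeas.comp (measurable_prodMk_left (x := z))
    simpa only [Function.comp_def] using h
  set ν : Measure ℝ := volume.restrict (Set.Icc (0 : ℝ) 1) with hν
  have hνp : IsProbabilityMeasure ν := ⟨by simp [hν]⟩
  have e : ombaboKernel U γ δ z = (((stdGaussian (Pos d)).prod (stdGaussian (Pos d))).prod ν).map
      (fun q => ombaboStep U γ δ z q.1.1 q.1.2 q.2) := by
    rw [ombaboKernel, Kernel.map_apply _ hmeas, Kernel.prod_apply, Kernel.id_apply,
      Kernel.const_apply, Measure.dirac_prod, Measure.map_map hmeas measurable_prodMk_left]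
    rfl
  have hcomp := hm.comp hmz
  simp only [Function.comp_def] at hcomp
  rw [e, lintegral_map hm hmz, lintegral_prod _ hcomp.aemeasurable,
    lintegral_prod _ hcomp.lintegral_prod_right'.aemeasurable, lintegral_obaboKernel z hm, rej]
  have key : ∀ g g' : Pos d, ∫⁻ w, h (ombaboStep U γ δ z g g' w) ∂ν ≤
      h (obaboStep U γ δ z g g') + ENNReal.ofReal (1 - accept U δ (stepO γ δ z g)) := by
    intro g g'
    set α := accept U δ (stepO γ δ z g) with hα
    have h2 : ∀ w, h (ombaboStep U γ δ z g g' w) ≤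
        h (obaboStep U γ δ z g g') + (Set.Ioi α).indicator 1 w := by
      intro w
      by_cases hw : w ≤ α
      · have : ombaboStep U γ δ z g g' w = obaboStep U γ δ z g g' := by
          rw [ombaboStep, adjustedVerlet, if_pos hw, obaboStep]
        rw [this]
        exact le_self_add
      · rw [Set.indicator_of_mem (Set.mem_Ioi.2 (not_le.1 hw))]
        exact (h1 _).trans le_add_self
    refine (lintegral_mono h2).trans ?_
    rw [lintegral_add_left measurable_const, lintegral_const, measure_univ, mul_one,
      lintegral_indicator_one measurableSet_Ioi, hν, Measure.restrict_apply measurableSet_Ioi]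
    refine add_le_add le_rfl ?_
    rw [← Real.volume_Ioc]
    exact measure_mono fun w hw => ⟨hw.1, hw.2.2⟩
  have hob : Measurable fun q : Pos d × Pos d => h (obaboStep U γ δ z q.1 q.2) := by
    have := hm.comp (measurable_obaboStep_right (U := U) (γ := γ) (δ := δ) z)
    simpa only [Function.comp_def] using this
  rw [← lintegral_add_left hob.lintegral_prod_right']
  refine lintegral_mono fun g => ?_
  refine (lintegral_mono (key g)).trans (le_of_eq ?_)
  rw [lintegral_add_right _ measurable_const, lintegral_const, measure_univ, mul_one]

/-- The expected number of rejections before time `n`, as a function of the initial state. -/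
def rejFrom (U : Pos d → ℝ) (γ δ : ℝ) : ℕ → Phase d → ℝ≥0∞
  | 0, _ => 0
  | n + 1, z => rej U γ δ z + ∫⁻ w, rejFrom U γ δ n w ∂obaboKernel U γ δ z

lemma measurable_rejFrom (hU : Measurable U) (n : ℕ) : Measurable (rejFrom U γ δ n) := by
  induction n with
  | zero => exact measurable_const
  | succ n ih => exact (measurable_rej hU).add ih.lintegral_kernel

lemma law_succ' {S : Type*} [MeasurableSpace S] (κ : Kernel S S) (ν : Measure S) (k : ℕ) :
    law κ ν (k + 1) = law κ (ν.bind κ) k := by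
  induction k with
  | zero => rfl
  | succ k ih => rw [law_succ, ih, law_succ]

lemma lintegral_rejFrom (hU : Measurable U) (ν : Measure (Phase d)) (n : ℕ) :
    ∫⁻ z, rejFrom U γ δ n z ∂ν = sumRej U γ δ ν n := by
  induction n generalizing ν with
  | zero => simp [rejFrom, sumRej]
  | succ n ih =>
    simp only [rejFrom]
    rw [lintegral_add_left (measurable_rej hU), ← Measure.lintegral_bind
      (obaboKernel U γ δ).measurable.aemeasurable (measurable_rejFrom hU n).aemeasurable, ih,
      sumRej, sumRej, Finset.sum_range_succ', law_zero, add_comm]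
    simp only [law_succ']

/-- Every summand is at most 1 without any moment assumption, so the error is genuinely real-valued
for all initial laws. -/
lemma sumRej_ne_top (ν : Measure (Phase d)) [IsProbabilityMeasure ν] (n : ℕ) :
    sumRej U γ δ ν n ≠ ⊤ := by
  refine (ENNReal.sum_lt_top.2 fun k _ => ?_).ne
  refine lt_of_le_of_lt (lintegral_mono fun z => rej_le_one z) ?_
  simp

end Comparison

/-! ### Additive functionals of a Markov chain -/

/-- G j z s is a value function with j steps to go from state z and accumulated sum s; a one-step
supermartingale inequality is iterated backwards in time. -/
lemma IsMarkovChain.lintegral_sum_le {S Ω : Type*} [MeasurableSpace S] [MeasurableSpace Ω]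
    {κ : Kernel S S} [IsMarkovKernel κ] {μ₀ : Measure S} {Pr : Measure Ω} [IsProbabilityMeasure Pr]
    {Z : ℕ → Ω → S} (hZ : IsMarkovChain κ μ₀ Pr Z) {φ : S → ℝ} (hφ : Measurable φ)
    {G : ℕ → S → ℝ → ℝ≥0∞} (hG : ∀ j, Measurable (Function.uncurry (G j)))
    (hstep : ∀ j z s, ∫⁻ w, G j w (s + φ w) ∂κ z ≤ G (j + 1) z s) (n : ℕ) :
    ∫⁻ ω, G 0 (Z n ω) (∑ i ∈ Finset.range n, φ (Z (i + 1) ω)) ∂Pr ≤ ∫⁻ z, G n z 0 ∂μ₀ := by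
  suffices h : ∀ k j, ∫⁻ ω, G j (Z k ω) (∑ i ∈ Finset.range k, φ (Z (i + 1) ω)) ∂Pr ≤
      ∫⁻ z, G (j + k) z 0 ∂μ₀ by simpa using h n 0
  intro k
  induction k with
  | zero =>
    intro j
    have hm : Measurable fun z => G (j + 0) z 0 :=
      (hG _).comp (measurable_id.prodMk measurable_const)
    rw [← hZ.initial, lintegral_map hm (hZ.measurable 0)]
    simp
  | succ k ih =>
    intro j
    have hh : Measurable fun ω => (fun i : Fin (k + 1) => Z i ω) :=
      measurable_pi_lambda _ fun i => hZ.measurable i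
    -- The sum starts at time 1, so the initial entry of the history is skipped.
    obtain ⟨s, hs⟩ : ∃ s : (Fin (k + 1) → S) → ℝ, s = fun h => ∑ i : Fin k, φ (h i.succ) :=
      ⟨_, rfl⟩
    have hsm : Measurable s := by
      rw [hs]
      exact Finset.measurable_fun_sum _ fun i _ => hφ.comp (measurable_pi_apply _)
    have hsZ : ∀ ω, s (fun i : Fin (k + 1) => Z i ω) =
        ∑ i ∈ Finset.range k, φ (Z (i + 1) ω) := fun ω => by
      rw [hs, ← Fin.sum_univ_eq_sum_range (fun i => φ (Z (i + 1) ω)) k]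
      simp
    have hF : Measurable fun p : (Fin (k + 1) → S) × S => G j p.2 (s p.1 + φ p.2) :=
      (hG j).comp (measurable_snd.prodMk ((hsm.comp measurable_fst).add
        (hφ.comp measurable_snd)))
    have e1 : ∫⁻ ω, G j (Z (k + 1) ω) (∑ i ∈ Finset.range (k + 1), φ (Z (i + 1) ω)) ∂Pr =
        ∫⁻ p, G j p.2 (s p.1 + φ p.2)
          ∂Pr.map (fun ω => ((fun i : Fin (k + 1) => Z i ω), Z (k + 1) ω)) := by
      rw [lintegral_map hF (hh.prodMk (hZ.measurable _))]
      refine lintegral_congr fun ω => ?_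
      rw [Finset.sum_range_succ, hsZ]
    have : IsProbabilityMeasure (Pr.map fun ω => (fun i : Fin (k + 1) => Z i ω)) :=
      Measure.isProbabilityMeasure_map hh.aemeasurable
    rw [e1, hZ.step k, Measure.lintegral_compProd hF]
    have hG1 : Measurable fun h : Fin (k + 1) → S => G (j + 1) (h (Fin.last k)) (s h) :=
      (hG (j + 1)).comp ((measurable_pi_apply _).prodMk hsm)
    calc _ ≤ ∫⁻ h, G (j + 1) (h (Fin.last k)) (s h)
          ∂Pr.map fun ω => (fun i : Fin (k + 1) => Z i ω) :=
          lintegral_mono fun h => hstep j (h (Fin.last k)) (s h)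
      _ = ∫⁻ ω, G (j + 1) (Z k ω) (∑ i ∈ Finset.range k, φ (Z (i + 1) ω)) ∂Pr := by
          rw [lintegral_map hG1 hh]
          refine lintegral_congr fun ω => ?_
          rw [hsZ]
          simp
      _ ≤ _ := by
          refine (ih (j + 1)).trans (le_of_eq ?_)
          rw [add_right_comm, add_assoc]

end Langevin
end

noncomputable section

namespace Langevin

open scoped NNReal

/-! ### Concentration of ergodic averages -/

section Value

variable {d : ℕ} {U : Pos d → ℝ} {L m γ δ c Λ : ℝ} {φ : Phase d → ℝ}

/-- The mean `z ↦ 𝔼_z (∑_{1 ≤ k ≤ j} φ(Z_k))` for the unadjusted chain. -/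
def meanSum (U : Pos d → ℝ) (γ δ : ℝ) (φ : Phase d → ℝ) : ℕ → Phase d → ℝ
  | 0, _ => 0
  | j + 1, z => transition U γ δ (fun w => φ w + meanSum U γ δ φ j w) z

lemma QuadLip.add {f g : Phase d → ℝ} {Λ' : ℝ} (hf : QuadLip γ c Λ f) (hg : QuadLip γ c Λ' g) :
    QuadLip γ c (Λ + Λ') (fun z => f z + g z) := fun z w => by
  have := hf z w
  have := hg z w
  rw [add_sub_add_comm, add_mul]
  exact (abs_add_le _ _).trans (by linarith)

lemma QuadLip.mono {f : Phase d → ℝ} {Λ' : ℝ} (hf : QuadLip γ c Λ f) (h : Λ ≤ Λ') :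
    QuadLip γ c Λ' f := fun z w =>
  (hf z w).trans (mul_le_mul_of_nonneg_right h (Real.sqrt_nonneg _))

lemma QuadLip.const_mul {f : Phase d → ℝ} (hf : QuadLip γ c Λ f) (a : ℝ) :
    QuadLip γ c (|a| * Λ) (fun z => a * f z) := fun z w => by
  rw [← mul_sub, abs_mul, mul_assoc]
  exact mul_le_mul_of_nonneg_left (hf z w) (abs_nonneg a)

/-- The constant is the fixed point of the recursion Λ_(j+1) = (1 - κδ)(Λ + Λ_j), hence does not
grow with j. -/
lemma quadLip_meanSum (hφ : QuadLip γ c Λ φ) (hd : 0 < d) (hU : Potential U L m)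
    (hP : Params L m γ δ) (hc1 : 4 ≤ c * γ ^ 2) (hc2 : c * L ≤ 1) (hΛ : 0 ≤ Λ) (j : ℕ) :
    QuadLip γ c ((1 - rate m γ * δ) * (Λ / (rate m γ * δ))) (meanSum U γ δ φ j) := by
  have hr : 0 ≤ 1 - rate m γ * δ := by have := hP.rate_le_one; linarith
  have hκ := hP.rate_pos
  induction j with
  | zero =>
    intro z w
    simp only [meanSum, sub_zero, abs_zero]
    positivity
  | succ j ih =>
    have h := hφ.add ih
    have e : Λ + (1 - rate m γ * δ) * (Λ / (rate m γ * δ)) = Λ / (rate m γ * δ) := by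
      have := hκ.ne'
      generalize rate m γ * δ = k at *
      field_simp; ring
    rw [e] at h
    exact h.transition hd hU hP hc1 hc2 (by positivity)

lemma quadLip_add_meanSum (hφ : QuadLip γ c Λ φ) (hd : 0 < d) (hU : Potential U L m)
    (hP : Params L m γ δ) (hc1 : 4 ≤ c * γ ^ 2) (hc2 : c * L ≤ 1) (hΛ : 0 ≤ Λ) (j : ℕ) :
    QuadLip γ c (Λ / (rate m γ * δ)) (fun w => φ w + meanSum U γ δ φ j w) := by
  have hκ := hP.rate_pos
  have h := hφ.add (quadLip_meanSum hφ hd hU hP hc1 hc2 hΛ j)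
  have e : Λ + (1 - rate m γ * δ) * (Λ / (rate m γ * δ)) = Λ / (rate m γ * δ) := by
    have := hκ.ne'
    generalize rate m γ * δ = k at *
    field_simp; ring
  rwa [e] at h

/-- One step of the exponential supermartingale. -/
lemma lintegral_exp_meanSum_le (hφ : QuadLip γ c Λ φ) (hd : 0 < d) (hU : Potential U L m)
    (hP : Params L m γ δ) (hc1 : 4 ≤ c * γ ^ 2) (hc2 : c * L ≤ 1) (hΛ : 0 ≤ Λ) (l a s : ℝ) (j : ℕ)
    (z : Phase d) :
    ∫⁻ w, ENNReal.ofReal (Real.exp (l * (s + φ w + meanSum U γ δ φ j w - a) +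
        j * (26 / 10 * (l ^ 2 * ((Λ / (rate m γ * δ)) ^ 2 * (c * (δ * γ)))))))
          ∂obaboKernel U γ δ z ≤
      ENNReal.ofReal (Real.exp (l * (s + meanSum U γ δ φ (j + 1) z - a) +
        (j + 1 : ℕ) * (26 / 10 * (l ^ 2 * ((Λ / (rate m γ * δ)) ^ 2 * (c * (δ * γ))))))) := by
  have hκ := hP.rate_pos
  have hq := (quadLip_add_meanSum hφ hd hU hP hc1 hc2 hΛ j).const_mul l
  set V := 26 / 10 * (l ^ 2 * ((Λ / (rate m γ * δ)) ^ 2 * (c * (δ * γ)))) with hV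
  have h := hq.lintegral_exp_obaboKernel_le hd hU hP hc1 hc2 (by positivity) z
  have e1 : transition U γ δ (fun w => l * (φ w + meanSum U γ δ φ j w)) z =
      l * meanSum U γ δ φ (j + 1) z := by
    rw [transition, integral_const_mul]; rfl
  rw [e1] at h
  have e2 : ∀ w, ENNReal.ofReal (Real.exp (l * (s + φ w + meanSum U γ δ φ j w - a) + j * V)) =
      ENNReal.ofReal (Real.exp (l * (s - a) + j * V)) *
        ENNReal.ofReal (Real.exp (l * (φ w + meanSum U γ δ φ j w))) := fun w => by
    rw [← ENNReal.ofReal_mul (Real.exp_pos _).le, ← Real.exp_add]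
    congr 2; ring
  simp only [e2]
  rw [lintegral_const_mul' _ _ ENNReal.ofReal_ne_top]
  refine (mul_le_mul_right h _).trans (le_of_eq ?_)
  rw [← ENNReal.ofReal_mul (Real.exp_pos _).le, ← Real.exp_add]
  congr 2
  rw [hV, mul_pow, sq_abs]
  push_cast
  ring

lemma measurable_meanSum (hφ : QuadLip γ c Λ φ) (hd : 0 < d) (hU : Potential U L m)
    (hP : Params L m γ δ) (hc1 : 4 ≤ c * γ ^ 2) (hc2 : c * L ≤ 1) (hΛ : 0 ≤ Λ) (j : ℕ) :
    Measurable (meanSum U γ δ φ j) := by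
  have hr : 0 ≤ 1 - rate m γ * δ := by have := hP.rate_le_one; linarith
  have hκ := hP.rate_pos
  exact ((quadLip_meanSum hφ hd hU hP hc1 hc2 hΛ j).lipschitzWith hP.γ_pos hc1
    (by positivity)).continuous.measurable

/-- The tail of an additive functional of the adjusted chain, before optimisation. -/
lemma measure_tail_le (hφ : QuadLip γ c Λ φ) (hφm : Measurable φ) (hd : 0 < d)
    (hU : Potential U L m) (hP : Params L m γ δ) (hc1 : 4 ≤ c * γ ^ 2) (hc2 : c * L ≤ 1)
    (hΛ : 0 ≤ Λ) {μ₀ : Measure (Phase d)} {Ω : Type*} [MeasurableSpace Ω] {Pr : Measure Ω}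
    [IsProbabilityMeasure Pr] {Z : ℕ → Ω → Phase d}
    (hZ : IsMarkovChain (ombaboKernel U γ δ) μ₀ Pr Z) (n : ℕ) {l : ℝ} (hl : 0 ≤ l) (a b : ℝ) :
    Pr {ω | a ≤ ∑ i ∈ Finset.range n, φ (Z (i + 1) ω) ∨
        ∑ i ∈ Finset.range n, φ (Z (i + 1) ω) ≤ b} ≤
      ∫⁻ z, ENNReal.ofReal (Real.exp (l * (meanSum U γ δ φ n z - a) +
        n * (26 / 10 * (l ^ 2 * ((Λ / (rate m γ * δ)) ^ 2 * (c * (δ * γ))))))) ∂μ₀ +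
      ∫⁻ z, ENNReal.ofReal (Real.exp (-l * (meanSum U γ δ φ n z - b) +
        n * (26 / 10 * (l ^ 2 * ((Λ / (rate m γ * δ)) ^ 2 * (c * (δ * γ))))))) ∂μ₀ +
      sumRej U γ δ μ₀ n := by
  have hUm : Measurable U := hU.contDiff.continuous.measurable
  have : IsMarkovKernel (ombaboKernel U γ δ) := isMarkovKernel_ombaboKernel hUm γ δ
  set V := 26 / 10 * (l ^ 2 * ((Λ / (rate m γ * δ)) ^ 2 * (c * (δ * γ)))) with hV
  have hψ := fun j => measurable_meanSum hφ hd hU hP hc1 hc2 hΛ j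
  obtain ⟨E, hE⟩ : ∃ E : ℝ → ℝ → ℕ → Phase d → ℝ → ℝ≥0∞, ∀ l a j z s, E l a j z s =
      ENNReal.ofReal (Real.exp (l * (s + meanSum U γ δ φ j z - a) + j * V)) :=
    ⟨_, fun _ _ _ _ _ => rfl⟩
  have hEm : ∀ l a j, Measurable (Function.uncurry (E l a j)) := fun l a j => by
    have : Measurable fun p : Phase d × ℝ =>
        ENNReal.ofReal (Real.exp (l * (p.2 + meanSum U γ δ φ j p.1 - a) + j * V)) :=
      (((((measurable_snd.add ((hψ j).comp measurable_fst)).sub_const a).const_mul l).add_const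
        _).exp).ennreal_ofReal
    rw [show Function.uncurry (E l a j) = _ from funext fun p => hE l a j p.1 p.2]
    exact this
  have hEstep : ∀ l', l' ^ 2 = l ^ 2 → ∀ a j z s, ∫⁻ w, E l' a j w (s + φ w)
      ∂obaboKernel U γ δ z ≤ E l' a (j + 1) z s := fun l' hl' a j z s => by
    have h := lintegral_exp_meanSum_le hφ hd hU hP hc1 hc2 hΛ l' a s j z
    rw [hl', ← hV] at h
    simp only [hE]
    exact h
  -- The sum of both exponential supermartingales and the expected future rejections. The cap at 1
  -- makes it admissible for the comparison of the two kernels, each step of which adds one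
  -- rejection probability.
  obtain ⟨G, hG⟩ : ∃ G : ℕ → Phase d → ℝ → ℝ≥0∞, ∀ j z s, G j z s =
      min 1 (E l a j z s + E (-l) b j z s + rejFrom U γ δ j z) := ⟨_, fun _ _ _ => rfl⟩
  have hGm : ∀ j, Measurable (Function.uncurry (G j)) := fun j => by
    have : Measurable fun p : Phase d × ℝ => min 1 (Function.uncurry (E l a j) p +
        Function.uncurry (E (-l) b j) p + rejFrom U γ δ j p.1) :=
      measurable_const.min (((hEm l a j).add (hEm (-l) b j)).add
        ((measurable_rejFrom hUm j).comp measurable_fst))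
    rw [show Function.uncurry (G j) = _ from funext fun p => hG j p.1 p.2]
    exact this
  have hGstep : ∀ j z s, ∫⁻ w, G j w (s + φ w) ∂ombaboKernel U γ δ z ≤ G (j + 1) z s := by
    intro j z s
    have hm : Measurable fun w => G j w (s + φ w) :=
      (hGm j).comp (measurable_id.prodMk (hφm.const_add s))
    have hEs : ∀ l a, Measurable fun w => E l a j w (s + φ w) := fun l a =>
      (hEm l a j).comp (measurable_id.prodMk (hφm.const_add s))
    have h1 : ∀ w, G j w (s + φ w) ≤ 1 := fun w => by rw [hG]; exact min_le_left _ _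
    rw [hG (j + 1)]
    refine le_min ((lintegral_mono h1).trans (by simp)) ?_
    refine (lintegral_ombaboKernel_le hUm z hm h1).trans ?_
    have h2 : ∫⁻ w, G j w (s + φ w) ∂obaboKernel U γ δ z ≤
        ∫⁻ w, E l a j w (s + φ w) ∂obaboKernel U γ δ z +
          ∫⁻ w, E (-l) b j w (s + φ w) ∂obaboKernel U γ δ z +
            ∫⁻ w, rejFrom U γ δ j w ∂obaboKernel U γ δ z := by
      have hEE : Measurable fun w => E l a j w (s + φ w) + E (-l) b j w (s + φ w) :=
        (hEs l a).add (hEs (-l) b)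
      rw [← lintegral_add_left (hEs l a), ← lintegral_add_left hEE]
      refine lintegral_mono fun w => ?_
      rw [hG]
      exact min_le_right _ _
    refine (add_le_add_left h2 _).trans ?_
    rw [add_assoc]
    refine add_le_add (add_le_add (hEstep l rfl a j z s) (hEstep (-l) (neg_sq l) b j z s)) ?_
    rw [rejFrom, add_comm]
  have hmain := hZ.lintegral_sum_le hφm hGm hGstep n
  have hmeasB : Measurable fun ω => ∑ i ∈ Finset.range n, φ (Z (i + 1) ω) :=
    Finset.measurable_fun_sum _ fun i _ => hφm.comp (hZ.measurable _)
  have hB : MeasurableSet {ω | a ≤ ∑ i ∈ Finset.range n, φ (Z (i + 1) ω) ∨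
        ∑ i ∈ Finset.range n, φ (Z (i + 1) ω) ≤ b} :=
    (measurableSet_le measurable_const hmeasB).union (measurableSet_le hmeasB measurable_const)
  calc _ = ∫⁻ ω, Set.indicator {ω | a ≤ ∑ i ∈ Finset.range n, φ (Z (i + 1) ω) ∨
        ∑ i ∈ Finset.range n, φ (Z (i + 1) ω) ≤ b} 1 ω ∂Pr := (lintegral_indicator_one hB).symm
    _ ≤ ∫⁻ ω, G 0 (Z n ω) (∑ i ∈ Finset.range n, φ (Z (i + 1) ω)) ∂Pr := by
        refine lintegral_mono fun ω => ?_
        by_cases hω : ω ∈ {ω | a ≤ ∑ i ∈ Finset.range n, φ (Z (i + 1) ω) ∨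
            ∑ i ∈ Finset.range n, φ (Z (i + 1) ω) ≤ b}
        -- With no step to go the conditional mean vanishes, and on either half of the event the
        -- corresponding exponent is nonnegative.
        · rw [Set.indicator_of_mem hω, hG, hE, hE]
          refine le_min le_rfl ?_
          have h0 : ∀ {x : ℝ}, 0 ≤ x → (1 : ℝ≥0∞) ≤ ENNReal.ofReal (Real.exp x) := fun hx => by
            rw [← ENNReal.ofReal_one]
            exact ENNReal.ofReal_le_ofReal (Real.one_le_exp hx)
          rcases hω with h | h
          · refine (h0 ?_).trans (le_add_right le_self_add)
            simp only [meanSum, Nat.cast_zero, zero_mul, add_zero]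
            exact mul_nonneg hl (sub_nonneg.2 h)
          · refine (h0 ?_).trans (le_add_right le_add_self)
            simp only [meanSum, Nat.cast_zero, zero_mul, add_zero]
            nlinarith [mul_nonneg hl (sub_nonneg.2 h)]
        · rw [Set.indicator_of_notMem hω]
          exact zero_le
    _ ≤ ∫⁻ z, G n z 0 ∂μ₀ := hmain
    _ ≤ ∫⁻ z, (E l a n z 0 + E (-l) b n z 0 + rejFrom U γ δ n z) ∂μ₀ := by
        refine lintegral_mono fun z => ?_
        rw [hG]
        exact min_le_right _ _
    _ = _ := by
        have hE0 : ∀ l a, Measurable fun w => E l a n w 0 := fun l a =>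
          (hEm l a n).comp (measurable_id.prodMk measurable_const)
        have hEE : Measurable fun w => E l a n w 0 + E (-l) b n w 0 := (hE0 l a).add (hE0 (-l) b)
        rw [lintegral_add_left hEE, lintegral_add_left (hE0 l a),
          lintegral_rejFrom hUm]
        simp only [hE, zero_add]

end Value

end Langevin
end

/-! ### The tail bound for ergodic averages: constants, bias and optimisation. -/

noncomputable section

namespace Langevin

open scoped NNReal

section Concentration

variable {d : ℕ} {U : Pos d → ℝ} {L m γ δ c Λ : ℝ} {φ : Phase d → ℝ}

/-- Each application of the operator preserves the integral under an invariant law, so every step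
adds the same mean of φ. -/
lemma integral_meanSum (hφ : QuadLip γ c Λ φ) (hd : 0 < d) (hU : Potential U L m)
    (hP : Params L m γ δ) (hc1 : 4 ≤ c * γ ^ 2) (hc2 : c * L ≤ 1) (hΛ : 0 ≤ Λ)
    {π : Measure (Phase d)} [IsProbabilityMeasure π] (hπ : (obaboKernel U γ δ).Invariant π)
    (hn : Integrable (fun z => ‖z‖) π) (n : ℕ) :
    ∫ z, meanSum U γ δ φ n z ∂π = n * ∫ z, φ z ∂π := by
  have hr : 0 ≤ 1 - rate m γ * δ := by have := hP.rate_le_one; linarith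
  have hκ := hP.rate_pos
  have hφi := integrable_of_lipschitz_of_integrable_norm (hφ.lipschitzWith hP.γ_pos hc1 hΛ) hn
  induction n with
  | zero => simp [meanSum]
  | succ n ih =>
    have hi := integrable_of_lipschitz_of_integrable_norm
      ((quadLip_meanSum hφ hd hU hP hc1 hc2 hΛ n).lipschitzWith hP.γ_pos hc1 (by positivity)) hn
    have h := integral_bind_of_integrable (obaboKernel U γ δ) π
      (f := fun w => φ w + meanSum U γ δ φ n w) (by rw [hπ]; exact hφi.add hi)
    rw [hπ, integral_add hφi hi, ih] at h
    simp only [meanSum, transition]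
    rw [← h]
    push_cast
    ring

lemma K₁_sq_eq (hL : 0 < L) : K₁ L ^ 2 = 3 * max L (1 / L) := by
  rw [K₁, mul_pow, Real.sq_sqrt (by norm_num)]
  congr 1
  rcases le_total 1 L with h | h
  · have h1 : 1 ≤ √L := Real.one_le_sqrt.2 h
    have h2 : 1 / √L ≤ 1 := by rw [div_le_one (by positivity)]; exact h1
    have h3 : 1 / L ≤ 1 := by rw [div_le_one hL]; exact h
    rw [max_eq_left (h2.trans h1), max_eq_left (h3.trans h), Real.sq_sqrt hL.le]
  · have h0 : 0 < √L := Real.sqrt_pos.2 hL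
    have h1 : √L ≤ 1 := Real.sqrt_le_one.2 h
    have h2 : 1 ≤ 1 / √L := (one_le_div h0).2 h1
    have h3 : 1 ≤ 1 / L := (one_le_div hL).2 h
    rw [max_eq_right (h1.trans h2), max_eq_right (h.trans h3), div_pow, one_pow,
      Real.sq_sqrt hL.le]

lemma max_one_mul_max_one (hL : 0 < L) : max 1 L * max 1 (1 / L) = max L (1 / L) := by
  rcases le_total 1 L with h | h
  · have h3 : 1 / L ≤ 1 := by rw [div_le_one hL]; exact h
    rw [max_eq_right h, max_eq_left h3, max_eq_left (h3.trans h), mul_one]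
  · have h3 : 1 ≤ 1 / L := (one_le_div hL).2 h
    rw [max_eq_left h, max_eq_right h3, max_eq_right (h.trans h3), one_mul]

/-- The Euclidean Lipschitz constant of the mean of an additive functional. -/
lemma lipschitzWith_meanSum (hd : 0 < d) (hU : Potential U L m) (hP : Params L m γ δ)
    (hφ : QuadLip γ (1 / L) (√(2 * max 1 L)) φ) (n : ℕ) :
    LipschitzWith (K₁ L / (rate m γ * δ)).toNNReal (meanSum U γ δ φ n) := by
  have hL := hP.L_pos
  have hκ := hP.rate_pos
  have hK := K₁_nonneg L
  have hc1 : 4 ≤ 1 / L * γ ^ 2 := by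
    rw [one_div, inv_mul_eq_div, le_div_iff₀ hL]; exact hP.γ_sq
  have hc2 : 1 / L * L ≤ 1 := by rw [one_div_mul_cancel hL.ne']
  have h := quadLip_meanSum hφ hd hU hP hc1 hc2 (Real.sqrt_nonneg _) n
  refine LipschitzWith.of_dist_le_mul fun z w => ?_
  rw [Real.dist_eq, Real.coe_toNNReal _ (by positivity), dist_eq_norm]
  have h1 : (1 - rate m γ * δ) * (√(2 * max 1 L) / (rate m γ * δ)) ≤
      √(2 * max 1 L) / (rate m γ * δ) :=
    mul_le_of_le_one_left (by positivity) (by linarith)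
  refine (h.mono h1 z w).trans ?_
  rw [div_mul_eq_mul_div, div_mul_eq_mul_div]
  refine div_le_div_of_nonneg_right ?_ hκ.le
  -- The factors √(2 max(1, L)) and √(3/2 · max(1, 1/L)) from the two norm comparisons multiply to
  -- K₁.
  have hq := (quad_bounds hP.γ_pos hc1 (z - w)).2.1
  have hq2 : quad γ (1 / L) (z - w) ≤ 3 / 2 * max 1 (1 / L) * ‖z - w‖ ^ 2 := by
    have e : ‖z - w‖ ^ 2 = ‖(z - w).fst‖ ^ 2 + ‖(z - w).snd‖ ^ 2 := norm_sq_phase _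
    rw [e]
    have a1 := mul_le_mul_of_nonneg_right (le_max_left 1 (1 / L)) (sq_nonneg ‖(z - w).fst‖)
    have a2 := mul_le_mul_of_nonneg_right (le_max_right 1 (1 / L)) (sq_nonneg ‖(z - w).snd‖)
    linarith
  rw [← Real.sqrt_mul (by positivity)]
  refine Real.sqrt_le_iff.2 ⟨by positivity, ?_⟩
  rw [mul_pow, K₁_sq_eq hL, ← max_one_mul_max_one hL]
  have := mul_le_mul_of_nonneg_left hq2 (by positivity : 0 ≤ 2 * max 1 L)
  linarith

/-- The comparison of the variance proxy with the constant `ClS`. -/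
lemma variance_le_ClS (hP : Params L m γ δ) :
    26 / 10 * ((√(2 * max 1 L) / (rate m γ * δ)) ^ 2 * (1 / L * (δ * γ))) ≤
      ClS L m γ δ / (rate m γ * δ) := by
  have hL := hP.L_pos
  have hκ := hP.rate_pos
  have hm := hP.m_pos
  have hγ := hP.γ_pos
  have hδ := hP.δ_pos
  rw [div_pow, Real.sq_sqrt (by positivity)]
  have e1 : max 1 L * (1 / L) ≤ max L (1 / L) := by
    rw [← max_one_mul_max_one hL]
    exact mul_le_mul_of_nonneg_left (le_max_right _ _) (by positivity)
  have e2 : 18 * max L (1 / L) * γ ^ 2 / m ≤ ClS L m γ δ := by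
    have h1 : 1 ≤ (1 + δ + δ ^ 2 * L / 2) ^ 2 := by
      have : 0 ≤ δ + δ ^ 2 * L / 2 := by positivity
      nlinarith
    rw [ClS, K₁_sq_eq hL]
    calc 18 * max L (1 / L) * γ ^ 2 / m = 6 / m * (3 * max L (1 / L)) * γ ^ 2 * 1 := by ring
      _ ≤ _ := mul_le_mul_of_nonneg_left h1 (by positivity)
  have e3 : γ / (rate m γ) = 3 * γ ^ 2 / m := by rw [rate]; field_simp
  have hr : 0 < rate m γ := by rw [rate]; positivity
  rw [le_div_iff₀ hκ]
  -- Here 2 · 2.6 = 5.2, and γ/κ = 3γ²/m turns it into 15.6, below the 6 · 3 = 18 contained in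
  -- `ClS`.
  calc _ = 52 / 10 * (max 1 L * (1 / L)) * (γ / rate m γ) := by field_simp; ring
    _ ≤ 52 / 10 * max L (1 / L) * (γ / rate m γ) := by gcongr
    _ = 156 / 10 * max L (1 / L) * γ ^ 2 / m := by rw [e3]; ring
    _ ≤ 18 * max L (1 / L) * γ ^ 2 / m := by gcongr; norm_num
    _ ≤ _ := e2

/-- The optimisation over the exponential parameter. -/
lemma exists_chernoff {x B B' : ℝ} (hx : 0 ≤ x) (hB : 0 < B) (hB' : B' ≤ B) :
    ∃ l, 0 ≤ l ∧ -(l * x) + l ^ 2 * B' ≤ -(x ^ 2 / (4 * B)) := by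
  refine ⟨x / (2 * B), by positivity, ?_⟩
  have h := mul_le_mul_of_nonneg_left hB' (sq_nonneg (x / (2 * B)))
  have e : -(x / (2 * B) * x) + (x / (2 * B)) ^ 2 * B = -(x ^ 2 / (4 * B)) := by
    field_simp; ring
  linarith

/-- Serves both tails, with l equal to l₀ or -l₀; the initial law contributes C'K²/4 to the
variance. -/
lemma lintegral_exp_chernoff {μ₀ : Measure (Phase d)} [IsProbabilityMeasure μ₀] {C' : ℝ}
    (hC' : 0 < C') (hμ : LogSobolev μ₀ C') {ψ : Phase d → ℝ} {K : ℝ≥0} (hK : LipschitzWith K ψ)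
    {l l₀ a x V : ℝ} (hl : l ^ 2 = l₀ ^ 2) (h : l * (∫ z, ψ z ∂μ₀ - a) ≤ -(l₀ * x)) :
    ∫⁻ z, ENNReal.ofReal (Real.exp (l * (ψ z - a) + l₀ ^ 2 * V)) ∂μ₀ ≤
      ENNReal.ofReal (Real.exp (-(l₀ * x) + l₀ ^ 2 * (V + C' * K ^ 2 / 4))) := by
  have hl2 : LipschitzWith (‖l‖₊ * K) fun z => l * ψ z :=
    (LipschitzWith.of_dist_le_mul fun s t => by
      rw [dist_eq_norm, dist_eq_norm, ← mul_sub, norm_mul]; rfl :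
        LipschitzWith ‖l‖₊ fun s : ℝ => l * s).comp hK
  have h1 := hμ.lintegral_exp_le hC'.le hl2
  have e : ∀ z, ENNReal.ofReal (Real.exp (l * (ψ z - a) + l₀ ^ 2 * V)) =
      ENNReal.ofReal (Real.exp (-(l * a) + l₀ ^ 2 * V)) * ENNReal.ofReal (Real.exp (l * ψ z)) :=
    fun z => by
      rw [← ENNReal.ofReal_mul (Real.exp_pos _).le, ← Real.exp_add]
      congr 2; ring
  simp only [e]
  rw [lintegral_const_mul' _ _ ENNReal.ofReal_ne_top]
  refine (mul_le_mul_right h1 _).trans ?_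
  rw [← ENNReal.ofReal_mul (Real.exp_pos _).le, ← Real.exp_add]
  refine ENNReal.ofReal_le_ofReal (Real.exp_le_exp.2 ?_)
  rw [integral_const_mul, NNReal.coe_mul, coe_nnnorm, Real.norm_eq_abs, mul_pow, sq_abs, hl]
  linarith

/-- Concentration of the ergodic averages of the adjusted chain. -/
theorem concentration (hd : 0 < d) (hU : Potential U L m) (hP : Params L m γ δ)
    {πδ : Measure (Phase d)} [IsProbabilityMeasure πδ] (hπ : (obaboKernel U γ δ).Invariant πδ)
    {μ₀ : Measure (Phase d)} [IsProbabilityMeasure μ₀] {C' : ℝ} (hC' : 0 < C')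
    (hμ : LogSobolev μ₀ C') {Ω : Type*} [MeasurableSpace Ω] {Pr : Measure Ω}
    [IsProbabilityMeasure Pr] {Z : ℕ → Ω → Phase d}
    (hZ : IsMarkovChain (ombaboKernel U γ δ) μ₀ Pr Z) (hφ : LipschitzWith 1 φ) {n : ℕ} {r : ℝ}
    (hn : 1 ≤ n) (hr : 0 ≤ r) :
    Pr.real {ω | r + 2 * K₁ L / (n * rate m γ * δ) * (wasserstein μ₀ πδ).toReal +
          (wasserstein (gibbs U) πδ).toReal ≤
        |(∑ k ∈ Finset.Icc 1 n, φ (Z k ω)) / n - ∫ z, φ z ∂gibbs U|} ≤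
      2 * Real.exp (-(n * r ^ 2 * rate m γ * δ /
        (4 * ClS L m γ δ + 4 * K₁ L ^ 2 * C' / (n * rate m γ * δ)))) +
          (sumRej U γ δ μ₀ n).toReal := by
  have hL := hP.L_pos
  have hκ := hP.rate_pos
  have hm := hP.m_pos
  have hγ := hP.γ_pos
  have hδ := hP.δ_pos
  have hK := K₁_nonneg L
  have hn0 : (0 : ℝ) < n := by exact_mod_cast hn
  have hc1 : 4 ≤ 1 / L * γ ^ 2 := by
    rw [one_div, inv_mul_eq_div, le_div_iff₀ hL]; exact hP.γ_sq
  have hc2 : 1 / L * L ≤ 1 := by rw [one_div_mul_cancel hL.ne']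
  have hq : QuadLip γ (1 / L) (√(2 * max 1 L)) φ := by
    have := quadLip_of_lipschitzWith hγ hc1 hφ
    simpa using this
  obtain ⟨hgp, hgn⟩ := gibbs_spec hU hm
  have hμn := hμ.integrable_norm hC'.le
  have hπn : Integrable (fun z => ‖z‖) πδ := by
    simpa using (InP_of_invariant hd hU hP hπ le_rfl).2
  set ψ := meanSum U γ δ φ n with hψ
  set K := (K₁ L / (rate m γ * δ)).toNNReal with hKdef
  have hKv : (K : ℝ) = K₁ L / (rate m γ * δ) := Real.coe_toNNReal _ (by positivity)
  have hψL : LipschitzWith K ψ := lipschitzWith_meanSum hd hU hP hq n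
  set W := (wasserstein μ₀ πδ).toReal with hW
  set W' := (wasserstein (gibbs U) πδ).toReal with hW'
  set p := ∫ z, φ z ∂gibbs U with hp
  have hW0 : 0 ≤ W := ENNReal.toReal_nonneg
  -- From the initial law to the invariant one by the Lipschitz constant of ψ, where the mean is n
  -- π_δ(φ), then from π_δ to π.
  have hbias : |∫ z, ψ z ∂μ₀ - n * p| ≤ K₁ L / (rate m γ * δ) * W + n * W' := by
    have h1 := abs_integral_sub_le_wasserstein hμn hπn hψL
    rw [integral_meanSum hq hd hU hP hc1 hc2 (Real.sqrt_nonneg _) hπ hπn, hKv] at h1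
    have h2 := abs_integral_sub_le_wasserstein hgn hπn hφ
    rw [NNReal.coe_one, one_mul] at h2
    rw [abs_le] at h1 h2 ⊢
    have h3 := mul_le_mul_of_nonneg_left h2.1 hn0.le
    have h4 := mul_le_mul_of_nonneg_left h2.2 hn0.le
    constructor <;> linarith [h1.1, h1.2]
  set R := r + 2 * K₁ L / (n * rate m γ * δ) * W + W' with hR
  -- The threshold contains twice the initial bias term; one copy is enough here.
  have hnR : n * R = n * r + 2 * (K₁ L / (rate m γ * δ) * W) + n * W' := by
    rw [hR]
    have : rate m γ ≠ 0 := fun h => by rw [h, zero_mul] at hκ; exact lt_irrefl _ hκ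
    field_simp
  have hKW : 0 ≤ K₁ L / (rate m γ * δ) * W := by positivity
  have hsum : ∀ ω, ∑ k ∈ Finset.Icc 1 n, φ (Z k ω) = ∑ i ∈ Finset.range n, φ (Z (i + 1) ω) :=
    fun ω => by
      rw [Finset.range_eq_Ico, Finset.sum_Ico_add' (fun k => φ (Z k ω)) 0 n 1]
      rfl
  have hsub : {ω | R ≤ |(∑ k ∈ Finset.Icc 1 n, φ (Z k ω)) / n - p|} ⊆
      {ω | n * (p + R) ≤ ∑ i ∈ Finset.range n, φ (Z (i + 1) ω) ∨
        ∑ i ∈ Finset.range n, φ (Z (i + 1) ω) ≤ n * (p - R)} := fun ω hω => by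
    simp only [Set.mem_ofPred_eq, hsum] at hω ⊢
    rcases le_abs.1 hω with h | h
    · left
      rw [← le_div_iff₀' hn0]; linarith
    · right
      rw [← div_le_iff₀' hn0]; linarith
  set V := 26 / 10 * ((√(2 * max 1 L) / (rate m γ * δ)) ^ 2 * (1 / L * (δ * γ))) with hV
  have hVle := variance_le_ClS hP
  rw [← hV] at hVle
  have hC : 0 < ClS L m γ δ := by
    have : 0 < K₁ L ^ 2 := by rw [K₁_sq_eq hL]; positivity
    rw [ClS]; positivity
  have hB' : n * V + C' * (K : ℝ) ^ 2 / 4 ≤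
      (n * ClS L m γ δ + K₁ L ^ 2 * C' / (rate m γ * δ)) / (rate m γ * δ) := by
    rw [hKv, add_div]
    have h1 := mul_le_mul_of_nonneg_left hVle hn0.le
    have h2 : 0 ≤ C' * (K₁ L / (rate m γ * δ)) ^ 2 := by positivity
    have h3 : K₁ L ^ 2 * C' / (rate m γ * δ) / (rate m γ * δ) =
      C' * (K₁ L / (rate m γ * δ)) ^ 2 := by rw [div_pow]; field_simp
    rw [h3, mul_div_assoc (n : ℝ)]
    linarith
  -- The parameter is optimal for the larger variance in the statement, and it remains valid for the
  -- actual one.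
  obtain ⟨l, hl, hle⟩ := exists_chernoff (x := n * r) (by positivity) (by positivity) hB'
  have hexp : -((n * r) ^ 2 / (4 * ((n * ClS L m γ δ + K₁ L ^ 2 * C' / (rate m γ * δ)) /
      (rate m γ * δ)))) = -(n * r ^ 2 * rate m γ * δ /
        (4 * ClS L m γ δ + 4 * K₁ L ^ 2 * C' / (n * rate m γ * δ))) := by
    rw [mul_assoc (n : ℝ) (rate m γ) δ, mul_assoc (n * r ^ 2) (rate m γ) δ]
    generalize rate m γ * δ = k at *
    generalize ClS L m γ δ = D at *
    have : 0 < n * D + K₁ L ^ 2 * C' / k := by positivity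
    have e : 4 * D + 4 * K₁ L ^ 2 * C' / (n * k) = 4 * (n * D + K₁ L ^ 2 * C' / k) / n := by
      field_simp
    rw [e]
    generalize n * D + K₁ L ^ 2 * C' / k = Y at *
    field_simp
  rw [hexp] at hle
  set X := Real.exp (-(n * r ^ 2 * rate m γ * δ /
        (4 * ClS L m γ δ + 4 * K₁ L ^ 2 * C' / (n * rate m γ * δ)))) with hX
  have htail := measure_tail_le hq hφ.continuous.measurable hd hU hP hc1 hc2
    (Real.sqrt_nonneg _) hZ n hl (n * (p + R)) (n * (p - R))
  have eV : (n : ℝ) * (26 / 10 * (l ^ 2 * ((√(2 * max 1 L) / (rate m γ * δ)) ^ 2 *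
      (1 / L * (δ * γ))))) = l ^ 2 * (n * V) := by rw [hV]; ring
  rw [eV, ← hψ] at htail
  rw [abs_le] at hbias
  have hu1 := lintegral_exp_chernoff hC' hμ hψL (l := l) (l₀ := l) (a := n * (p + R))
    (x := n * r) (V := n * V) rfl (by
      rw [← mul_neg]
      refine mul_le_mul_of_nonneg_left ?_ hl
      linarith [hbias.2])
  have hu2 := lintegral_exp_chernoff hC' hμ hψL (l := -l) (l₀ := l) (a := n * (p - R))
    (x := n * r) (V := n * V) (neg_sq l) (by
      rw [neg_mul, neg_le_neg_iff]
      refine mul_le_mul_of_nonneg_left ?_ hl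
      linarith [hbias.1])
  have hfin : Pr {ω | R ≤ |(∑ k ∈ Finset.Icc 1 n, φ (Z k ω)) / n - p|} ≤
      ENNReal.ofReal (2 * X + (sumRej U γ δ μ₀ n).toReal) := by
    refine (measure_mono hsub).trans (htail.trans ?_)
    have hX0 : 0 ≤ X := (Real.exp_pos _).le
    rw [ENNReal.ofReal_add (by positivity) ENNReal.toReal_nonneg,
      ENNReal.ofReal_toReal (sumRej_ne_top μ₀ n), two_mul, ENNReal.ofReal_add hX0 hX0]
    have hle' := ENNReal.ofReal_le_ofReal (Real.exp_le_exp.2 hle)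
    exact add_le_add_left (add_le_add (hu1.trans hle') (hu2.trans hle')) _
  exact ENNReal.toReal_le_of_le_ofReal (by positivity) hfin

end Concentration

end Langevin
end

noncomputable section

namespace Langevin

/-! ### Separable potentials -/

section Coordinates

variable {d : ℕ} {Q : Pos d ≃ₗᵢ[ℝ] Pos d} {i : Fin d}

/-- The `i`-th coordinate of `Q⁻¹ x`, as a point of the one-dimensional Euclidean space. -/
def coord (Q : Pos d ≃ₗᵢ[ℝ] Pos d) (i : Fin d) : Pos d →L[ℝ] Pos 1 :=
  (ContinuousLinearMap.toSpanSingleton ℝ (EuclideanSpace.single (0 : Fin 1) (1 : ℝ))).comp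
    ((EuclideanSpace.proj i : Pos d →L[ℝ] ℝ).comp (Q.symm : Pos d →L[ℝ] Pos d))

lemma coord_apply_zero (x : Pos d) : coord Q i x 0 = Q.symm x i := by
  simp [coord]

lemma norm_pos_one (y : Pos 1) : ‖y‖ = |y 0| := by
  rw [EuclideanSpace.norm_eq, Fin.sum_univ_one, Real.sqrt_sq_eq_abs, Real.norm_eq_abs, abs_abs]

lemma inner_pos_one (y w : Pos 1) : inner ℝ y w = y 0 * w 0 := by
  rw [PiLp.inner_apply, Fin.sum_univ_one, real_inner_comm]
  rfl

lemma inner_map_single (x : Pos d) (t : ℝ) :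
    inner ℝ x (Q (EuclideanSpace.single i t)) = t * Q.symm x i := by
  rw [← Q.symm.inner_map_map, Q.symm_apply_apply, EuclideanSpace.inner_single_right]
  simp

lemma norm_sq_eq_sum_coord (x : Pos d) : ‖x‖ ^ 2 = ∑ i, ‖coord Q i x‖ ^ 2 := by
  rw [← Q.symm.norm_map, EuclideanSpace.norm_sq_eq]
  simp only [norm_pos_one, coord_apply_zero, Real.norm_eq_abs]

lemma norm_coord_le (x : Pos d) : ‖coord Q i x‖ ≤ ‖x‖ := by
  rw [← abs_of_nonneg (norm_nonneg (coord Q i x)), ← abs_of_nonneg (norm_nonneg x), ← sq_le_sq,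
    norm_sq_eq_sum_coord (Q := Q) x]
  exact Finset.single_le_sum (f := fun j => ‖coord Q j x‖ ^ 2) (fun _ _ => sq_nonneg _)
    (Finset.mem_univ i)

lemma coord_ext_zero {y w : Pos 1} (h : y 0 = w 0) : y = w := by
  ext j
  rw [Subsingleton.elim j 0, h]

/-- The coordinate of a standard Gaussian vector is a standard Gaussian variable. -/
lemma map_coord_stdGaussian :
    (stdGaussian (Pos d)).map (coord Q i) = stdGaussian (Pos 1) := by
  have : IsProbabilityMeasure ((stdGaussian (Pos d)).map (coord Q i)) :=
    Measure.isProbabilityMeasure_map (coord Q i).continuous.measurable.aemeasurable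
  refine Measure.ext_of_charFun (funext fun t => ?_)
  have h1 : charFun ((stdGaussian (Pos d)).map (coord Q i)) t =
      charFun (stdGaussian (Pos d)) (Q (EuclideanSpace.single i (t 0))) := by
    rw [charFun_apply, charFun_apply,
      integral_map (coord Q i).continuous.measurable.aemeasurable (by fun_prop)]
    refine integral_congr_ae (ae_of_all _ fun x => ?_)
    simp only [inner_pos_one, inner_map_single, coord_apply_zero, mul_comm]
  rw [h1, charFun_stdGaussian, charFun_stdGaussian, Q.norm_map, PiLp.norm_single,
    norm_pos_one, Real.norm_eq_abs]

/-- The `i`-th coordinates of position and velocity. -/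
def phaseCoord (Q : Pos d ≃ₗᵢ[ℝ] Pos d) (i : Fin d) (z : Phase d) : Phase 1 :=
  mk (coord Q i z.fst) (coord Q i z.snd)

lemma measurable_phaseCoord : Measurable (phaseCoord Q i) := by
  have := (coord Q i).continuous.measurable
  unfold phaseCoord mk; fun_prop

lemma norm_phaseCoord_le (z : Phase d) : ‖phaseCoord Q i z‖ ≤ ‖z‖ := by
  rw [← abs_of_nonneg (norm_nonneg (phaseCoord Q i z)), ← abs_of_nonneg (norm_nonneg z), ← sq_le_sq,
    norm_sq_phase, norm_sq_phase]
  exact add_le_add (pow_le_pow_left₀ (norm_nonneg _) (norm_coord_le _) 2)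
    (pow_le_pow_left₀ (norm_nonneg _) (norm_coord_le _) 2)

lemma phaseCoord_stepO (γ δ : ℝ) (z : Phase d) (g : Pos d) :
    phaseCoord Q i (stepO γ δ z g) = stepO γ δ (phaseCoord Q i z) (coord Q i g) := by
  simp [phaseCoord, stepO]

lemma InP.map_phaseCoord {p : ℝ} (hp : 0 ≤ p) {ν : Measure (Phase d)} (hν : InP p ν) :
    InP p (ν.map (phaseCoord Q i)) := by
  have := hν.1
  refine ⟨Measure.isProbabilityMeasure_map measurable_phaseCoord.aemeasurable, ?_⟩
  have hm : Measurable fun z : Phase 1 => ‖z‖ ^ p := by fun_prop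
  rw [integrable_map_measure hm.aestronglyMeasurable measurable_phaseCoord.aemeasurable]
  refine hν.2.mono' (hm.comp measurable_phaseCoord).aestronglyMeasurable (ae_of_all _ fun z => ?_)
  simp only [Function.comp_def]
  rw [Real.norm_of_nonneg (by positivity)]
  exact Real.rpow_le_rpow (norm_nonneg _) (norm_phaseCoord_le z) hp

lemma momentAt_map_phaseCoord (c : Pos d) (p : ℝ) (ν : Measure (Phase d)) :
    momentAt (coord Q i c) p (ν.map (phaseCoord Q i)) = coordMoment Q c i p ν := by
  have hm : Measurable fun z : Phase 1 => ‖z - mk (coord Q i c) 0‖ ^ p := by fun_prop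
  rw [momentAt, coordMoment, integral_map measurable_phaseCoord.aemeasurable
    hm.aestronglyMeasurable]
  refine integral_congr_ae (ae_of_all _ fun z => ?_)
  simp only
  congr 1
  rw [← Real.sqrt_sq (norm_nonneg _), norm_sub_mk_sq, norm_pos_one, norm_pos_one, sq_abs, sq_abs]
  simp [phaseCoord, coord_apply_zero]

end Coordinates

section OneDimensional

variable {f : ℝ → ℝ} {ℓ Lℓ : ℝ}

/-- A function of one real variable, as a potential on the one-dimensional Euclidean space. -/
def onLine (f : ℝ → ℝ) (y : Pos 1) : ℝ := f (y 0)

lemma gradient_onLine (hf : ContDiff ℝ 2 f) (y : Pos 1) : gradient (onLine f) y 0 = deriv f (y 0) := by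
  have h1 : HasFDerivAt (onLine f) (deriv f (y 0) • (EuclideanSpace.proj (0 : Fin 1) : Pos 1 →L[ℝ] ℝ)) y :=
    ((hf.differentiable (by norm_num)) (y 0)).hasDerivAt.comp_hasFDerivAt y
      (EuclideanSpace.proj (0 : Fin 1) : Pos 1 →L[ℝ] ℝ).hasFDerivAt
  have h2 : inner ℝ (gradient (onLine f) y) (EuclideanSpace.single (0 : Fin 1) (1 : ℝ)) =
      deriv f (y 0) := by
    rw [gradient, InnerProductSpace.toDual_symm_apply, h1.fderiv]
    simp
  rw [inner_pos_one] at h2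
  simpa using h2

/-- The derivative of the gradient is multiplication by f'' on a line, so its operator norm is an
absolute value. -/
lemma hessPol_onLine (hf : ContDiff ℝ 2 f) (c : Pos 1) (h : ∀ s t : ℝ,
    |deriv (deriv f) t - deriv (deriv f) s| ≤
      Lℓ * |s - t| * (2 + |s - c 0| ^ (ℓ - 2) + |t - c 0| ^ (ℓ - 2)) / 4) :
    HessPol (onLine f) ℓ Lℓ c := by
  have hd : Differentiable ℝ (deriv f) :=
    ((contDiff_succ_iff_deriv (n := 1)).1 hf).2.2.differentiable (by norm_num)
  have hg : gradient (onLine f) = fun y => deriv f (y 0) • EuclideanSpace.single (0 : Fin 1) (1 : ℝ) := by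
    funext y
    exact coord_ext_zero (by simp [gradient_onLine hf])
  have hfd : ∀ y : Pos 1, HasFDerivAt (gradient (onLine f))
      ((deriv (deriv f) (y 0) • (EuclideanSpace.proj (0 : Fin 1) : Pos 1 →L[ℝ] ℝ)).smulRight
        (EuclideanSpace.single (0 : Fin 1) (1 : ℝ))) y := fun y => by
    rw [hg]
    have h0 : HasDerivAt (deriv f) (deriv (deriv f) (y 0))
        ((EuclideanSpace.proj (0 : Fin 1) : Pos 1 →L[ℝ] ℝ) y) := (hd (y 0)).hasDerivAt
    have h1 : HasFDerivAt (deriv f ∘ fun y : Pos 1 => y 0)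
        (deriv (deriv f) (y 0) • (EuclideanSpace.proj (0 : Fin 1) : Pos 1 →L[ℝ] ℝ)) y :=
      h0.comp_hasFDerivAt y (EuclideanSpace.proj (0 : Fin 1) : Pos 1 →L[ℝ] ℝ).hasFDerivAt
    exact h1.smul_const _
  intro x y
  have h' := h (x 0) (y 0)
  rw [norm_pos_one, norm_pos_one, norm_pos_one]
  refine le_trans ?_ h'
  rw [(hfd x).fderiv, (hfd y).fderiv]
  refine ContinuousLinearMap.opNorm_le_bound _ (abs_nonneg _) fun v => ?_
  rw [norm_pos_one, norm_pos_one, ← abs_mul]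
  simp [sub_mul]

end OneDimensional

section Separable

variable {d : ℕ} {U : Pos d → ℝ} {L m γ δ ℓ Lℓ : ℝ} {xs : Pos d} {Q : Pos d ≃ₗᵢ[ℝ] Pos d}
  {u : Fin d → ℝ → ℝ}

/-- A coordinate of the gradient depends on that coordinate alone; this decouples the Verlet map. -/
lemma Separable.gradient_coord (hS : Separable U ℓ Lℓ xs Q u) (x : Pos d) (i : Fin d) :
    coord Q i (gradient U x) = gradient (onLine (u i)) (coord Q i x) := by
  refine coord_ext_zero ?_
  rw [gradient_onLine (hS.1 i), coord_apply_zero, coord_apply_zero]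
  have hU : U = fun x => ∑ j, u j (Q.symm x j) := by
    funext x
    rw [← hS.2.1, Q.apply_symm_apply]
  have h1 : HasFDerivAt U (∑ j, deriv (u j) (Q.symm x j) •
      ((EuclideanSpace.proj j : Pos d →L[ℝ] ℝ).comp (Q.symm : Pos d →L[ℝ] Pos d))) x := by
    rw [hU]
    exact HasFDerivAt.fun_sum fun j _ =>
      (((hS.1 j).differentiable (by norm_num)) (Q.symm x j)).hasDerivAt.comp_hasFDerivAt x
        ((EuclideanSpace.proj j : Pos d →L[ℝ] ℝ).comp
          (Q.symm : Pos d →L[ℝ] Pos d)).hasFDerivAt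
  have h2 := inner_map_single (Q := Q) (i := i) (gradient U x) 1
  rw [one_mul] at h2
  rw [← h2, gradient, InnerProductSpace.toDual_symm_apply, h1.fderiv]
  simp

/-- Restriction to the i-th axis of the rotated frame is isometric, so both constants L and m are
inherited. -/
lemma Separable.potential (hS : Separable U ℓ Lℓ xs Q u) (hU : Potential U L m) (i : Fin d) :
    Potential (onLine (u i)) L m := by
  have hlift : ∀ y : Pos 1, coord Q i (Q (EuclideanSpace.single i (y 0))) = y := fun y =>
    coord_ext_zero (by simp [coord_apply_zero])
  have hgr : ∀ y, gradient (onLine (u i)) y =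
      coord Q i (gradient U (Q (EuclideanSpace.single i (y 0)))) := fun y => by
    rw [hS.gradient_coord, hlift]
  have hnorm : ∀ x y : Pos 1, Q (EuclideanSpace.single i (x 0)) - Q (EuclideanSpace.single i (y 0)) =
      Q (EuclideanSpace.single i ((x - y) 0)) := fun x y => by
    rw [← map_sub]
    congr 1
    ext j
    rcases eq_or_ne j i with rfl | h <;> simp [*]
  refine ⟨?_, fun x y => ?_, fun x y => ?_⟩
  · exact (hS.1 i).comp (EuclideanSpace.proj (0 : Fin 1) : Pos 1 →L[ℝ] ℝ).contDiff
  · rw [hgr, hgr, ← map_sub]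
    refine (norm_coord_le _).trans ((hU.gradLip _ _).trans (le_of_eq ?_))
    rw [hnorm, Q.norm_map, PiLp.norm_single, norm_pos_one, Real.norm_eq_abs]
  · have h := hU.strongConv (Q (EuclideanSpace.single i (x 0))) (Q (EuclideanSpace.single i (y 0)))
    rw [hnorm, Q.norm_map, PiLp.norm_single, real_inner_comm, inner_map_single,
      Real.norm_eq_abs] at h
    rw [hgr, hgr, ← map_sub, inner_pos_one, coord_apply_zero, norm_pos_one]
    exact h

lemma Separable.phaseCoord_verlet (hS : Separable U ℓ Lℓ xs Q u) (z : Phase d) (i : Fin d) :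
    phaseCoord Q i (verlet U δ z) = verlet (onLine (u i)) δ (phaseCoord Q i z) := by
  simp [phaseCoord, verlet, hS.gradient_coord]

lemma Separable.hamiltonian_eq (hS : Separable U ℓ Lℓ xs Q u) (z : Phase d) :
    hamiltonian U z = ∑ i, hamiltonian (onLine (u i)) (phaseCoord Q i z) := by
  simp only [hamiltonian, phaseCoord, onLine]
  rw [Finset.sum_add_distrib, ← Finset.sum_div]
  change _ = ∑ i, u i (coord Q i z.fst 0) + (∑ i, ‖coord Q i z.snd‖ ^ 2) / 2
  rw [← norm_sq_eq_sum_coord (Q := Q) z.snd]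
  simp only [coord_apply_zero]
  rw [← hS.2.1, Q.apply_symm_apply]

lemma lintegral_coord_stdGaussian (i : Fin d) {f : Pos 1 → ℝ≥0∞} (hf : Measurable f) :
    ∫⁻ g, f (coord Q i g) ∂stdGaussian (Pos d) = ∫⁻ g, f g ∂stdGaussian (Pos 1) := by
  rw [← map_coord_stdGaussian (Q := Q) (i := i), lintegral_map hf (coord Q i).continuous.measurable]

/-- Projecting the chain to one coordinate pair gives the one-dimensional chain, as each coordinate
of a standard Gaussian vector is standard Gaussian. Only marginals are involved; independence
between coordinates plays no role. -/
lemma Separable.lintegral_obaboKernel (hS : Separable U ℓ Lℓ xs Q u) (i : Fin d)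
    {f : Phase 1 → ℝ≥0∞} (hf : Measurable f) (z : Phase d) :
    ∫⁻ w, f (phaseCoord Q i w) ∂obaboKernel U γ δ z =
      ∫⁻ w, f w ∂obaboKernel (onLine (u i)) γ δ (phaseCoord Q i z) := by
  have hfc : Measurable fun w : Phase d => f (phaseCoord Q i w) := hf.comp measurable_phaseCoord
  rw [Langevin.lintegral_obaboKernel _ hfc, Langevin.lintegral_obaboKernel _ hf]
  have hm : Measurable fun p : Pos 1 × Pos 1 =>
      f (obaboStep (onLine (u i)) γ δ (phaseCoord Q i z) p.1 p.2) :=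
    hf.comp (measurable_obaboStep_right _)
  have e : ∀ g g' : Pos d, phaseCoord Q i (obaboStep U γ δ z g g') =
      obaboStep (onLine (u i)) γ δ (phaseCoord Q i z) (coord Q i g) (coord Q i g') := fun g g' => by
    simp only [obaboStep, phaseCoord_stepO, hS.phaseCoord_verlet]
  simp only [e]
  rw [← lintegral_coord_stdGaussian (Q := Q) i hm.lintegral_prod_right']
  refine lintegral_congr fun g => ?_
  exact lintegral_coord_stdGaussian (Q := Q) i (hm.comp measurable_prodMk_left)

lemma Separable.lintegral_law (hS : Separable U ℓ Lℓ xs Q u) (i : Fin d) (ν : Measure (Phase d))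
    (k : ℕ) {f : Phase 1 → ℝ≥0∞} (hf : Measurable f) :
    ∫⁻ z, f (phaseCoord Q i z) ∂law (obaboKernel U γ δ) ν k =
      ∫⁻ z, f z ∂law (obaboKernel (onLine (u i)) γ δ) (ν.map (phaseCoord Q i)) k := by
  induction k generalizing f with
  | zero => rw [law_zero, law_zero, lintegral_map hf measurable_phaseCoord]
  | succ k ih =>
    have hfc : Measurable fun w : Phase d => f (phaseCoord Q i w) := hf.comp measurable_phaseCoord
    rw [lintegral_law_succ _ _ _ hf, lintegral_law_succ _ _ _ hfc, ← ih hf.lintegral_kernel]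
    exact lintegral_congr fun z => hS.lintegral_obaboKernel i hf z

lemma K_ten_nonneg (hP : Params L m γ δ) (hLℓ : 0 < Lℓ) : 0 ≤ K_ten L m γ δ ℓ Lℓ := by
  have h1 := cubicFactor_pos hP ℓ
  have h2 := cubicConst_pos hP.L_pos hP.δ_pos ℓ hLℓ
  have h3 : 0 < rate m γ := pos_of_mul_pos_left hP.rate_pos hP.δ_pos.le
  rw [K_ten_eq]
  positivity

lemma K₉_nonneg (hP : Params L m γ δ) : 0 ≤ K₉ L m γ δ := by
  have h1 : 0 < rate m γ := pos_of_mul_pos_left hP.rate_pos hP.δ_pos.le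
  have h2 := hP.L_pos
  have h3 := hP.δ_pos
  rw [K₉]
  positivity

/-- The sum of the expected rejections for a separable potential. -/
lemma sumRej_le_separable (hU : Potential U L m) (hP : Params L m γ δ)
    (hxs : gradient U xs = 0) (hℓ : 2 ≤ ℓ) (hLℓ : 0 < Lℓ) (hS : Separable U ℓ Lℓ xs Q u)
    {ν : Measure (Phase d)} (hν : InP (ℓ + 1) ν) (n : ℕ) :
    sumRej U γ δ ν n ≤ ENNReal.ofReal (δ ^ 2 * K_ten L m γ δ ℓ Lℓ *
      ((∑ i, coordMoment Q xs i (ℓ + 1) ν) + δ * n * d * ℓ ^ ((ℓ + 1) / 2))) := by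
  have hL := hP.L_pos
  have hδ := hP.δ_pos
  have hC := cubicConst_pos (L := L) (δ := δ) hL hδ ℓ hLℓ
  have hKnn : 0 ≤ K_ten L m γ δ ℓ Lℓ := K_ten_nonneg hP hLℓ
  obtain ⟨B, hB⟩ : ∃ B : Fin d → Phase 1 → ℝ, ∀ i z, B i z =
    δ ^ 3 * (51 / 100 * cubicConst L δ ℓ Lℓ) * (1 + ‖z - mk (coord Q i xs) 0‖ ^ (ℓ + 1)) :=
    ⟨_, fun _ _ => rfl⟩
  have hB0 : ∀ i z, 0 ≤ B i z := fun i z => by rw [hB]; positivity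
  have hBm : ∀ i, Measurable (B i) := fun i => by
    rw [show B i = _ from funext (hB i)]; fun_prop
  -- Acceptance is decided jointly, but the total energy error is the sum of one-dimensional errors,
  -- each bounded by its own cubic estimate.
  have hacc : ∀ z : Phase d, 1 - accept U δ z ≤ ∑ i, B i (phaseCoord Q i z) := fun z => by
    refine one_sub_accept_le (Finset.sum_nonneg fun i _ => hB0 i _) ?_
    rw [hS.hamiltonian_eq, hS.hamiltonian_eq, ← Finset.sum_sub_distrib]
    refine Finset.sum_le_sum fun i _ => ?_
    have hpot := hS.potential hU i
    rw [hS.phaseCoord_verlet, hB]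
    refine energy_error_le_cubic hpot.contDiff hL hpot.gradLip hδ hP.δ_mul_L_sq ?_ hℓ hLℓ
      (hessPol_onLine (hS.1 i) _ ?_) _
    · rw [← hS.gradient_coord, hxs, map_zero]
    · rw [coord_apply_zero]; exact hS.2.2 i
  have hBO : ∀ i, Measurable fun p : Phase 1 × Pos 1 => ENNReal.ofReal (B i (stepO γ δ p.1 p.2)) :=
    fun i => ((hBm i).comp (measurable_stepO γ δ)).ennreal_ofReal
  have hrej : ∀ z : Phase d, rej U γ δ z ≤ ∑ i, ∫⁻ g, ENNReal.ofReal
      (B i (stepO γ δ (phaseCoord Q i z) g)) ∂stdGaussian (Pos 1) := fun z => by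
    have e : ∀ i, ∫⁻ g, ENNReal.ofReal (B i (stepO γ δ (phaseCoord Q i z) g)) ∂stdGaussian (Pos 1) =
        ∫⁻ g, ENNReal.ofReal (B i (phaseCoord Q i (stepO γ δ z g))) ∂stdGaussian (Pos d) :=
      fun i => by
        simp only [phaseCoord_stepO]
        exact (lintegral_coord_stdGaussian i ((hBO i).comp measurable_prodMk_left)).symm
    simp only [e]
    rw [← lintegral_finsetSum]
    · refine lintegral_mono fun g => ?_
      rw [← ENNReal.ofReal_sum_of_nonneg fun i _ => hB0 i _]
      exact ENNReal.ofReal_le_ofReal (hacc _)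
    · exact fun i _ => ((hBm i).comp (measurable_phaseCoord.comp
        ((measurable_stepO γ δ).comp measurable_prodMk_left))).ennreal_ofReal
  have hI : ∀ i, Measurable fun z : Phase 1 => ∫⁻ g, ENNReal.ofReal (B i (stepO γ δ z g))
      ∂stdGaussian (Pos 1) := fun i => (hBO i).lintegral_prod_right'
  calc sumRej U γ δ ν n ≤ ∑ k ∈ Finset.range n, ∑ i, ∫⁻ z, ∫⁻ g,
        ENNReal.ofReal (B i (stepO γ δ z g)) ∂stdGaussian (Pos 1)
          ∂law (obaboKernel (onLine (u i)) γ δ) (ν.map (phaseCoord Q i)) k := by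
        refine Finset.sum_le_sum fun k _ => (lintegral_mono hrej).trans (le_of_eq ?_)
        have hIc : ∀ i, Measurable fun z : Phase d => ∫⁻ g, ENNReal.ofReal
            (B i (stepO γ δ (phaseCoord Q i z) g)) ∂stdGaussian (Pos 1) :=
          fun i => (hI i).comp measurable_phaseCoord
        rw [lintegral_finsetSum _ fun i _ => hIc i]
        exact Finset.sum_congr rfl fun i _ => hS.lintegral_law i ν k (hI i)
    _ = ∑ i, ∑ k ∈ Finset.range n, ∫⁻ z, ∫⁻ g,
        ENNReal.ofReal (B i (stepO γ δ z g)) ∂stdGaussian (Pos 1)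
          ∂law (obaboKernel (onLine (u i)) γ δ) (ν.map (phaseCoord Q i)) k := Finset.sum_comm
    _ ≤ ∑ i, ENNReal.ofReal (δ ^ 2 * K_ten L m γ δ ℓ Lℓ *
          (coordMoment Q xs i (ℓ + 1) ν + δ * n * ℓ ^ ((ℓ + 1) / 2))) := by
        refine Finset.sum_le_sum fun i _ => ?_
        have h := sum_lintegral_cubic_le one_pos (hS.potential hU i) hP
          (xs := coord Q i xs) (by rw [← hS.gradient_coord, hxs, map_zero]) hℓ hC
          (hν.map_phaseCoord (Q := Q) (i := i) (by linarith)) n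
        -- In dimension one the base d + ℓ - 1 reduces to ℓ.
        rw [momentAt_map_phaseCoord, ← K_ten_eq, Nat.cast_one, add_sub_cancel_left] at h
        simpa only [hB] using h
    _ = _ := by
        have hM : ∀ i, 0 ≤ coordMoment Q xs i (ℓ + 1) ν := fun i =>
          integral_nonneg fun z => by positivity
        rw [← ENNReal.ofReal_sum_of_nonneg fun i _ => by have := hM i; positivity,
          ← Finset.mul_sum, Finset.sum_add_distrib, Finset.sum_const, Finset.card_univ,
          Fintype.card_fin, nsmul_eq_mul]
        congr 3
        ring

end Separable

end Langevin
end

open Langevin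

theorem mainTheorem9 (d : ℕ) (hd : 0 < d) (U : Pos d → ℝ) (hU : ContDiff ℝ 2 U)
    (L m γ δ : ℝ) (hL : 0 < L) (hLip : GradLip U L) (hm : 0 < m) (hConv : StrongConv U m)
    (hγ : 2 * √L ≤ γ) (hδ : 0 < δ) (hδ' : δ ≤ m / (33 * γ ^ 3)) :
    -- the global minimum
    ∃ xs : Pos d, (∀ x, x ≠ xs → U xs < U x) ∧
    -- the unique invariant probability measure of the unadjusted chain
    ∃ πδ : Measure (Phase d),
      IsProbabilityMeasure πδ ∧ (obaboKernel U γ δ).Invariant πδ ∧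
      (∀ ν : Measure (Phase d), IsProbabilityMeasure ν → (obaboKernel U γ δ).Invariant ν →
        ν = πδ) ∧
      (∀ p : ℝ, 1 ≤ p → InP p πδ) ∧
    -- the additive error and its bounds
    ∃ err : Measure (Phase d) → ℕ → ℝ,
      (∀ (ν : Measure (Phase d)) (n : ℕ), 1 ≤ n → InP 2 ν →
        err ν n ≤ δ * K₉ L m γ δ * (momentAt xs 2 ν + δ * n * d)) ∧
      (∀ ℓ Lℓ : ℝ, 2 ≤ ℓ → 0 < Lℓ → HessPol U ℓ Lℓ xs →
        ∀ (ν : Measure (Phase d)) (n : ℕ), 1 ≤ n → InP (ℓ + 1) ν →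
          err ν n ≤ δ ^ 2 * K_ten L m γ δ ℓ Lℓ *
            (momentAt xs (ℓ + 1) ν + δ * n * (d + ℓ - 1) ^ ((ℓ + 1) / 2))) ∧
      (∀ (ℓ Lℓ : ℝ) (Q : Pos d ≃ₗᵢ[ℝ] Pos d) (u : Fin d → ℝ → ℝ), 2 ≤ ℓ → 0 < Lℓ →
        Separable U ℓ Lℓ xs Q u →
        ∀ (ν : Measure (Phase d)) (n : ℕ), 1 ≤ n → InP (ℓ + 1) ν →
          err ν n ≤ δ ^ 2 * K_ten L m γ δ ℓ Lℓ *
            ((∑ i, coordMoment Q xs i (ℓ + 1) ν) + δ * n * d * ℓ ^ ((ℓ + 1) / 2))) ∧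
      -- the concentration inequality
      ∀ (μ₀ : Measure (Phase d)) (C' : ℝ), IsProbabilityMeasure μ₀ → 0 < C' → LogSobolev μ₀ C' →
        ∀ (Ω : Type*) [MeasurableSpace Ω] (Pr : Measure Ω) [IsProbabilityMeasure Pr]
          (Z : ℕ → Ω → Phase d), IsMarkovChain (ombaboKernel U γ δ) μ₀ Pr Z →
        ∀ φ : Phase d → ℝ, LipschitzWith 1 φ → Integrable φ (gibbs U) ∧
        ∀ (n : ℕ) (r : ℝ), 1 ≤ n → 0 ≤ r →
          Pr.real {ω | r + 2 * K₁ L / (n * rate m γ * δ) * (wasserstein μ₀ πδ).toReal +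
                (wasserstein (gibbs U) πδ).toReal ≤
              |(∑ k ∈ Finset.Icc 1 n, φ (Z k ω)) / n - ∫ z, φ z ∂gibbs U|} ≤
            2 * Real.exp (-(n * r ^ 2 * rate m γ * δ /
              (4 * ClS L m γ δ + 4 * K₁ L ^ 2 * C' / (n * rate m γ * δ)))) + err μ₀ n := by
  have hsL : 0 < √L := Real.sqrt_pos.2 hL
  have hγ0 : 0 < γ := by linarith
  have hP : Params L m γ δ :=
    { L_pos := hL
      m_pos := hm
      m_le := strongConv_le_gradLip hd hLip hConv
      γ_pos := hγ0
      γ_sq := by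
        have h := pow_le_pow_left₀ (by positivity) hγ 2
        rw [mul_pow, Real.sq_sqrt hL.le] at h
        linarith
      δ_pos := hδ
      δ_le := (le_div_iff₀ (by positivity)).1 hδ' }
  have hpot : Potential U L m := ⟨hU, hLip, hConv⟩
  obtain ⟨xs, hxs, hmin⟩ := exists_isMin hU hm hConv
  obtain ⟨πδ, hπp, hπ⟩ := exists_invariant hd hpot hP
  refine ⟨xs, fun x hx => ?_, πδ, hπp, hπ, fun ν hν hνi => invariant_unique hd hpot hP hνi hπ,
    fun p hp => InP_of_invariant hd hpot hP hπ hp, fun ν n => (sumRej U γ δ ν n).toReal, ?_, ?_, ?_,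
    ?_⟩
  · have h1 : 0 < ‖x - xs‖ := norm_pos_iff.2 (sub_ne_zero.2 hx)
    have h2 : 0 < m / 2 * ‖x - xs‖ ^ 2 := by positivity
    linarith [hmin x]
  · intro ν n _ hν
    have hK := K₉_nonneg hP
    exact ENNReal.toReal_le_of_le_ofReal
      (mul_nonneg (mul_nonneg hδ.le hK) (add_nonneg (momentAt_nonneg _ _ _) (by positivity)))
      (sumRej_le_quadratic hd hpot hP hxs hν n)
  · intro ℓ Lℓ hℓ hLℓ hH ν n _ hν
    have hK := K_ten_nonneg hP (ℓ := ℓ) hLℓ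
    have hd1 : (1 : ℝ) ≤ d := by exact_mod_cast hd
    have h1 : 0 ≤ (d : ℝ) + ℓ - 1 := by linarith
    exact ENNReal.toReal_le_of_le_ofReal
      (mul_nonneg (mul_nonneg (sq_nonneg _) hK)
        (add_nonneg (momentAt_nonneg _ _ _) (by positivity)))
      (sumRej_le_cubic hd hpot hP hxs hℓ hLℓ hH hν n)
  · intro ℓ Lℓ Q u hℓ hLℓ hS ν n _ hν
    have hK := K_ten_nonneg hP (ℓ := ℓ) hLℓ
    exact ENNReal.toReal_le_of_le_ofReal
      (mul_nonneg (mul_nonneg (sq_nonneg _) hK)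
        (add_nonneg (Finset.sum_nonneg fun i _ => integral_nonneg fun z => by positivity)
          (by positivity)))
      (sumRej_le_separable hpot hP hxs hℓ hLℓ hS hν n)
  · intro μ₀ C' hμp hC' hμ Ω _ Pr _ Z hZ φ hφ
    obtain ⟨hgp, hgn⟩ := gibbs_spec hpot hm
    exact ⟨integrable_of_lipschitz_of_integrable_norm hφ hgn, fun n r hn hr =>
      concentration hd hpot hP hπ hC' hμ hZ hφ hn hr⟩
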